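/- Notation. Let $n\ge 2$, $T>0$, $\mathbb T=[0,1)^n$ the flat torus. All functions and distributions are real-valued; torus distributions are the continuous linear functionals on $C^\infty_\#$, the smooth $1$-periodic functions on $\mathbb R^n$; $\hat g(\xi)=\langle g,e^{-2\pi i x\cdot\xi}\rangle$ for $\xi\in\mathbb Z^n$, and $\varrho(\xi)=2\pi(1+|\xi|^2)^{1/2}$. For $s\in\mathbb R$, $H^s_\#$ is the space of torus distributions with $\|g\|_{H^s_\#}^2=\sum_\xi\varrho(\xi)^{2s}|\hat g(\xi)|^2<\infty$; $\dot H^s_\#$ is its subspace $\hat g(0)=0$; boldface denotes $n$-component vectors, and $\dot{\mathbf H}^s_{\#\sigma}=\{\mathbf w\in\dot{\mathbf H}^s_\#:\operatorname{div}\mathbf w=0\}$. The dual product is $\langle g,f\rangle=\sum_\xi\hat g(\xi)\hat f(-\xi)$ (summed over components for vectors), $\Lambda_\#^r$ is the operator with $\widehat{\Lambda_\#^r g}(\xi)=\varrho(\xi)^r\hat g(\xi)$, and $\mathbb P_\sigma$ is the Leray projector, $\widehat{\mathbb P_\sigma\mathbf F}(\xi)=\hat{\mathbf F}(\xi)-\xi\,(\xi\cdot\hat{\mathbf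 F}(\xi))/|\xi|^2$ for $\xi\ne0$ and $\widehat{\mathbb P_\sigma\mathbf F}(0)=0$. A prime denotes the time derivative in the sense of distributions on $(0,T)$, and $W^1(X,Y)=\{\mathbf v\in L_2(0,T;X):\mathbf v'\in L_2(0,T;Y)\}$. Let $a_{ij}^{\alpha\beta}(x,t)$ ($1\le i,j,\alpha,\beta\le n$) be essentially bounded on $\mathbb R^n\times(0,T)$, $1$-periodic in $x$, with $a_{kj}^{\alpha\beta}=a_{\alpha j}^{k\beta}=a_{k\beta}^{\alpha j}$ (no ellipticity is needed), and put, with summation over repeated indices, $$a_{\mathbb T}(t;\mathbf u,\mathbf v)=\int_{\mathbb T}a_{ij}^{\alpha\beta}(x,t)\,E_{j\beta}(\mathbf u)\,E_{i\alpha}(\mathbf v)\,dx,\qquad E_{j\beta}(\mathbf u)=\tfrac12(\partial_j u_\beta+\partial_\beta u_j),\qquad \mathbf u,\mathbf v\in\mathbf H^1_\# .$$ Lemma. Let $\mathbf f\in L_2(0,T;\dot{\mathbf H}^{-1}_\#)$ and let $\mathbf u\in L_\infty(0,T;\dot{\mathbf H}^0_{\#\sigma})\cap L_2(0,T;\dot{\mathbf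 H}^1_{\#\sigma})$, with time derivative $\mathbf u'(\cdot,t)$ (a function of $t$ with values in the torus distributions), solve $$\langle\mathbf u'(\cdot,t)+\mathbb P_\sigma[(\mathbf u\cdot\nabla)\mathbf u](\cdot,t),\mathbf w\rangle+a_{\mathbb T}(t;\mathbf u(\cdot,t),\mathbf w)=\langle\mathbf f(\cdot,t),\mathbf w\rangle\quad\text{for a.e. }t\in(0,T),\ \forall\,\mathbf w\in\dot{\mathbf H}^1_{\#\sigma}.$$ (i) Then $\mathbf u'+\mathbb P_\sigma[(\mathbf u\cdot\nabla)\mathbf u]\in L_2(0,T;\dot{\mathbf H}^{-1}_{\#\sigma})$, $(\mathbf u\cdot\nabla)\mathbf u\in L_2(0,T;\dot{\mathbf H}^{-n/2}_\#)$ and $\mathbf u'\in L_2(0,T;\dot{\mathbf H}^{-n/2}_{\#\sigma})$, and for a.e. $t$ the values at $t$ lie in the respective spaces $\dot{\mathbf H}^{-1}_{\#\sigma}$, $\dot{\mathbf H}^{-n/2}_\#$, $\dot{\mathbf H}^{-n/2}_{\#\sigma}$; hence $\mathbf u\in W^1(\dot{\mathbf H}^1_{\#\sigma},\dot{\mathbf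 H}^{-n/2}_{\#\sigma})$. In addition, $$\partial_t\|\mathbf u\|^2_{\mathbf H^{-(n-2)/4}_\#}=2\langle\Lambda_\#^{-n/2}\mathbf u',\Lambda_\#\mathbf u\rangle=2\langle\mathbf u',\Lambda_\#^{1-n/2}\mathbf u\rangle=2\langle\Lambda_\#^{1-n/2}\mathbf u',\mathbf u\rangle$$ in the sense of distributions on $(0,T)$, and also at a.e. $t\in(0,T)$ when $\mathbf u$ on the left is redefined on a null set of times as the function $\widetilde{\mathbf u}$ of (ii). (ii) There is $\widetilde{\mathbf u}\in C^0([0,T];\dot{\mathbf H}^{-(n-2)/4}_{\#\sigma})$ with $\mathbf u(\cdot,t)=\widetilde{\mathbf u}(\cdot,t)$ for a.e. $t$. It is also $\dot{\mathbf H}^0_{\#\sigma}$-weakly continuous on $[0,T]$: $\widetilde{\mathbf u}(\cdot,t)\in\dot{\mathbf H}^0_{\#\sigma}$ for all $t\in[0,T]$, and $\lim_{t\to t_0}\langle\widetilde{\mathbf u}(\cdot,t),\mathbf w\rangle=\langle\widetilde{\mathbf u}(\cdot,t_0),\mathbf w\rangle$ for all $\mathbf w\in\mathbf H^0_\#$ and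 $t_0\in[0,T]$. (iii) There is an associated pressure $p\in L_2(0,T;\dot H^{1-n/2}_\#)$, that is, $$\langle\mathbf u'(\cdot,t)+(\mathbf u\cdot\nabla)\mathbf u(\cdot,t),\mathbf w\rangle+a_{\mathbb T}(t;\mathbf u(\cdot,t),\mathbf w)+\langle\nabla p(\cdot,t),\mathbf w\rangle=\langle\mathbf f(\cdot,t),\mathbf w\rangle\quad\text{for a.e. }t\in(0,T),\ \forall\,\mathbf w\in\mathbf C^\infty_\#,$$ and for the given $\mathbf u$ it is unique in $L_2(0,T;\dot H^{1-n/2}_\#)$ (up to a null set of times). -/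

import Mathlib

open MeasureTheory Filter Topology
open scoped ContDiff ENNReal

noncomputable section

namespace PeriodicNS

/-! ## Periodic test functions and torus distributions -/

/-- The fundamental cell `[0,1)ⁿ` of the flat torus. -/
def cube (n : ℕ) : Set (Fin n → ℝ) := Set.univ.pi fun _ => Set.Ico (0 : ℝ) 1

/-- Real-valued smooth functions on the torus: the smooth `1`-periodic functions on `ℝⁿ`. -/
def testFnSpace (n : ℕ) : Submodule ℝ ((Fin n → ℝ) → ℝ) where
  carrier := {φ | ContDiff ℝ ∞ φ ∧
    ∀ (x : Fin n → ℝ) (m : Fin n → ℤ), φ (x + fun i => (m i : ℝ)) = φ x}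
  add_mem' := by
    rintro φ ψ ⟨h1, h2⟩ ⟨h3, h4⟩
    exact ⟨h1.add h3, fun x m => by simp [h2, h4]⟩
  zero_mem' := ⟨contDiff_const, fun _ _ => rfl⟩
  smul_mem' := by
    rintro c φ ⟨h1, h2⟩
    exact ⟨contDiff_const.smul h1, fun x m => by simp [h2]⟩

/-- The type of real-valued periodic test functions. -/
abbrev TestFn (n : ℕ) : Type := testFnSpace n

/-- Real torus distributions: the linear functionals on the periodic smooth functions that are
continuous for the seminorms `sup_x ‖Dᵏ φ(x)‖`, i.e. bounded by finitely many of them. -/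
def torusDistSpace (n : ℕ) : Submodule ℝ (TestFn n →ₗ[ℝ] ℝ) where
  carrier := {g | ∃ (N : ℕ) (C : ℝ), ∀ (φ : TestFn n) (B : ℝ),
    (∀ k ≤ N, ∀ x, ‖iteratedFDeriv ℝ k (φ : (Fin n → ℝ) → ℝ) x‖ ≤ B) → |g φ| ≤ C * B}
  add_mem' := by
    rintro g h ⟨N, C, hg⟩ ⟨M, D, hh⟩
    refine ⟨max N M, C + D, fun φ B hB => ?_⟩
    have h1 := hg φ B fun k hk => hB k (hk.trans (le_max_left _ _))
    have h2 := hh φ B fun k hk => hB k (hk.trans (le_max_right _ _))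
    calc |(g + h) φ| ≤ |g φ| + |h φ| := abs_add_le _ _
      _ ≤ (C + D) * B := by linarith
  zero_mem' := ⟨0, 0, fun φ B _ => by simp⟩
  smul_mem' := by
    rintro c g ⟨N, C, hg⟩
    refine ⟨N, |c| * C, fun φ B hB => ?_⟩
    have h1 := hg φ B hB
    calc |(c • g) φ| = |c| * |g φ| := by simp [abs_mul]
      _ ≤ |c| * (C * B) := by gcongr
      _ = |c| * C * B := by ring

/-- The type of real torus distributions. -/
abbrev TorusDist (n : ℕ) : Type := torusDistSpace n

/-- Vector-valued torus distributions. -/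
abbrev VecDist (n : ℕ) : Type := Fin n → TorusDist n

variable {n : ℕ}

/-- The partial derivative `∂_j φ` of a test function. -/
def TestFn.partialDeriv (j : Fin n) : TestFn n →ₗ[ℝ] TestFn n where
  toFun φ := ⟨fun x => fderiv ℝ (φ : (Fin n → ℝ) → ℝ) x (Pi.single j 1), by
    refine ⟨(φ.2.1.fderiv_right (m := ∞) (by simp)).clm_apply contDiff_const, fun x m => ?_⟩
    have h : (fun y => (φ : (Fin n → ℝ) → ℝ) (y + fun i => (m i : ℝ))) = φ :=
      funext fun y => φ.2.2 y m
    beta_reduce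
    rw [← fderiv_comp_add_right, h]⟩
  map_add' φ ψ := by
    ext x
    simp [fderiv_add (φ.2.1.differentiable (by simp) x) (ψ.2.1.differentiable (by simp) x)]
  map_smul' c φ := by
    ext x
    simp [fderiv_const_smul (φ.2.1.differentiable (by simp) x) c]

theorem TestFn.norm_iteratedFDeriv_partialDeriv_le (j : Fin n) (φ : TestFn n) (k : ℕ)
    (x : Fin n → ℝ) :
    ‖iteratedFDeriv ℝ k (TestFn.partialDeriv j φ : (Fin n → ℝ) → ℝ) x‖ ≤
      ‖iteratedFDeriv ℝ (k + 1) (φ : (Fin n → ℝ) → ℝ) x‖ := by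
  have hsm : ContDiff ℝ ∞ (fderiv ℝ (φ : (Fin n → ℝ) → ℝ)) :=
    φ.2.1.fderiv_right (m := ∞) (by simp)
  have h := ContinuousLinearMap.norm_iteratedFDeriv_comp_left
    (ContinuousLinearMap.apply ℝ ℝ (Pi.single j 1 : Fin n → ℝ)) (x := x) hsm.contDiffAt
    (n := k) (N := (∞ : WithTop ℕ∞)) (by exact_mod_cast le_top)
  rw [norm_iteratedFDeriv_fderiv] at h
  refine (show _ ≤ _ from h).trans ?_
  have h1 : ‖ContinuousLinearMap.apply ℝ ℝ (Pi.single j 1 : Fin n → ℝ)‖ ≤ 1 := by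
    refine ContinuousLinearMap.opNorm_le_bound _ zero_le_one fun L => ?_
    have h2 := L.le_opNorm (Pi.single j 1 : Fin n → ℝ)
    rw [Pi.norm_single, norm_one, mul_one] at h2
    simpa using h2
  calc _ ≤ 1 * ‖iteratedFDeriv ℝ (k + 1) (φ : (Fin n → ℝ) → ℝ) x‖ := by gcongr
    _ = _ := one_mul _

/-- The distributional derivative `∂_j g`, `⟨∂_j g, φ⟩ = -⟨g, ∂_j φ⟩`. -/
def TorusDist.partialDeriv (j : Fin n) (g : TorusDist n) : TorusDist n :=
  ⟨-(g.1 ∘ₗ TestFn.partialDeriv j), by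
    obtain ⟨N, C, hg⟩ := g.2
    refine ⟨N + 1, C, fun φ B hB => ?_⟩
    have := hg (TestFn.partialDeriv j φ) B fun k hk x =>
      (TestFn.norm_iteratedFDeriv_partialDeriv_le j φ k x).trans (hB (k + 1) (by omega) x)
    simpa using this⟩

theorem TestFn.integrableOn_mul {f : (Fin n → ℝ) → ℝ} (hf : IntegrableOn f (cube n))
    (φ : TestFn n) :
    IntegrableOn (fun x => f x * (φ : (Fin n → ℝ) → ℝ) x) (cube n) := by
  have hc : Continuous (φ : (Fin n → ℝ) → ℝ) := φ.2.1.continuous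
  obtain ⟨C, hC⟩ := (isCompact_Icc (a := (0 : Fin n → ℝ)) (b := 1)).exists_bound_of_continuousOn
    hc.continuousOn
  have hmeas : MeasurableSet (cube n) := MeasurableSet.univ_pi fun _ => measurableSet_Ico
  refine Integrable.mul_bdd (c := C) hf hc.aestronglyMeasurable ?_
  filter_upwards [ae_restrict_mem hmeas] with x hx
  exact hC x ⟨fun i => (hx i trivial).1, fun i => (hx i trivial).2.le⟩

open Classical in
/-- The torus distribution `φ ↦ ∫ f φ` given by a function integrable on the cell
(`0` if `f` is not integrable). -/
def TorusDist.ofFun (f : (Fin n → ℝ) → ℝ) : TorusDist n :=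
  if hf : IntegrableOn f (cube n) then
    ⟨{ toFun := fun φ => ∫ x in cube n, f x * (φ : (Fin n → ℝ) → ℝ) x
       map_add' := fun φ ψ => by
        simp only [Submodule.coe_add, Pi.add_apply, mul_add]
        exact integral_add (TestFn.integrableOn_mul hf φ) (TestFn.integrableOn_mul hf ψ)
       map_smul' := fun c φ => by
        simp only [SetLike.val_smul, Pi.smul_apply, smul_eq_mul, RingHom.id_apply]
        rw [← integral_const_mul]
        congr 1
        ext x
        ring }, by
      refine ⟨0, ∫ x in cube n, |f x|, fun φ B hB => ?_⟩
      change |∫ x in cube n, f x * (φ : (Fin n → ℝ) → ℝ) x| ≤ _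
      rw [← integral_mul_const]
      refine (abs_integral_le_integral_abs).trans
        (integral_mono (TestFn.integrableOn_mul hf φ).abs (hf.abs.mul_const B) fun x => ?_)
      have := hB 0 le_rfl x
      rw [norm_iteratedFDeriv_zero, Real.norm_eq_abs] at this
      simp only [abs_mul]
      gcongr⟩
  else 0

/-- A test function, or a vector of them, seen as a distribution. -/
def TestFn.toDist (φ : TestFn n) : TorusDist n := TorusDist.ofFun φ

open Classical in
/-- The (almost everywhere unique) integrable function on the cell that a regular distribution is
given by; `0` if the distribution is not given by an integrable function. -/
def TorusDist.toFun (g : TorusDist n) : (Fin n → ℝ) → ℝ :=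
  if h : ∃ f : (Fin n → ℝ) → ℝ, IntegrableOn f (cube n) ∧ TorusDist.ofFun f = g then
    h.choose else 0

/-! ## Fourier coefficients -/

theorem phase_add (ξ m : Fin n → ℤ) (x : Fin n → ℝ) :
    2 * Real.pi * ∑ i, (x + fun i => (m i : ℝ)) i * (ξ i : ℝ) =
      2 * Real.pi * ∑ i, x i * (ξ i : ℝ) + ((∑ i, m i * ξ i : ℤ) : ℝ) * (2 * Real.pi) := by
  push_cast
  simp only [Pi.add_apply, add_mul, Finset.sum_add_distrib]
  ring

theorem contDiff_phase (ξ : Fin n → ℤ) :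
    ContDiff ℝ ∞ fun x : Fin n → ℝ => 2 * Real.pi * ∑ i, x i * (ξ i : ℝ) :=
  contDiff_const.mul (ContDiff.sum fun i _ => (contDiff_apply ℝ ℝ i).mul contDiff_const)

/-- `x ↦ cos (2π x·ξ)`. -/
def cosFn (ξ : Fin n → ℤ) : TestFn n :=
  ⟨fun x => Real.cos (2 * Real.pi * ∑ i, x i * (ξ i : ℝ)),
    Real.contDiff_cos.comp (contDiff_phase ξ), fun x m => by
      beta_reduce
      rw [phase_add, Real.cos_add_int_mul_two_pi]⟩

/-- `x ↦ sin (2π x·ξ)`. -/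
def sinFn (ξ : Fin n → ℤ) : TestFn n :=
  ⟨fun x => Real.sin (2 * Real.pi * ∑ i, x i * (ξ i : ℝ)),
    Real.contDiff_sin.comp (contDiff_phase ξ), fun x m => by
      beta_reduce
      rw [phase_add, Real.sin_add_int_mul_two_pi]⟩

/-- The Fourier coefficient `ĝ(ξ) = ⟨g, e^{-2πi x·ξ}⟩`, where
`e^{-2πi x·ξ} = cos (2π x·ξ) - i sin (2π x·ξ)`. -/
def TorusDist.fourier (g : TorusDist n) (ξ : Fin n → ℤ) : ℂ :=
  (g.1 (cosFn ξ) : ℂ) - Complex.I * (g.1 (sinFn ξ) : ℂ)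

open Classical in
/-- The distribution `∑_ξ c(ξ) e^{2πi x·ξ}`, i.e. the (unique) real torus distribution with the
Fourier coefficients `c`. It exists exactly if `c` grows at most polynomially and
`c(-ξ)` is the complex conjugate of `c(ξ)`; otherwise the value is `0`. -/
def TorusDist.ofFourier (c : (Fin n → ℤ) → ℂ) : TorusDist n :=
  if h : ∃ g : TorusDist n, ∀ ξ, g.fourier ξ = c ξ then h.choose else 0

/-- `|ξ|²`. -/
def freqSq (ξ : Fin n → ℤ) : ℝ := ∑ i, (ξ i : ℝ) ^ 2

/-- `ϱ(ξ) = 2π (1 + |ξ|²)^{1/2}`. -/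
def rho (ξ : Fin n → ℤ) : ℝ := 2 * Real.pi * Real.sqrt (1 + freqSq ξ)

/-- The dual product `⟨g, f⟩ = ∑_ξ ĝ(ξ) f̂(-ξ)`. For real `g`, `f` the terms at `ξ` and `-ξ` are
complex conjugate to each other, so the sum is real. -/
def dual (g f : TorusDist n) : ℝ := (∑' ξ : Fin n → ℤ, g.fourier ξ * f.fourier (-ξ)).re

/-- The dual product of vector distributions. -/
def vecDual (G F : VecDist n) : ℝ := ∑ k, dual (G k) (F k)

/-- A vector distribution applied to a vector of test functions. -/
def vecApply (G : VecDist n) (w : Fin n → TestFn n) : ℝ := ∑ k, (G k).1 (w k)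

/-- The periodic Bessel potential operator `Λ^r`, acting on vectors componentwise. -/
def bessel (r : ℝ) (G : VecDist n) : VecDist n := fun k =>
  TorusDist.ofFourier fun ξ => ((rho ξ ^ r : ℝ) : ℂ) * (G k).fourier ξ

/-- The Leray projector `ℙ_σ`:
`∑_{ξ ≠ 0} (F̂(ξ) - ξ (ξ·F̂(ξ)) / |ξ|²) e^{2πi x·ξ}`. -/
def leray (F : VecDist n) : VecDist n := fun k =>
  TorusDist.ofFourier fun ξ =>
    if ξ = 0 then 0
    else (F k).fourier ξ - (ξ k : ℂ) * (∑ j, (ξ j : ℂ) * (F j).fourier ξ) / ((freqSq ξ : ℝ) : ℂ)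

/-! ## Periodic Sobolev spaces -/

/-- `g ∈ H^s`. -/
def MemH (s : ℝ) (g : TorusDist n) : Prop :=
  Summable fun ξ : Fin n → ℤ => rho ξ ^ (2 * s) * ‖g.fourier ξ‖ ^ 2

/-- `G ∈ (H^s)ⁿ`. -/
def MemVecH (s : ℝ) (G : VecDist n) : Prop := ∀ k, MemH s (G k)

/-- `g` has zero mean, `⟨g, 1⟩ = ĝ(0) = 0`. -/
def MeanZero (g : TorusDist n) : Prop := g.fourier 0 = 0

/-- `div G`. -/
def divergence (G : VecDist n) : TorusDist n := ∑ k, (G k).partialDeriv k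

/-- `∇ p`. -/
def gradient (p : TorusDist n) : VecDist n := fun k => p.partialDeriv k

/-- `G ∈ (Ḣ^s)ⁿ`: zero mean. -/
def MemVecHdot (s : ℝ) (G : VecDist n) : Prop := MemVecH s G ∧ ∀ k, MeanZero (G k)

/-- `G ∈ Ḣ^s_σ`: zero mean and divergence free. -/
def MemHdotSigma (s : ℝ) (G : VecDist n) : Prop := MemVecHdot s G ∧ divergence G = 0

/-- `‖G‖²` in `(H^s)ⁿ`. -/
def normSqH (s : ℝ) (G : VecDist n) : ℝ :=
  ∑ k, ∑' ξ : Fin n → ℤ, rho ξ ^ (2 * s) * ‖(G k).fourier ξ‖ ^ 2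

/-! ## Functions of time -/

/-- Lebesgue measure on `(0,T)`. -/
def timeMeasure (T : ℝ) : Measure ℝ := volume.restrict (Set.Ioo 0 T)

/-- `g ∈ L_q(0,T; H^s)` (Bochner). The map `h ↦ (ϱ(ξ)^s ĥ(ξ))_ξ` is an isometry of `H^s` into
`ℓ²(ℤⁿ)`, and `g` is asked to be an `L_q` function of time under this identification. -/
def MemLqH (q : ℝ≥0∞) (T s : ℝ) (g : ℝ → TorusDist n) : Prop :=
  ∃ G : ℝ → lp (fun _ : Fin n → ℤ => ℂ) 2, MemLp G q (timeMeasure T) ∧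
    ∀ᵐ t ∂timeMeasure T, ∀ ξ, G t ξ = ((rho ξ ^ s : ℝ) : ℂ) * (g t).fourier ξ

/-- `p ∈ L_q(0,T; Ḣ^s)`. -/
def MemLqHdot (q : ℝ≥0∞) (T s : ℝ) (p : ℝ → TorusDist n) : Prop :=
  MemLqH q T s p ∧ ∀ᵐ t ∂timeMeasure T, MemH s (p t) ∧ MeanZero (p t)

/-- `G ∈ L_q(0,T; (Ḣ^s)ⁿ)`, and `G(t) ∈ (Ḣ^s)ⁿ` for a.e. `t`. -/
def MemLqVecHdot (q : ℝ≥0∞) (T s : ℝ) (G : ℝ → VecDist n) : Prop :=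
  (∀ k, MemLqH q T s fun t => G t k) ∧ ∀ᵐ t ∂timeMeasure T, MemVecHdot s (G t)

/-- `G ∈ L_q(0,T; Ḣ^s_σ)`, and `G(t) ∈ Ḣ^s_σ` for a.e. `t`. -/
def MemLqHdotSigma (q : ℝ≥0∞) (T s : ℝ) (G : ℝ → VecDist n) : Prop :=
  (∀ k, MemLqH q T s fun t => G t k) ∧ ∀ᵐ t ∂timeMeasure T, MemHdotSigma s (G t)

/-- `h` is the derivative of `g` in the sense of distributions on `(0,T)`. -/
def HasDistribDeriv (T : ℝ) (g h : ℝ → ℝ) : Prop :=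
  LocallyIntegrableOn g (Set.Ioo 0 T) ∧ LocallyIntegrableOn h (Set.Ioo 0 T) ∧
    ∀ ψ : ℝ → ℝ, ContDiff ℝ ∞ ψ → HasCompactSupport ψ → tsupport ψ ⊆ Set.Ioo 0 T →
      ∫ t in Set.Ioo 0 T, g t * deriv ψ t = -∫ t in Set.Ioo 0 T, h t * ψ t

/-- `v = u'`: the function `v` of time, with values in the vector torus distributions, is the time
derivative of `u` in the sense of distributions. -/
def IsTimeDeriv (T : ℝ) (u v : ℝ → VecDist n) : Prop :=
  ∀ φ : Fin n → TestFn n,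
    HasDistribDeriv T (fun t => vecApply (u t) φ) (fun t => vecApply (v t) φ)

/-- `u ∈ W¹(0,T; Ḣ^s_σ, Ḣ^{s'}_σ)`. -/
def MemW1Sigma (T s s' : ℝ) (u : ℝ → VecDist n) : Prop :=
  MemLqHdotSigma 2 T s u ∧ ∃ v, IsTimeDeriv T u v ∧ MemLqHdotSigma 2 T s' v

/-! ## The anisotropic Navier-Stokes equations -/

/-- Viscosity coefficients; `a i j α β x t` is `a_{ij}^{αβ}(x,t)`. -/
abbrev Tensor (n : ℕ) : Type :=
  Fin n → Fin n → Fin n → Fin n → (Fin n → ℝ) → ℝ → ℝ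

/-- Admissible viscosity coefficients: essentially bounded on `ℝⁿ × (0,T)`, periodic in `x`, and
with the symmetries `a_{kj}^{αβ} = a_{αj}^{kβ} = a_{kβ}^{αj}`. No ellipticity. -/
structure IsViscosity (T : ℝ) (a : Tensor n) : Prop where
  bounded : ∀ i j α β, MemLp (fun z : (Fin n → ℝ) × ℝ => a i j α β z.1 z.2) ∞
    (volume.restrict (Set.univ ×ˢ Set.Ioo 0 T))
  periodic : ∀ i j α β, ∀ m : Fin n → ℤ,
    ∀ᵐ z : (Fin n → ℝ) × ℝ ∂(volume.restrict (Set.univ ×ˢ Set.Ioo 0 T)),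
      a i j α β (z.1 + fun l => (m l : ℝ)) z.2 = a i j α β z.1 z.2
  symm : ∀ k j α β,
    ∀ᵐ z : (Fin n → ℝ) × ℝ ∂(volume.restrict (Set.univ ×ˢ Set.Ioo 0 T)),
      a k j α β z.1 z.2 = a α j k β z.1 z.2 ∧ a k j α β z.1 z.2 = a k β α j z.1 z.2

/-- The symmetric gradient `E_{jβ}(u) = (∂_j u_β + ∂_β u_j) / 2`. -/
def strain (u : VecDist n) (j β : Fin n) : TorusDist n :=
  (1 / 2 : ℝ) • ((u β).partialDeriv j + (u j).partialDeriv β)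

/-- The form `a(t; u, v) = ∑ ∫ a_{ij}^{αβ}(x,t) E_{jβ}(u)(x) E_{iα}(v)(x) dx`, for `u, v` in `H¹`. -/
def viscForm (a : Tensor n) (t : ℝ) (u v : VecDist n) : ℝ :=
  ∑ i, ∑ j, ∑ α, ∑ β,
    ∫ x in cube n, a i j α β x t * (strain u j β).toFun x * (strain v i α).toFun x

/-- `(u·∇)u`, with components `∑_j u_j ∂_j u_k`, for `u` in `H¹`: products of square integrable
functions, seen as distributions. -/
def convection (u : VecDist n) : VecDist n := fun k =>
  TorusDist.ofFun fun x => ∑ j, (u j).toFun x * ((u k).partialDeriv j).toFun x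

/-- `u`, with time derivative `u'`, solves the weak equation
`⟨u'(t) + ℙ_σ[(u·∇)u](t), w⟩ + a(t; u(t), w) = ⟨f(t), w⟩` for a.e. `t ∈ (0,T)` and all
`w ∈ Ḣ¹_σ`. -/
structure SolvesWeakEquation (T : ℝ) (a : Tensor n) (f u u' : ℝ → VecDist n) : Prop where
  timeDeriv : IsTimeDeriv T u u'
  equation : ∀ᵐ t ∂timeMeasure T, ∀ w : VecDist n, MemHdotSigma 1 w →
    vecDual (u' t + leray (convection (u t))) w + viscForm a t (u t) w = vecDual (f t) w

/-- `p` is an associated pressure: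
`⟨u'(t) + (u·∇)u(t), w⟩ + a(t; u(t), w) + ⟨∇p(t), w⟩ = ⟨f(t), w⟩` for a.e. `t ∈ (0,T)` and all
periodic smooth vector fields `w`. -/
def IsAssociatedPressure (T : ℝ) (a : Tensor n) (f u u' : ℝ → VecDist n)
    (p : ℝ → TorusDist n) : Prop :=
  ∀ᵐ t ∂timeMeasure T, ∀ w : Fin n → TestFn n,
    vecApply (u' t + convection (u t)) w + viscForm a t (u t) (fun k => (w k).toDist)
      + vecApply (gradient (p t)) w = vecApply (f t) w

end PeriodicNS

end

open PeriodicNS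

noncomputable section

namespace PeriodicNS

open scoped ComplexConjugate

variable {n : ℕ}

/-! ## The weight `ϱ` -/

/-! The whole argument is carried out on Fourier coefficients. A torus distribution is determined by
them (`fourier_injective`), every hermitian family of polynomial growth occurs
(`exists_fourier_eq`), and derivatives, Bessel potentials, the Leray projector and the inversion of
the gradient act frequency by frequency. Squared Sobolev norms are taken in `[0,∞]` (`hE`), so
estimates can be summed and integrated before finiteness is known.

The analytic core is the product estimate `‖fg‖_{H^{1-n/2}} ≤ C ‖f‖_{H^{1/2}} ‖g‖_{H^{1/2}}`
(`exists_tsum_conv_le`). For divergence free `u` the convection term is `∑_j ∂_j(u_j u_k)`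
(`convection_eq`). The interpolation `‖g‖²_{H^{1/2}} ≤ ‖g‖_{H⁰} ‖g‖_{H¹}` then bounds its squared
`H^{-n/2}` norm by a constant times `‖u‖²_{H⁰} ‖u‖²_{H¹}`: the first factor is bounded in time, the
second integrable (`exists_hE_convection_le`). Boundedness of the coefficients alone puts the
viscous term `Au` into `L₂(0,T;H^{-1})`.

Testing the weak equation with `cos` and `sin` modes times the columns of `I - ξ⊗ξ/|ξ|²` identifies
`u' + ℙ_σ[(u·∇)u]` with `ℙ_σ(f - Au)` for almost every time (`fourier_eq_lerayCoeff`,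
`SolvesWeakEquation.ae_eq_leray`). This gives all memberships in (i), because `n ≥ 2` makes `H^{-1}`
a subspace of `H^{-n/2}`.

For the derivative identity, every coefficient of `u` has an integrable distributional derivative,
hence agrees almost everywhere with an absolutely continuous function, for which the square of the
modulus obeys the product rule. Multiply by `ϱ^{1-n/2}` and sum over the frequencies. Since
`ϱ^{1-n/2} = ϱ^{-n/2} ϱ`, the rates are dominated by `ϱ^{-n}|û'|² + ϱ²|û|²`, whose sum is integrable
in time. The squared norm is therefore itself a primitive of the summed rate
(`hasSum_normSq_cprim`), which yields the identity both as distributions and almost everywhere.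

The absolutely continuous coefficients define the representative of (ii). Its `H⁰` bound passes from
almost every time to every time by lower semicontinuity; boundedness and continuity of each
coefficient give weak continuity; weak continuity together with continuity of the norm gives strong
continuity, as in any Hilbert space.

For (iii), `f - Au - u' - (u·∇)u` has zero mean and zero Leray projection, so it is a gradient, and
its potential is one order smoother. Uniqueness holds because a zero-mean distribution with
vanishing gradient is zero. -/

theorem freqSq_nonneg (ξ : Fin n → ℤ) : 0 ≤ freqSq ξ :=
  Finset.sum_nonneg fun _ _ => sq_nonneg _

theorem freqSq_neg (ξ : Fin n → ℤ) : freqSq (-ξ) = freqSq ξ := by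
  simp [freqSq]

theorem freqSq_pos {ξ : Fin n → ℤ} (h : ξ ≠ 0) : 0 < freqSq ξ := by
  obtain ⟨i, hi⟩ := Function.ne_iff.mp h
  refine Finset.sum_pos' (fun _ _ => sq_nonneg _) ⟨i, Finset.mem_univ i, ?_⟩
  have : (ξ i : ℝ) ≠ 0 := by exact_mod_cast hi
  positivity

theorem rho_neg (ξ : Fin n → ℤ) : rho (-ξ) = rho ξ := by
  simp [rho, freqSq_neg]

theorem rho_sq (ξ : Fin n → ℤ) : rho ξ ^ 2 = (2 * Real.pi) ^ 2 * (1 + freqSq ξ) := by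
  rw [rho, mul_pow, Real.sq_sqrt (by linarith [freqSq_nonneg ξ])]

theorem rho_pos (ξ : Fin n → ℤ) : 0 < rho ξ := by
  have := freqSq_nonneg ξ
  have := Real.pi_pos
  unfold rho
  positivity

theorem two_pi_le_rho (ξ : Fin n → ℤ) : 2 * Real.pi ≤ rho ξ := by
  have h : 1 ≤ Real.sqrt (1 + freqSq ξ) := Real.one_le_sqrt.mpr (by linarith [freqSq_nonneg ξ])
  have := Real.pi_pos
  unfold rho
  nlinarith

theorem one_le_rho (ξ : Fin n → ℤ) : 1 ≤ rho ξ := by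
  linarith [two_pi_le_rho ξ, Real.pi_gt_three]

theorem two_pi_abs_le_rho (ξ : Fin n → ℤ) (i : Fin n) : 2 * Real.pi * |(ξ i : ℝ)| ≤ rho ξ := by
  have h : (ξ i : ℝ) ^ 2 ≤ freqSq ξ :=
    Finset.single_le_sum (f := fun j => (ξ j : ℝ) ^ 2) (fun _ _ => sq_nonneg _)
      (Finset.mem_univ i)
  have := Real.pi_pos
  unfold rho
  gcongr
  rw [← Real.sqrt_sq_eq_abs]
  exact Real.sqrt_le_sqrt (by linarith)

theorem one_add_abs_le_rho (ξ : Fin n → ℤ) (i : Fin n) : 1 + |(ξ i : ℝ)| ≤ rho ξ := by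
  have h1 := two_pi_abs_le_rho ξ i
  have h2 := two_pi_le_rho ξ
  have h3 := Real.pi_gt_three
  have h4 := abs_nonneg (ξ i : ℝ)
  nlinarith

theorem rho_add_le (η ζ : Fin n → ℤ) : rho (η + ζ) ≤ 2 * max (rho η) (rho ζ) := by
  have h : freqSq (η + ζ) ≤ 2 * freqSq η + 2 * freqSq ζ := by
    simp only [freqSq, Finset.mul_sum, ← Finset.sum_add_distrib]
    refine Finset.sum_le_sum fun i _ => ?_
    simp only [Pi.add_apply, Int.cast_add]
    nlinarith [sq_nonneg ((η i : ℝ) - ζ i)]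
  have h1 := rho_sq (η + ζ)
  have h2 := rho_sq η
  have h3 := rho_sq ζ
  have h4 : rho (η + ζ) ^ 2 ≤ 2 * rho η ^ 2 + 2 * rho ζ ^ 2 := by
    rw [h1, h2, h3]
    have : 0 ≤ (2 * Real.pi) ^ 2 := sq_nonneg _
    nlinarith
  have p1 := rho_pos η
  have p2 := rho_pos ζ
  have h5 : rho η ^ 2 ≤ max (rho η) (rho ζ) ^ 2 := by gcongr; exact le_max_left _ _
  have h6 : rho ζ ^ 2 ≤ max (rho η) (rho ζ) ^ 2 := by gcongr; exact le_max_right _ _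
  refine abs_le_of_sq_le_sq' (a := rho (η + ζ)) ?_ (by positivity) |>.2
  nlinarith

/-- The weight `ϱ(ξ)^r` as an extended nonnegative number. -/
def wt (r : ℝ) (ξ : Fin n → ℤ) : ℝ≥0∞ := ENNReal.ofReal (rho ξ ^ r)

theorem wt_mul (r s : ℝ) (ξ : Fin n → ℤ) : wt r ξ * wt s ξ = wt (r + s) ξ := by
  have := rho_pos ξ
  rw [wt, wt, wt, ← ENNReal.ofReal_mul (by positivity), Real.rpow_add this]

theorem wt_zero (ξ : Fin n → ℤ) : wt 0 ξ = 1 := by simp [wt]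

theorem wt_ne_top (r : ℝ) (ξ : Fin n → ℤ) : wt r ξ ≠ ⊤ := ENNReal.ofReal_ne_top

theorem wt_mono {r s : ℝ} (h : r ≤ s) (ξ : Fin n → ℤ) : wt r ξ ≤ wt s ξ :=
  ENNReal.ofReal_le_ofReal (Real.rpow_le_rpow_of_exponent_le (one_le_rho ξ) h)

theorem wt_le_of_nonpos {r : ℝ} (hr : r ≤ 0) {η ζ : Fin n → ℤ} (h : rho η ≤ rho ζ) :
    wt r ζ ≤ wt r η :=
  ENNReal.ofReal_le_ofReal (Real.rpow_le_rpow_of_nonpos (rho_pos η) h hr)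

/-! ## Lattice sums -/

/-- Bernoulli's inequality for the concave power `x ↦ x^{1-θ}` bounds `(1-θ)(N+1)^{-θ}` by the
increment of that power from `N` to `N+1`, and the increments telescope. -/
theorem sum_range_rpow_neg_le {θ : ℝ} (h0 : 0 ≤ θ) (h1 : θ < 1) (N : ℕ) :
    ∑ k ∈ Finset.range N, (1 + (k : ℝ)) ^ (-θ) ≤ (1 - θ)⁻¹ * (N : ℝ) ^ (1 - θ) := by
  have hθ : 0 < 1 - θ := by linarith
  induction N with
  | zero => simp [Real.zero_rpow hθ.ne']
  | succ N ih =>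
    rw [Finset.sum_range_succ]
    have hN : (0 : ℝ) < N + 1 := by positivity
    have key : (N : ℝ) ^ (1 - θ) ≤ (N + 1 : ℝ) ^ (1 - θ) - (1 - θ) * (N + 1 : ℝ) ^ (-θ) := by
      have hb := rpow_one_add_le_one_add_mul_self (s := -(1 / (N + 1 : ℝ))) (p := 1 - θ)
        (by rw [neg_le_neg_iff, div_le_one hN]; linarith [Nat.cast_nonneg (α := ℝ) N])
        hθ.le (by linarith)
      have e1 : (1 : ℝ) + -(1 / (N + 1 : ℝ)) = N / (N + 1) := by field_simp; ring
      rw [e1, Real.div_rpow (by positivity) hN.le, div_le_iff₀ (by positivity)] at hb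
      have e2 : (N + 1 : ℝ) ^ (-θ) = (N + 1 : ℝ) ^ (1 - θ) / (N + 1) := by
        rw [show -θ = (1 - θ) - 1 by ring, Real.rpow_sub_one hN.ne']
      rw [e2]
      calc _ ≤ _ := hb
        _ = _ := by ring
    push_cast
    rw [show (1 + (N : ℝ)) = N + 1 by ring]
    calc _ ≤ (1 - θ)⁻¹ * (N : ℝ) ^ (1 - θ) + (N + 1 : ℝ) ^ (-θ) := by gcongr
      _ ≤ (1 - θ)⁻¹ * ((N + 1 : ℝ) ^ (1 - θ) - (1 - θ) * (N + 1 : ℝ) ^ (-θ))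
          + (N + 1 : ℝ) ^ (-θ) := by
        have : 0 < (1 - θ)⁻¹ := by positivity
        gcongr
      _ = _ := by field_simp; ring

theorem sum_Icc_rpow_neg_le {θ : ℝ} (h0 : 0 ≤ θ) (h1 : θ < 1) (N : ℕ) :
    ∑ k ∈ Finset.Icc (-(N : ℤ)) N, (1 + |(k : ℝ)|) ^ (-θ) ≤
      2 * ((1 - θ)⁻¹ * ((N + 1 : ℕ) : ℝ) ^ (1 - θ)) := by
  have hsub : Finset.Icc (-(N : ℤ)) N ⊆
      (Finset.range (N + 1)).image (fun k : ℕ => (k : ℤ)) ∪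
        (Finset.range (N + 1)).image (fun k : ℕ => -(k : ℤ)) := by
    intro k hk
    simp only [Finset.mem_Icc] at hk
    simp only [Finset.mem_union, Finset.mem_image, Finset.mem_range]
    rcases le_total 0 k with h | h
    · exact Or.inl ⟨k.toNat, by omega, by omega⟩
    · exact Or.inr ⟨(-k).toNat, by omega, by omega⟩
  have hs := sum_range_rpow_neg_le h0 h1 (N + 1)
  calc _ ≤ ∑ k ∈ (Finset.range (N + 1)).image (fun k : ℕ => (k : ℤ)) ∪
        (Finset.range (N + 1)).image (fun k : ℕ => -(k : ℤ)), (1 + |(k : ℝ)|) ^ (-θ) :=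
        Finset.sum_le_sum_of_subset_of_nonneg hsub fun _ _ _ => by positivity
    _ ≤ ∑ k ∈ (Finset.range (N + 1)).image (fun k : ℕ => (k : ℤ)), (1 + |(k : ℝ)|) ^ (-θ) +
        ∑ k ∈ (Finset.range (N + 1)).image (fun k : ℕ => -(k : ℤ)), (1 + |(k : ℝ)|) ^ (-θ) := by
        rw [← Finset.sum_union_inter]
        exact le_add_of_nonneg_right (Finset.sum_nonneg fun _ _ => by positivity)
    _ ≤ _ := by
        rw [Finset.sum_image (by intro a _ b _ h; simpa using h),
          Finset.sum_image (by intro a _ b _ h; simpa using h), two_mul]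
        simp only [Int.cast_neg, abs_neg, Int.cast_natCast, Nat.abs_cast]
        exact add_le_add hs hs

/-- The weight is distributed evenly over the coordinates: with `θ = b/n < 1`, `ϱ(η)^{-b}` is at
most `∏ (1+|η_i|)^{-θ}`. The region lies in a box of side comparable to `R`, so the sum is bounded
by the `n`-th power of a one-dimensional sum of size `R^{1-θ}`. -/
theorem exists_tsum_wt_le (hn : 0 < n) {b : ℝ} (h0 : 0 ≤ b) (hb : b < n) :
    ∃ C : ℝ, 0 ≤ C ∧ ∀ R : ℝ, 1 ≤ R →
      ∑' η : Fin n → ℤ, (if rho η ≤ R then wt (-b) η else 0) ≤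
        ENNReal.ofReal (C * R ^ ((n : ℝ) - b)) := by
  have hn' : (0 : ℝ) < n := by exact_mod_cast hn
  set θ := b / n with hθ
  have hθ0 : 0 ≤ θ := by positivity
  have hθ1 : θ < 1 := by rw [hθ, div_lt_one hn']; exact hb
  have h1θ : 0 < 1 - θ := by linarith
  refine ⟨(2 * ((1 - θ)⁻¹ * 2 ^ (1 - θ))) ^ n, by positivity, fun R hR => ?_⟩
  set N := ⌊R⌋₊
  set B : Finset (Fin n → ℤ) := Fintype.piFinset fun _ => Finset.Icc (-(N : ℤ)) N
  have hmem : ∀ η : Fin n → ℤ, rho η ≤ R → η ∈ B := by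
    intro η hη
    simp only [B, Fintype.mem_piFinset, Finset.mem_Icc]
    intro i
    have h1 := one_add_abs_le_rho η i
    have h2 : ((η i).natAbs : ℝ) ≤ R := by
      rw [Nat.cast_natAbs, Int.cast_abs]; linarith
    have h3 : (η i).natAbs ≤ N := Nat.le_floor h2
    omega
  rw [tsum_eq_sum (s := B) fun η hη => if_neg fun h => hη (hmem η h)]
  have hterm : ∀ η : Fin n → ℤ, (if rho η ≤ R then wt (-b) η else 0) ≤
      ENNReal.ofReal (∏ i, (1 + |(η i : ℝ)|) ^ (-θ)) := by
    intro η
    split_ifs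
    · refine ENNReal.ofReal_le_ofReal ?_
      have hr := rho_pos η
      calc rho η ^ (-b) = ∏ _i : Fin n, rho η ^ (-θ) := by
            rw [Finset.prod_const, Finset.card_univ, Fintype.card_fin, ← Real.rpow_natCast,
              ← Real.rpow_mul hr.le]
            congr 1
            rw [hθ]; field_simp
        _ ≤ _ := Finset.prod_le_prod (fun _ _ => by positivity) fun i _ =>
            Real.rpow_le_rpow_of_nonpos (by positivity) (one_add_abs_le_rho η i) (by linarith)
    · exact zero_le
  calc _ ≤ ∑ η ∈ B, ENNReal.ofReal (∏ i, (1 + |(η i : ℝ)|) ^ (-θ)) :=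
        Finset.sum_le_sum fun η _ => hterm η
    _ = ENNReal.ofReal (∑ η ∈ B, ∏ i, (1 + |(η i : ℝ)|) ^ (-θ)) :=
        (ENNReal.ofReal_sum_of_nonneg fun _ _ => Finset.prod_nonneg fun _ _ => by positivity).symm
    _ ≤ _ := by
        refine ENNReal.ofReal_le_ofReal ?_
        rw [← Finset.prod_univ_sum (fun _ => Finset.Icc (-(N : ℤ)) N)
          (fun _ k => (1 + |(k : ℝ)|) ^ (-θ)), Finset.prod_const, Finset.card_univ,
          Fintype.card_fin]
        have h2 : ((N + 1 : ℕ) : ℝ) ≤ 2 * R := by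
          have := Nat.floor_le (show 0 ≤ R by linarith)
          push_cast; linarith
        calc _ ≤ (2 * ((1 - θ)⁻¹ * ((N + 1 : ℕ) : ℝ) ^ (1 - θ))) ^ n := by
              gcongr
              exact sum_Icc_rpow_neg_le hθ0 hθ1 N
          _ ≤ (2 * ((1 - θ)⁻¹ * (2 * R) ^ (1 - θ))) ^ n := by gcongr
          _ = _ := by
              rw [Real.mul_rpow (by norm_num) (by linarith),
                show (2 * ((1 - θ)⁻¹ * (2 ^ (1 - θ) * R ^ (1 - θ)))) =
                  (2 * ((1 - θ)⁻¹ * 2 ^ (1 - θ))) * R ^ (1 - θ) by ring, mul_pow]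
              congr 1
              rw [← Real.rpow_natCast, ← Real.rpow_mul (by linarith)]
              congr 1
              rw [hθ]; field_simp

/-- `∑ ϱ^{-b} < ∞` for `b > n`. -/
theorem summable_rho_rpow_neg : Summable fun η : Fin n → ℤ => rho η ^ (-(2 * n : ℝ)) := by
  have h1 : Summable fun k : ℤ => (1 + |(k : ℝ)|) ^ (-2 : ℝ) := by
    have h := (Real.summable_one_div_int_add_rpow (1 / 2 : ℝ) 2).mpr (by norm_num)
    refine Summable.of_nonneg_of_le (fun _ => by positivity) (fun k => ?_) h
    rw [Real.rpow_neg (by positivity), one_div]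
    have hk : |(k : ℝ) + 1 / 2| ≤ 1 + |(k : ℝ)| := by
      refine (abs_add_le _ _).trans ?_
      rw [abs_of_pos (by norm_num : (0 : ℝ) < 1 / 2)]; linarith
    have hp : 0 < |(k : ℝ) + 1 / 2| := by
      rw [abs_pos]
      intro h0
      have h2 : ((2 * k + 1 : ℤ) : ℝ) = 0 := by push_cast; linarith
      have h3 : 2 * k + 1 = 0 := by exact_mod_cast h2
      omega
    gcongr
  have hp : Summable fun η : Fin n → ℤ => ∏ i, (1 + |(η i : ℝ)|) ^ (-2 : ℝ) := by
    refine summable_of_sum_le (c := (∑' k : ℤ, (1 + |(k : ℝ)|) ^ (-2 : ℝ)) ^ n)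
      (fun _ => Finset.prod_nonneg fun _ _ => by positivity) fun s => ?_
    have hsub : s ⊆ Fintype.piFinset fun i => s.image fun η => η i := fun η hη => by
      simp only [Fintype.mem_piFinset]
      exact fun i => Finset.mem_image_of_mem _ hη
    refine (Finset.sum_le_sum_of_subset_of_nonneg hsub fun _ _ _ =>
      Finset.prod_nonneg fun _ _ => by positivity).trans ?_
    rw [← Finset.prod_univ_sum (fun i => s.image fun η => η i)
      (fun _ (k : ℤ) => (1 + |(k : ℝ)|) ^ (-2 : ℝ))]
    calc _ ≤ ∏ _i : Fin n, ∑' k : ℤ, (1 + |(k : ℝ)|) ^ (-2 : ℝ) :=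
          Finset.prod_le_prod (fun _ _ => Finset.sum_nonneg fun _ _ => by positivity)
            fun i _ => h1.sum_le_tsum _ fun _ _ => by positivity
      _ = _ := by simp
  refine Summable.of_nonneg_of_le (fun η => by have := rho_pos η; positivity) (fun η => ?_) hp
  have hr := rho_pos η
  calc rho η ^ (-(2 * n : ℝ)) = ∏ _i : Fin n, rho η ^ (-2 : ℝ) := by
        rw [Finset.prod_const, Finset.card_univ, Fintype.card_fin, ← Real.rpow_natCast,
          ← Real.rpow_mul hr.le]
        congr 1; ring
    _ ≤ _ := Finset.prod_le_prod (fun _ _ => by positivity) fun i _ =>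
        Real.rpow_le_rpow_of_nonpos (by positivity) (one_add_abs_le_rho η i) (by norm_num)

/-! ## The product estimate -/

/-- Cauchy-Schwarz, obtained as Hölder's inequality for the counting measure; with values in `[0,∞]`
no summability has to be checked. -/
theorem ENNReal_tsum_mul_sq_le {ι : Type*} [Countable ι] (f g : ι → ℝ≥0∞) :
    (∑' i, f i * g i) ^ 2 ≤ (∑' i, f i ^ 2) * ∑' i, g i ^ 2 := by
  let _ : MeasurableSpace ι := ⊤
  have h := ENNReal.lintegral_mul_le_Lp_mul_Lq (μ := Measure.count)
    Real.HolderConjugate.two_two (f := f) (g := g) measurable_from_top.aemeasurable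
    measurable_from_top.aemeasurable
  simp only [lintegral_count, Pi.mul_apply] at h
  have h2 := pow_le_pow_left₀ (zero_le) h 2
  rw [mul_pow] at h2
  have e : ∀ a : ℝ≥0∞, (a ^ (1 / (2 : ℝ))) ^ 2 = a := fun a => by
    rw [← ENNReal.rpow_natCast, ← ENNReal.rpow_mul]; norm_num
  rw [e, e] at h2
  simpa only [ENNReal.rpow_two] using h2

theorem ENNReal_add_sq_le (a b : ℝ≥0∞) : (a + b) ^ 2 ≤ 2 * (a ^ 2 + b ^ 2) := by
  have h := ENNReal.rpow_add_le_mul_rpow_add_rpow a b (p := 2) (by norm_num)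
  have e : ((2 : ℝ) - 1) = 1 := by norm_num
  rw [e] at h
  simpa using h

theorem tsum_tsum_sub_mul (F G : (Fin n → ℤ) → ℝ≥0∞) :
    ∑' ξ, ∑' η, F η * G (ξ - η) = (∑' η, F η) * ∑' ζ, G ζ := by
  rw [ENNReal.tsum_comm]
  simp_rw [ENNReal.tsum_mul_left]
  rw [← ENNReal.tsum_mul_right]
  congr 1; ext η
  exact congrArg _ ((Equiv.subRight η).tsum_eq G)

/-- The contributions of `ϱ(η) ≤ ϱ(ξ - η)` to the product estimate. -/
theorem exists_tsum_conv_half_le (hn : 2 ≤ n) :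
    ∃ C : ℝ≥0∞, C ≠ ⊤ ∧ ∀ F G : (Fin n → ℤ) → ℝ≥0∞,
      ∑' ξ, wt (2 - n) ξ *
        (∑' η, if rho η ≤ rho (ξ - η) then F η * G (ξ - η) else 0) ^ 2 ≤
      C * ((∑' η, wt 1 η * F η ^ 2) * ∑' η, wt 1 η * G η ^ 2) := by
  have hn0 : 0 < n := by omega
  have hn2 : (2 : ℝ) ≤ n := by exact_mod_cast hn
  obtain ⟨C₁, hC₁, h1⟩ := exists_tsum_wt_le hn0 (b := 1) zero_le_one (by linarith)
  obtain ⟨C₂, hC₂, h2⟩ := exists_tsum_wt_le hn0 (b := (n : ℝ) - 2) (by linarith) (by linarith)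
  refine ⟨2 * (ENNReal.ofReal (2 * C₁) + ENNReal.ofReal C₂), ENNReal.mul_ne_top (by simp)
    (ENNReal.add_ne_top.mpr ⟨ENNReal.ofReal_ne_top, ENNReal.ofReal_ne_top⟩), fun F G => ?_⟩
  set S := (∑' η, wt 1 η * F η ^ 2) * ∑' η, wt 1 η * G η ^ 2 with hS
  -- low frequencies
  have hA : ∑' ξ, wt (2 - n) ξ * (∑' η, if rho η ≤ rho (ξ - η) ∧ rho η ≤ rho ξ
      then F η * G (ξ - η) else 0) ^ 2 ≤ ENNReal.ofReal (2 * C₁) * S := by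
    have hterm : ∀ ξ : Fin n → ℤ, wt (2 - n) ξ * (∑' η, if rho η ≤ rho (ξ - η) ∧ rho η ≤ rho ξ
        then F η * G (ξ - η) else 0) ^ 2 ≤
        ENNReal.ofReal (2 * C₁) * ∑' η, (wt 1 η * F η ^ 2) * (wt 1 (ξ - η) * G (ξ - η) ^ 2) := by
      intro ξ
      -- The factor `ϱ(η)^{1/2} ϱ(ξ-η)^{1/2}` goes to `F G` and its inverse to the indicator of the
      -- region. There `ϱ(ξ) ≤ 2ϱ(ξ-η)`, so the second sum is at most `2ϱ(ξ)⁻¹ ∑_{ϱ(η)≤ϱ(ξ)}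
      -- ϱ(η)⁻¹`, of size `ϱ(ξ)^{n-2}`, which is exactly cancelled by the outer weight.
      have hcs := ENNReal_tsum_mul_sq_le
        (fun η => wt (1 / 2) η * F η * (wt (1 / 2) (ξ - η) * G (ξ - η)))
        (fun η => if rho η ≤ rho (ξ - η) ∧ rho η ≤ rho ξ then
          wt (-(1 / 2)) η * wt (-(1 / 2)) (ξ - η) else 0)
      have e1 : ∀ η : Fin n → ℤ, wt (1 / 2) η * F η * (wt (1 / 2) (ξ - η) * G (ξ - η)) *
          (if rho η ≤ rho (ξ - η) ∧ rho η ≤ rho ξ then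
          wt (-(1 / 2)) η * wt (-(1 / 2)) (ξ - η) else 0) =
          if rho η ≤ rho (ξ - η) ∧ rho η ≤ rho ξ then F η * G (ξ - η) else 0 := by
        intro η
        split_ifs
        · calc _ = (wt (1 / 2) η * wt (-(1 / 2)) η) * (wt (1 / 2) (ξ - η) *
                wt (-(1 / 2)) (ξ - η)) * (F η * G (ξ - η)) := by ring
            _ = _ := by rw [wt_mul, wt_mul]; norm_num [wt_zero]
        · simp
      have e2 : ∀ η : Fin n → ℤ, (wt (1 / 2) η * F η * (wt (1 / 2) (ξ - η) * G (ξ - η))) ^ 2 =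
          (wt 1 η * F η ^ 2) * (wt 1 (ξ - η) * G (ξ - η) ^ 2) := by
        intro η
        calc _ = (wt (1 / 2) η * wt (1 / 2) η) * (wt (1 / 2) (ξ - η) * wt (1 / 2) (ξ - η)) *
              (F η ^ 2 * G (ξ - η) ^ 2) := by ring
          _ = _ := by rw [wt_mul, wt_mul]; norm_num; ring
      simp only [e1, e2] at hcs
      have hw : ∑' η, (if rho η ≤ rho (ξ - η) ∧ rho η ≤ rho ξ then
          wt (-(1 / 2)) η * wt (-(1 / 2)) (ξ - η) else 0) ^ 2 ≤
          ENNReal.ofReal (2 * C₁) * wt ((n : ℝ) - 2) ξ := by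
        have hp : ∀ η : Fin n → ℤ, (if rho η ≤ rho (ξ - η) ∧ rho η ≤ rho ξ then
          wt (-(1 / 2)) η * wt (-(1 / 2)) (ξ - η) else 0) ^ 2 ≤
            ENNReal.ofReal (2 * (rho ξ)⁻¹) * (if rho η ≤ rho ξ then wt (-1) η else 0) := by
          intro η
          by_cases h : rho η ≤ rho (ξ - η) ∧ rho η ≤ rho ξ
          · rw [if_pos h, if_pos h.2]
            calc _ = (wt (-(1 / 2)) η * wt (-(1 / 2)) η) *
                  (wt (-(1 / 2)) (ξ - η) * wt (-(1 / 2)) (ξ - η)) := by ring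
              _ = wt (-1) η * wt (-1) (ξ - η) := by rw [wt_mul, wt_mul]; norm_num
              _ ≤ wt (-1) η * ENNReal.ofReal (2 * (rho ξ)⁻¹) := by
                  gcongr
                  refine ENNReal.ofReal_le_ofReal ?_
                  have h3 := rho_add_le η (ξ - η)
                  rw [add_sub_cancel, max_eq_right h.1] at h3
                  have p1 := rho_pos ξ
                  have p2 := rho_pos (ξ - η)
                  rw [Real.rpow_neg_one, ← div_eq_mul_inv, inv_eq_one_div, div_le_div_iff₀ p2 p1]
                  linarith
              _ = _ := mul_comm _ _
          · rw [if_neg h]; simp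
        calc _ ≤ ∑' η : Fin n → ℤ, ENNReal.ofReal (2 * (rho ξ)⁻¹) *
              (if rho η ≤ rho ξ then wt (-1) η else 0) := ENNReal.tsum_le_tsum hp
          _ = ENNReal.ofReal (2 * (rho ξ)⁻¹) *
              ∑' η : Fin n → ℤ, (if rho η ≤ rho ξ then wt (-1) η else 0) := ENNReal.tsum_mul_left
          _ ≤ ENNReal.ofReal (2 * (rho ξ)⁻¹) * ENNReal.ofReal (C₁ * rho ξ ^ ((n : ℝ) - 1)) := by
              gcongr
              exact h1 _ (one_le_rho ξ)
          _ = _ := by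
              have p1 := rho_pos ξ
              rw [wt, ← ENNReal.ofReal_mul (by positivity), ← ENNReal.ofReal_mul (by positivity)]
              congr 1
              rw [show (n : ℝ) - 2 = (n - 1) - 1 by ring, Real.rpow_sub_one p1.ne' (n - 1 : ℝ)]
              field_simp
      calc _ ≤ wt (2 - n) ξ * ((∑' η, (wt 1 η * F η ^ 2) * (wt 1 (ξ - η) * G (ξ - η) ^ 2)) *
            (ENNReal.ofReal (2 * C₁) * wt ((n : ℝ) - 2) ξ)) := by gcongr; exact hcs.trans (by gcongr)
        _ = (wt (2 - n) ξ * wt ((n : ℝ) - 2) ξ) * (ENNReal.ofReal (2 * C₁) *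
            ∑' η, (wt 1 η * F η ^ 2) * (wt 1 (ξ - η) * G (ξ - η) ^ 2)) := by ring
        _ = _ := by rw [wt_mul]; norm_num [wt_zero]
    refine (ENNReal.tsum_le_tsum hterm).trans ?_
    rw [ENNReal.tsum_mul_left, tsum_tsum_sub_mul (fun η => wt 1 η * F η ^ 2)
      (fun η => wt 1 η * G η ^ 2)]
  -- high frequencies
  have hB : ∑' ξ, wt (2 - n) ξ * (∑' η, if rho η ≤ rho (ξ - η) ∧ rho ξ ≤ rho η
      then F η * G (ξ - η) else 0) ^ 2 ≤ ENNReal.ofReal C₂ * S := by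
    have hterm : ∀ ξ : Fin n → ℤ, wt (2 - n) ξ * (∑' η, if rho η ≤ rho (ξ - η) ∧ rho ξ ≤ rho η
        then F η * G (ξ - η) else 0) ^ 2 ≤
        (∑' η, wt 1 η * G η ^ 2) *
          ∑' η, wt (-1) η * F η ^ 2 * (if rho ξ ≤ rho η then wt (-((n : ℝ) - 2)) ξ else 0) := by
      intro ξ
      -- Here `ϱ(η) ≤ ϱ(ξ-η)` is used to replace `ϱ(ξ-η)^{-1/2}` by `ϱ(η)^{-1/2}`, so that all of
      -- `G` is absorbed by the first Cauchy-Schwarz factor, uniformly in `ξ`.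
      have hcs := ENNReal_tsum_mul_sq_le
        (fun η => wt (1 / 2) (ξ - η) * G (ξ - η))
        (fun η => if rho ξ ≤ rho η then wt (-(1 / 2)) η * F η else 0)
      have e1 : ∑' η, (wt (1 / 2) (ξ - η) * G (ξ - η)) ^ 2 = ∑' η, wt 1 η * G η ^ 2 := by
        rw [← (Equiv.subLeft ξ).tsum_eq]
        congr 1; ext η
        simp only [Equiv.subLeft_apply, sub_sub_cancel]
        calc _ = (wt (1 / 2) η * wt (1 / 2) η) * G η ^ 2 := by ring
          _ = _ := by rw [wt_mul]; norm_num
      have e2 : ∀ η : Fin n → ℤ, (if rho η ≤ rho (ξ - η) ∧ rho ξ ≤ rho η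
        then F η * G (ξ - η) else 0) ≤ wt (1 / 2) (ξ - η) * G (ξ - η) *
          (if rho ξ ≤ rho η then wt (-(1 / 2)) η * F η else 0) := by
        intro η
        by_cases h : rho η ≤ rho (ξ - η) ∧ rho ξ ≤ rho η
        · rw [if_pos h, if_pos h.2]
          calc F η * G (ξ - η) = (wt (1 / 2) (ξ - η) * wt (-(1 / 2)) (ξ - η)) *
                (F η * G (ξ - η)) := by rw [wt_mul]; norm_num [wt_zero]
            _ ≤ (wt (1 / 2) (ξ - η) * wt (-(1 / 2)) η) * (F η * G (ξ - η)) := by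
                gcongr ?_ * _
                gcongr
                exact wt_le_of_nonpos (by norm_num) h.1
            _ = _ := by ring
        · rw [if_neg h]; exact zero_le
      have e3 : ∀ η : Fin n → ℤ, wt (2 - n) ξ *
          (if rho ξ ≤ rho η then wt (-(1 / 2)) η * F η else 0) ^ 2 =
          wt (-1) η * F η ^ 2 * (if rho ξ ≤ rho η then wt (-((n : ℝ) - 2)) ξ else 0) := by
        intro η
        split_ifs
        · calc _ = (wt (-(1 / 2)) η * wt (-(1 / 2)) η) * F η ^ 2 * wt (2 - n) ξ := by ring
            _ = _ := by rw [wt_mul]; norm_num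
        · simp
      rw [e1] at hcs
      calc _ ≤ wt (2 - n) ξ * (∑' η, wt (1 / 2) (ξ - η) * G (ξ - η) *
          (if rho ξ ≤ rho η then wt (-(1 / 2)) η * F η else 0)) ^ 2 := by
            gcongr with η; exact e2 η
        _ ≤ wt (2 - n) ξ * ((∑' η, wt 1 η * G η ^ 2) * ∑' η,
          (if rho ξ ≤ rho η then wt (-(1 / 2)) η * F η else 0) ^ 2) := by gcongr
        _ = (∑' η, wt 1 η * G η ^ 2) * ∑' η, wt (2 - n) ξ *
          (if rho ξ ≤ rho η then wt (-(1 / 2)) η * F η else 0) ^ 2 := by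
            rw [ENNReal.tsum_mul_left]; ring
        _ = _ := by simp only [e3]
    refine (ENNReal.tsum_le_tsum hterm).trans ?_
    -- Summing over `ξ` first, the sum of `ϱ(ξ)^{2-n}` over `ϱ(ξ) ≤ ϱ(η)` is of size `ϱ(η)²`, which
    -- raises the weight of `F` from `ϱ⁻¹` to `ϱ`.
    rw [ENNReal.tsum_mul_left, ENNReal.tsum_comm]
    simp_rw [ENNReal.tsum_mul_left]
    have hp : ∀ η : Fin n → ℤ, wt (-1) η * F η ^ 2 *
        ∑' ξ : Fin n → ℤ, (if rho ξ ≤ rho η then wt (-((n : ℝ) - 2)) ξ else 0) ≤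
        ENNReal.ofReal C₂ * (wt 1 η * F η ^ 2) := by
      intro η
      calc _ ≤ wt (-1) η * F η ^ 2 * ENNReal.ofReal (C₂ * rho η ^ ((n : ℝ) - (n - 2))) := by
            gcongr; exact h2 _ (one_le_rho η)
        _ = wt (-1) η * F η ^ 2 * (ENNReal.ofReal C₂ * wt 2 η) := by
            rw [ENNReal.ofReal_mul hC₂, wt]; congr 4; ring
        _ = ENNReal.ofReal C₂ * ((wt (-1) η * wt 2 η) * F η ^ 2) := by ring
        _ = _ := by rw [wt_mul]; norm_num
    calc _ ≤ (∑' η, wt 1 η * G η ^ 2) * ∑' η, ENNReal.ofReal C₂ * (wt 1 η * F η ^ 2) := by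
          exact mul_le_mul_right (ENNReal.tsum_le_tsum hp) _
      _ = _ := by rw [ENNReal.tsum_mul_left, hS]; ring
  calc _ ≤ ∑' ξ, (2 * (wt (2 - n) ξ * (∑' η, if rho η ≤ rho (ξ - η) ∧ rho η ≤ rho ξ
      then F η * G (ξ - η) else 0) ^ 2) + 2 * (wt (2 - n) ξ * (∑' η,
      if rho η ≤ rho (ξ - η) ∧ rho ξ ≤ rho η then F η * G (ξ - η) else 0) ^ 2)) := by
        refine ENNReal.tsum_le_tsum fun ξ => ?_
        calc _ ≤ wt (2 - n) ξ * ((∑' η, if rho η ≤ rho (ξ - η) ∧ rho η ≤ rho ξ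
              then F η * G (ξ - η) else 0) + ∑' η, if rho η ≤ rho (ξ - η) ∧ rho ξ ≤ rho η
              then F η * G (ξ - η) else 0) ^ 2 := by
              gcongr
              rw [← ENNReal.tsum_add]
              refine ENNReal.tsum_le_tsum fun η => ?_
              by_cases h : rho η ≤ rho (ξ - η)
              · rcases le_total (rho η) (rho ξ) with h' | h' <;> simp [h, h']
              · simp [h]
          _ ≤ wt (2 - n) ξ * (2 * _) := by gcongr; exact ENNReal_add_sq_le _ _
          _ = _ := by ring
    _ = 2 * _ + 2 * _ := by rw [ENNReal.tsum_add, ENNReal.tsum_mul_left, ENNReal.tsum_mul_left]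
    _ ≤ 2 * (ENNReal.ofReal (2 * C₁) * S) + 2 * (ENNReal.ofReal C₂ * S) := by gcongr
    _ = _ := by ring

/-- `‖f g‖_{H^{1-n/2}} ≤ C ‖f‖_{H^{1/2}} ‖g‖_{H^{1/2}}` on the side of Fourier coefficients. -/
theorem exists_tsum_conv_le (hn : 2 ≤ n) :
    ∃ C : ℝ≥0∞, C ≠ ⊤ ∧ ∀ F G : (Fin n → ℤ) → ℝ≥0∞,
      ∑' ξ, wt (2 - n) ξ * (∑' η, F η * G (ξ - η)) ^ 2 ≤
      C * ((∑' η, wt 1 η * F η ^ 2) * ∑' η, wt 1 η * G η ^ 2) := by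
  obtain ⟨C, hC, h⟩ := exists_tsum_conv_half_le hn
  refine ⟨2 * (C + C), ENNReal.mul_ne_top (by simp) (by simp [hC]), fun F G => ?_⟩
  set S := (∑' η, wt 1 η * F η ^ 2) * ∑' η, wt 1 η * G η ^ 2 with hS
  have h1 := h F G
  have h2 := h G F
  -- The substitution `η ↦ ξ - η` exchanges the roles of `F` and `G`, so the half with `ϱ(ξ-η) ≤
  -- ϱ(η)` is again an instance of the previous estimate.
  have hswap : ∀ ξ : Fin n → ℤ, (∑' η, if rho η ≤ rho (ξ - η) then G η * F (ξ - η) else 0) =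
      ∑' η, if rho (ξ - η) ≤ rho η then F η * G (ξ - η) else 0 := by
    intro ξ
    rw [← (Equiv.subLeft ξ).tsum_eq]
    congr 1; ext η
    simp only [Equiv.subLeft_apply, sub_sub_cancel, mul_comm]
  simp only [hswap] at h2
  rw [mul_comm (∑' η, wt 1 η * G η ^ 2), ← hS] at h2
  rw [← hS] at h1
  calc _ ≤ ∑' ξ, (2 * (wt (2 - n) ξ *
        (∑' η, if rho η ≤ rho (ξ - η) then F η * G (ξ - η) else 0) ^ 2) + 2 * (wt (2 - n) ξ *
        (∑' η, if rho (ξ - η) ≤ rho η then F η * G (ξ - η) else 0) ^ 2)) := by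
        refine ENNReal.tsum_le_tsum fun ξ => ?_
        calc _ ≤ wt (2 - n) ξ * ((∑' η, if rho η ≤ rho (ξ - η) then F η * G (ξ - η) else 0) +
              ∑' η, if rho (ξ - η) ≤ rho η then F η * G (ξ - η) else 0) ^ 2 := by
              gcongr
              rw [← ENNReal.tsum_add]
              refine ENNReal.tsum_le_tsum fun η => ?_
              rcases le_total (rho η) (rho (ξ - η)) with h' | h' <;> simp [h']
          _ ≤ wt (2 - n) ξ * (2 * _) := by gcongr; exact ENNReal_add_sq_le _ _
          _ = _ := by ring
    _ = 2 * _ + 2 * _ := by rw [ENNReal.tsum_add, ENNReal.tsum_mul_left, ENNReal.tsum_mul_left]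
    _ ≤ 2 * (C * S) + 2 * (C * S) := by gcongr
    _ = _ := by ring

/-! ## Fourier series on the cell -/

section Torus

open UnitAddTorus
open scoped ComplexConjugate

theorem measurePreserving_mk_haarAddCircle :
    MeasurePreserving ((↑) : ℝ → UnitAddCircle) (volume.restrict (Set.Ico (0 : ℝ) 1))
      AddCircle.haarAddCircle := by
  have h := AddCircle.measurePreserving_mk (1 : ℝ) 0
  rw [zero_add, AddCircle.volume_eq_smul_haarAddCircle, ENNReal.ofReal_one, one_smul] at h
  rwa [Measure.restrict_congr_set (Ico_ae_eq_Ioc (a := (0 : ℝ)) (b := 1))]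

-- The Fourier theory on the product torus refers to the product of the normalised Haar measures;
-- this instance makes that product the `volume` of the torus.
local instance unitAddCircleMeasureSpace : MeasureSpace UnitAddCircle := ⟨AddCircle.haarAddCircle⟩

local instance isAddHaarMeasure_unitAddCircle : Measure.IsAddHaarMeasure (volume : Measure UnitAddCircle) :=
  inferInstanceAs (Measure.IsAddHaarMeasure AddCircle.haarAddCircle)

local instance isProbabilityMeasure_unitAddCircle : IsProbabilityMeasure (volume : Measure UnitAddCircle) :=
  inferInstanceAs (IsProbabilityMeasure AddCircle.haarAddCircle)

/-- Lebesgue measure on the fundamental cell. -/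
def cubeMeasure (n : ℕ) : Measure (Fin n → ℝ) := volume.restrict (cube n)

/-- The quotient map `ℝⁿ → ℝⁿ/ℤⁿ`. -/
def toTorus (x : Fin n → ℝ) : UnitAddTorus (Fin n) := fun i => (x i : UnitAddCircle)

/-- The representative in the cell of a point of the torus. -/
def toCube (y : UnitAddTorus (Fin n)) : Fin n → ℝ := fun i => (AddCircle.equivIco 1 0 (y i) : ℝ)

theorem toTorus_toCube (y : UnitAddTorus (Fin n)) : toTorus (toCube y) = y :=
  funext fun i => AddCircle.coe_equivIco (p := (1 : ℝ)) (a := 0) (y := y i)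

theorem toCube_toTorus {x : Fin n → ℝ} (hx : x ∈ cube n) : toCube (toTorus x) = x :=
  funext fun i => AddCircle.equivIco_coe_of_mem (p := (1 : ℝ)) (a := 0) (by simpa using hx i trivial)

theorem exists_toCube_toTorus (x : Fin n → ℝ) :
    ∃ m : Fin n → ℤ, toCube (toTorus x) = x + fun i => (m i : ℝ) := by
  have h : ∀ i, ∃ m : ℤ, toCube (toTorus x) i = x i + m := by
    intro i
    have h1 : ((toCube (toTorus x) i : ℝ) : UnitAddCircle) = (x i : UnitAddCircle) :=
      congrFun (toTorus_toCube (toTorus x)) i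
    obtain ⟨m, hm⟩ := AddSubgroup.mem_zmultiples_iff.mp (QuotientAddGroup.eq_iff_sub_mem.mp h1)
    refine ⟨m, ?_⟩
    rw [zsmul_one] at hm
    linarith
  choose m hm using h
  exact ⟨m, funext hm⟩

theorem measurableSet_cube : MeasurableSet (cube n) :=
  MeasurableSet.univ_pi fun _ => measurableSet_Ico

theorem measurePreserving_toTorus :
    MeasurePreserving (toTorus (n := n)) (cubeMeasure n) volume := by
  have h2 := measurePreserving_pi (fun _ : Fin n => volume.restrict (Set.Ico (0 : ℝ) 1))
    (fun _ : Fin n => (volume : Measure UnitAddCircle)) (fun _ => measurePreserving_mk_haarAddCircle)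
  rw [← Measure.restrict_pi_pi] at h2
  exact h2

theorem measurable_toCube : Measurable (toCube (n := n)) :=
  measurable_pi_lambda _ fun i => measurable_subtype_coe.comp
    ((AddCircle.measurableEquivIco 1 0).measurable.comp (measurable_pi_apply i))

theorem measurePreserving_toCube :
    MeasurePreserving (toCube (n := n)) volume (cubeMeasure n) := by
  refine ⟨measurable_toCube, ?_⟩
  rw [← (measurePreserving_toTorus (n := n)).map_eq,
    Measure.map_map measurable_toCube measurePreserving_toTorus.measurable]
  have h : toCube ∘ toTorus =ᵐ[cubeMeasure n] id := by
    filter_upwards [ae_restrict_mem measurableSet_cube] with x hx using toCube_toTorus hx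
  rw [Measure.map_congr h, Measure.map_id]

/-- `e^{2πi x·ξ}`. -/
def expFn (ξ : Fin n → ℤ) (x : Fin n → ℝ) : ℂ :=
  Complex.exp ((2 * Real.pi * ∑ i, x i * (ξ i : ℝ) : ℝ) * Complex.I)

theorem mFourier_toTorus (ξ : Fin n → ℤ) (x : Fin n → ℝ) :
    mFourier ξ (toTorus x) = expFn ξ x := by
  simp only [mFourier, ContinuousMap.coe_mk, toTorus, fourier_coe_apply, ← Complex.exp_sum, expFn]
  congr 1
  push_cast
  rw [Finset.mul_sum, Finset.sum_mul]
  refine Finset.sum_congr rfl fun i _ => ?_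
  ring

theorem continuous_expFn (ξ : Fin n → ℤ) : Continuous (expFn ξ) := by
  unfold expFn
  fun_prop

theorem norm_expFn (ξ : Fin n → ℤ) (x : Fin n → ℝ) : ‖expFn ξ x‖ = 1 :=
  Complex.norm_exp_ofReal_mul_I _

theorem expFn_neg (ξ : Fin n → ℤ) (x : Fin n → ℝ) : expFn (-ξ) x = conj (expFn ξ x) := by
  rw [← mFourier_toTorus, mFourier_neg, mFourier_toTorus]

theorem expFn_add (ξ η : Fin n → ℤ) (x : Fin n → ℝ) :
    expFn (ξ + η) x = expFn ξ x * expFn η x := by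
  simp only [← mFourier_toTorus, mFourier_add]

theorem expFn_eq (ξ : Fin n → ℤ) (x : Fin n → ℝ) :
    expFn ξ x = (cosFn ξ : (Fin n → ℝ) → ℝ) x + Complex.I * (sinFn ξ : (Fin n → ℝ) → ℝ) x := by
  rw [expFn, Complex.exp_mul_I, ← Complex.ofReal_cos, ← Complex.ofReal_sin, mul_comm Complex.I]
  rfl

/-- The Fourier coefficients of a complex function on the cell. -/
def cubeCoeff (f : (Fin n → ℝ) → ℂ) (ξ : Fin n → ℤ) : ℂ :=
  ∫ x, expFn (-ξ) x * f x ∂cubeMeasure n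

instance isProbabilityMeasure_cubeMeasure : IsProbabilityMeasure (cubeMeasure n) := by
  rw [← (measurePreserving_toCube (n := n)).map_eq]
  exact Measure.isProbabilityMeasure_map measurable_toCube.aemeasurable

theorem integral_toCube {f : (Fin n → ℝ) → ℂ} (hf : AEStronglyMeasurable f (cubeMeasure n)) :
    ∫ y, f (toCube y) = ∫ x, f x ∂cubeMeasure n := by
  rw [← (measurePreserving_toCube (n := n)).map_eq] at hf ⊢
  rw [integral_map measurable_toCube.aemeasurable hf]

theorem mFourierCoeff_comp_toCube {f : (Fin n → ℝ) → ℂ}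
    (hf : AEStronglyMeasurable f (cubeMeasure n)) (ξ : Fin n → ℤ) :
    mFourierCoeff (fun y => f (toCube y)) ξ = cubeCoeff f ξ := by
  refine Eq.trans ?_ (integral_toCube ((continuous_expFn (-ξ)).aestronglyMeasurable.mul hf))
  simp only [mFourierCoeff, smul_eq_mul, ← mFourier_toTorus, toTorus_toCube]

theorem memLp_comp_toCube {f : (Fin n → ℝ) → ℂ} (hf : MemLp f 2 (cubeMeasure n)) :
    MemLp (fun y => f (toCube y)) 2 volume :=
  hf.comp_measurePreserving measurePreserving_toCube

theorem mFourierCoeff_toLp_comp_toCube {f : (Fin n → ℝ) → ℂ} (hf : MemLp f 2 (cubeMeasure n))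
    (ξ : Fin n → ℤ) :
    mFourierCoeff ((memLp_comp_toCube hf).toLp _) ξ = cubeCoeff f ξ := by
  rw [← mFourierCoeff_comp_toCube hf.1]
  exact integral_congr_ae (ae_eq_rfl.mul (memLp_comp_toCube hf).coeFn_toLp)

/-- Parseval's identity on the cell. -/
theorem hasSum_conj_cubeCoeff_mul {f g : (Fin n → ℝ) → ℂ} (hf : MemLp f 2 (cubeMeasure n))
    (hg : MemLp g 2 (cubeMeasure n)) :
    HasSum (fun ξ => conj (cubeCoeff f ξ) * cubeCoeff g ξ)
      (∫ x, conj (f x) * g x ∂cubeMeasure n) := by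
  have h := hasSum_prod_mFourierCoeff ((memLp_comp_toCube hf).toLp _)
    ((memLp_comp_toCube hg).toLp _)
  simp only [mFourierCoeff_toLp_comp_toCube hf, mFourierCoeff_toLp_comp_toCube hg] at h
  refine (congrArg (HasSum _) ?_).mp h
  refine Eq.trans ?_
    (integral_toCube ((Complex.continuous_conj.comp_aestronglyMeasurable hf.1).mul hg.1))
  refine integral_congr_ae ?_
  filter_upwards [(memLp_comp_toCube hf).coeFn_toLp, (memLp_comp_toCube hg).coeFn_toLp]
    with y h1 h2
  simp only [h1, h2]

/-- The Riesz-Fischer theorem on the cell. -/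
theorem exists_memLp_cubeCoeff {c : (Fin n → ℤ) → ℂ} (hc : Summable fun ξ => ‖c ξ‖ ^ 2) :
    ∃ f : (Fin n → ℝ) → ℂ, MemLp f 2 (cubeMeasure n) ∧ ∀ ξ, cubeCoeff f ξ = c ξ := by
  have hm : Memℓp c 2 := memℓp_gen (by simpa using hc)
  set F := mFourierBasis.repr.symm (⟨c, hm⟩ : lp (fun _ : Fin n → ℤ => ℂ) 2)
  have hF : MemLp (fun x => F (toTorus x)) 2 (cubeMeasure n) :=
    (Lp.memLp F).comp_measurePreserving measurePreserving_toTorus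
  refine ⟨fun x => F (toTorus x), hF, fun ξ => ?_⟩
  rw [← mFourierCoeff_comp_toCube hF.1]
  simp only [toTorus_toCube]
  rw [← mFourierBasis_repr]
  simp [F]

/-- An integrable function is determined by its Fourier coefficients. -/
theorem ae_eq_zero_of_cubeCoeff_eq_zero {f : (Fin n → ℝ) → ℂ} (hf : Integrable f (cubeMeasure n))
    (h : ∀ ξ, cubeCoeff f ξ = 0) : f =ᵐ[cubeMeasure n] 0 := by
  set F : UnitAddTorus (Fin n) → ℂ := fun y => f (toCube y)
  have hF : Integrable F volume :=
    measurePreserving_toCube.integrable_comp_of_integrable hf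
  -- The functional `g ↦ ∫ g F` is bounded for the supremum norm and vanishes on all characters,
  -- whose span is dense in the continuous functions.
  have hcont : ∀ g : C(UnitAddTorus (Fin n), ℂ), ∫ y, g y * F y = 0 := by
    have hint : ∀ g : C(UnitAddTorus (Fin n), ℂ), Integrable (fun y => g y * F y) volume :=
      fun g => hF.bdd_mul g.continuous.aestronglyMeasurable
        (Eventually.of_forall fun y => g.norm_coe_le_norm y)
    let L : C(UnitAddTorus (Fin n), ℂ) →ₗ[ℂ] ℂ :=
      { toFun := fun g => ∫ y, g y * F y
        map_add' := fun g₁ g₂ => by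
          simp only [ContinuousMap.add_apply, add_mul]
          exact integral_add (hint g₁) (hint g₂)
        map_smul' := fun c g => by
          simp only [ContinuousMap.smul_apply, smul_eq_mul, mul_assoc, RingHom.id_apply]
          exact integral_const_mul _ _ }
    have hL : Continuous L := by
      refine AddMonoidHomClass.continuous_of_bound L (∫ y, ‖F y‖) fun g => ?_
      calc ‖L g‖ ≤ ∫ y, ‖g y * F y‖ := norm_integral_le_integral_norm _
        _ ≤ ∫ y, ‖g‖ * ‖F y‖ := by
            refine integral_mono (hint g).norm (hF.norm.const_mul _) fun y => ?_
            simp only [norm_mul]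
            gcongr
            exact g.norm_coe_le_norm y
        _ = _ := by rw [integral_const_mul, mul_comm]
    have hspan : Submodule.span ℂ (Set.range (mFourier (d := Fin n))) ≤ LinearMap.ker L := by
      rw [Submodule.span_le]
      rintro _ ⟨ξ, rfl⟩
      have h1 := h (-ξ)
      rw [← mFourierCoeff_comp_toCube hf.1, mFourierCoeff, neg_neg] at h1
      exact h1
    have hcl : IsClosed ((LinearMap.ker L : Submodule ℂ C(UnitAddTorus (Fin n), ℂ)) :
        Set C(UnitAddTorus (Fin n), ℂ)) := isClosed_singleton.preimage hL
    have htop := Submodule.topologicalClosure_minimal _ hspan hcl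
    rw [span_mFourier_closure_eq_top] at htop
    exact fun g => htop (Submodule.mem_top (x := g))
  -- It suffices that the integral over each closed set vanishes; the indicator of such a set is a
  -- bounded pointwise limit of continuous functions.
  have hF0 : F =ᵐ[volume] 0 := by
    refine ae_eq_zero_of_forall_setIntegral_isClosed_eq_zero hF fun s hs => ?_
    have hlim : Tendsto (fun k => ∫ y, ((hs.apprSeq k y : NNReal) : ℂ) * F y) atTop
        (𝓝 (∫ y, s.indicator F y)) := by
      refine tendsto_integral_of_dominated_convergence (fun y => ‖F y‖) (fun k => ?_) hF.norm
        (fun k => Eventually.of_forall fun y => ?_) (Eventually.of_forall fun y => ?_)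
      · refine AEStronglyMeasurable.mul (Continuous.aestronglyMeasurable ?_) hF.1
        exact Complex.continuous_ofReal.comp
          (NNReal.continuous_coe.comp (hs.apprSeq k).continuous)
      · rw [norm_mul]
        refine mul_le_of_le_one_left (norm_nonneg _) ?_
        simp only [Complex.norm_real, Real.norm_eq_abs, NNReal.abs_eq]
        exact_mod_cast HasOuterApproxClosed.apprSeq_apply_le_one hs k y
      · have h1 := (tendsto_pi_nhds.mp (HasOuterApproxClosed.tendsto_apprSeq hs)) y
        have h2 : Tendsto (fun k => ((hs.apprSeq k y : NNReal) : ℂ)) atTop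
            (𝓝 ((s.indicator (fun _ => (1 : NNReal)) y : NNReal) : ℂ)) :=
          ((Complex.continuous_ofReal.comp NNReal.continuous_coe).tendsto _).comp h1
        have h3 := h2.mul_const (F y)
        convert h3 using 2
        by_cases hy : y ∈ s <;> simp [hy]
    have hz : ∀ k, ∫ y, ((hs.apprSeq k y : NNReal) : ℂ) * F y = 0 := fun k =>
      hcont ⟨fun y => ((hs.apprSeq k y : NNReal) : ℂ), Complex.continuous_ofReal.comp
          (NNReal.continuous_coe.comp (hs.apprSeq k).continuous)⟩
    simp only [hz] at hlim
    rw [← integral_indicator hs.measurableSet]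
    exact (tendsto_nhds_unique hlim tendsto_const_nhds)
  have h1 : (fun x => F (toTorus x)) =ᵐ[cubeMeasure n] 0 :=
    measurePreserving_toTorus.quasiMeasurePreserving.ae_eq_comp hF0
  filter_upwards [h1, ae_restrict_mem measurableSet_cube] with x hx hxc
  simpa [F, toCube_toTorus hxc] using hx

/-- The section `toCube` jumps where a coordinate reaches the boundary of the cell, but a periodic
function does not see the jump: its lift to `ℝⁿ` is `f` itself, and continuity descends along the
open quotient map. -/
theorem continuous_comp_toCube {E : Type*} [TopologicalSpace E] {f : (Fin n → ℝ) → E}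
    (hf : Continuous f)
    (hper : ∀ (x : Fin n → ℝ) (m : Fin n → ℤ), f (x + fun i => (m i : ℝ)) = f x) :
    Continuous fun y => f (toCube y) := by
  have hq : IsOpenQuotientMap (toTorus (n := n)) :=
    IsOpenQuotientMap.piMap fun _ => QuotientAddGroup.isOpenQuotientMap_mk
  rw [hq.isQuotientMap.continuous_iff]
  convert hf using 1
  ext x
  obtain ⟨m, hm⟩ := exists_toCube_toTorus x
  simp [hm, hper]

/-- Pointwise Fourier inversion for continuous periodic functions with summable coefficients. -/
theorem hasSum_cubeCoeff_mul_expFn {f : (Fin n → ℝ) → ℂ} (hf : Continuous f)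
    (hper : ∀ (x : Fin n → ℝ) (m : Fin n → ℤ), f (x + fun i => (m i : ℝ)) = f x)
    (hs : Summable (cubeCoeff f)) (x : Fin n → ℝ) :
    HasSum (fun ξ => cubeCoeff f ξ * expFn ξ x) (f x) := by
  set F : C(UnitAddTorus (Fin n), ℂ) := ⟨_, continuous_comp_toCube hf hper⟩
  have hF : mFourierCoeff F = cubeCoeff f :=
    funext fun ξ => mFourierCoeff_comp_toCube hf.aestronglyMeasurable ξ
  have h := hasSum_mFourier_series_apply_of_summable (f := F) (by rwa [hF]) (toTorus x)
  simp only [hF, mFourier_toTorus, smul_eq_mul] at h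
  convert h using 1
  obtain ⟨m, hm⟩ := exists_toCube_toTorus x
  simp [F, hm, hper]

theorem cubeCoeff_expFn (η ξ : Fin n → ℤ) :
    cubeCoeff (expFn η) ξ = if ξ = η then 1 else 0 := by
  have h := (orthonormal_iff_ite.mp (orthonormal_mFourier (d := Fin n))) ξ η
  rw [ContinuousMap.inner_toLp] at h
  rw [← h, ← mFourierCoeff_comp_toCube (continuous_expFn η).aestronglyMeasurable]
  simp only [mFourierCoeff, smul_eq_mul, ← mFourier_toTorus, toTorus_toCube, mFourier_neg, mul_comm]

/-- The integral of a continuous periodic function over the cell is translation invariant. -/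
theorem integral_cube_add {f : (Fin n → ℝ) → ℝ} (hf : Continuous f)
    (hper : ∀ (x : Fin n → ℝ) (m : Fin n → ℤ), f (x + fun i => (m i : ℝ)) = f x)
    (v : Fin n → ℝ) :
    ∫ x, f (x + v) ∂cubeMeasure n = ∫ x, f x ∂cubeMeasure n := by
  have key : ∀ g : (Fin n → ℝ) → ℝ, Continuous g →
      ∫ x, g x ∂cubeMeasure n = ∫ y, g (toCube y) := by
    intro g hg
    rw [← (measurePreserving_toCube (n := n)).map_eq, integral_map
      measurable_toCube.aemeasurable hg.aestronglyMeasurable]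
  -- On the torus the claim is the translation invariance of Haar measure; periodicity absorbs the
  -- lattice vector that brings the translate back into the cell.
  rw [key (fun x => f (x + v)) (hf.comp (continuous_add_const v)), key _ hf,
    ← integral_add_right_eq_self (fun y => f (toCube y)) (toTorus v)]
  congr 1
  ext y
  have h1 : y + toTorus v = toTorus (toCube y + v) := by
    conv_lhs => rw [← toTorus_toCube y]
    ext i
    simp [toTorus]
  obtain ⟨m, hm⟩ := exists_toCube_toTorus (toCube y + v)
  rw [h1, hm, hper]

end Torus

/-! ## Fourier coefficients of torus distributions -/

theorem TestFn.ext_coe {φ ψ : TestFn n} (h : ∀ x, (φ : (Fin n → ℝ) → ℝ) x = (ψ : (Fin n → ℝ) → ℝ) x) :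
    φ = ψ :=
  Subtype.ext (funext h)

theorem cosFn_neg (ξ : Fin n → ℤ) : cosFn (-ξ) = cosFn ξ :=
  TestFn.ext_coe fun x => by
    change Real.cos (2 * Real.pi * ∑ i, x i * (((-ξ) i : ℤ) : ℝ)) = Real.cos _
    rw [← Real.cos_neg]; simp

theorem sinFn_neg (ξ : Fin n → ℤ) : sinFn (-ξ) = -sinFn ξ :=
  TestFn.ext_coe fun x => by
    change Real.sin (2 * Real.pi * ∑ i, x i * (((-ξ) i : ℤ) : ℝ)) = -Real.sin _
    rw [← Real.sin_neg]; simp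

theorem hasFDerivAt_phase (ξ : Fin n → ℤ) (x : Fin n → ℝ) :
    HasFDerivAt (fun x : Fin n → ℝ => 2 * Real.pi * ∑ i, x i * (ξ i : ℝ))
      ((2 * Real.pi) • ∑ i, (ξ i : ℝ) • ContinuousLinearMap.proj (R := ℝ) (φ := fun _ : Fin n => ℝ) i)
      x := by
  refine HasFDerivAt.const_mul (HasFDerivAt.fun_sum fun i _ => ?_) _
  exact (hasFDerivAt_apply i x).mul_const _

theorem phase_fderiv_apply (ξ : Fin n → ℤ) (j : Fin n) :
    ((2 * Real.pi) • ∑ i, (ξ i : ℝ) • ContinuousLinearMap.proj (R := ℝ) (φ := fun _ : Fin n => ℝ) i)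
      (Pi.single j 1) = 2 * Real.pi * ξ j := by
  simp [Pi.single_apply]

theorem partialDeriv_cosFn (j : Fin n) (ξ : Fin n → ℤ) :
    TestFn.partialDeriv j (cosFn ξ) = (-(2 * Real.pi * ξ j)) • sinFn ξ :=
  TestFn.ext_coe fun x => by
    change fderiv ℝ (fun x : Fin n → ℝ => Real.cos (2 * Real.pi * ∑ i, x i * (ξ i : ℝ))) x
      (Pi.single j 1) = -(2 * Real.pi * ξ j) * Real.sin (2 * Real.pi * ∑ i, x i * (ξ i : ℝ))
    rw [((hasFDerivAt_phase ξ x).cos).fderiv, _root_.smul_apply, phase_fderiv_apply,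
      smul_eq_mul]
    ring

theorem partialDeriv_sinFn (j : Fin n) (ξ : Fin n → ℤ) :
    TestFn.partialDeriv j (sinFn ξ) = (2 * Real.pi * ξ j) • cosFn ξ :=
  TestFn.ext_coe fun x => by
    change fderiv ℝ (fun x : Fin n → ℝ => Real.sin (2 * Real.pi * ∑ i, x i * (ξ i : ℝ))) x
      (Pi.single j 1) = (2 * Real.pi * ξ j) * Real.cos (2 * Real.pi * ∑ i, x i * (ξ i : ℝ))
    rw [((hasFDerivAt_phase ξ x).sin).fderiv, _root_.smul_apply, phase_fderiv_apply,
      smul_eq_mul]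
    ring

theorem fourier_re (g : TorusDist n) (ξ : Fin n → ℤ) : (g.fourier ξ).re = g.1 (cosFn ξ) := by
  simp [TorusDist.fourier]

theorem fourier_im (g : TorusDist n) (ξ : Fin n → ℤ) : (g.fourier ξ).im = -g.1 (sinFn ξ) := by
  simp [TorusDist.fourier]

theorem fourier_neg (g : TorusDist n) (ξ : Fin n → ℤ) : g.fourier (-ξ) = conj (g.fourier ξ) := by
  apply Complex.ext
  · simp [fourier_re, cosFn_neg]
  · simp [fourier_im, sinFn_neg]

theorem norm_fourier_neg (g : TorusDist n) (ξ : Fin n → ℤ) : ‖g.fourier (-ξ)‖ = ‖g.fourier ξ‖ := by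
  rw [fourier_neg, RCLike.norm_conj]

theorem fourier_add (g h : TorusDist n) (ξ : Fin n → ℤ) :
    (g + h).fourier ξ = g.fourier ξ + h.fourier ξ := by
  apply Complex.ext
  · simp [fourier_re]
  · simp [fourier_im]; ring

theorem fourier_sub (g h : TorusDist n) (ξ : Fin n → ℤ) :
    (g - h).fourier ξ = g.fourier ξ - h.fourier ξ := by
  apply Complex.ext
  · simp [fourier_re]
  · simp [fourier_im]; ring

theorem fourier_neg_dist (g : TorusDist n) (ξ : Fin n → ℤ) : (-g).fourier ξ = -g.fourier ξ := by
  apply Complex.ext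
  · simp [fourier_re]
  · simp [fourier_im]

theorem fourier_smul (c : ℝ) (g : TorusDist n) (ξ : Fin n → ℤ) :
    (c • g).fourier ξ = c * g.fourier ξ := by
  apply Complex.ext
  · simp [fourier_re]
  · simp [fourier_im]

theorem fourier_zero_dist (ξ : Fin n → ℤ) : (0 : TorusDist n).fourier ξ = 0 := by
  simp [TorusDist.fourier]

theorem fourier_sum {ι : Type*} (s : Finset ι) (g : ι → TorusDist n) (ξ : Fin n → ℤ) :
    (∑ i ∈ s, g i).fourier ξ = ∑ i ∈ s, (g i).fourier ξ := by
  classical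
  induction s using Finset.induction_on with
  | empty => simp [fourier_zero_dist]
  | insert i s hi ih => rw [Finset.sum_insert hi, Finset.sum_insert hi, fourier_add, ih]

theorem fourier_partialDeriv (j : Fin n) (g : TorusDist n) (ξ : Fin n → ℤ) :
    (g.partialDeriv j).fourier ξ = 2 * Real.pi * Complex.I * ξ j * g.fourier ξ := by
  have h1 : (g.partialDeriv j).1 (cosFn ξ) = 2 * Real.pi * ξ j * g.1 (sinFn ξ) := by
    change -(g.1 (TestFn.partialDeriv j (cosFn ξ))) = _
    rw [partialDeriv_cosFn, map_smul, smul_eq_mul]; ring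
  have h2 : (g.partialDeriv j).1 (sinFn ξ) = -(2 * Real.pi * ξ j * g.1 (cosFn ξ)) := by
    change -(g.1 (TestFn.partialDeriv j (sinFn ξ))) = _
    rw [partialDeriv_sinFn, map_smul, smul_eq_mul]
  rw [TorusDist.fourier, TorusDist.fourier, h1, h2]
  push_cast
  linear_combination (2 * (Real.pi : ℂ) * ξ j * g.1 (sinFn ξ)) * Complex.I_sq

theorem fourier_divergence (G : VecDist n) (ξ : Fin n → ℤ) :
    (divergence G).fourier ξ = 2 * Real.pi * Complex.I * ∑ k, ξ k * (G k).fourier ξ := by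
  simp only [divergence, fourier_sum, fourier_partialDeriv, Finset.mul_sum]
  exact Finset.sum_congr rfl fun k _ => by ring

/-! ### Regular distributions and integration by parts on the cell -/

theorem ofFun_apply {f : (Fin n → ℝ) → ℝ} (hf : IntegrableOn f (cube n)) (φ : TestFn n) :
    (TorusDist.ofFun f).1 φ = ∫ x, f x * (φ : (Fin n → ℝ) → ℝ) x ∂cubeMeasure n := by
  rw [TorusDist.ofFun, dif_pos hf]
  rfl

theorem fourier_ofFun {f : (Fin n → ℝ) → ℝ} (hf : IntegrableOn f (cube n)) (ξ : Fin n → ℤ) :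
    (TorusDist.ofFun f).fourier ξ = cubeCoeff (fun x => (f x : ℂ)) ξ := by
  have h1 := (TestFn.integrableOn_mul hf (cosFn ξ)).ofReal (𝕜 := ℂ)
  have h2 := (TestFn.integrableOn_mul hf (sinFn ξ)).ofReal (𝕜 := ℂ)
  rw [TorusDist.fourier, ofFun_apply hf, ofFun_apply hf, ← integral_complex_ofReal,
    ← integral_complex_ofReal, ← integral_const_mul]
  refine (integral_sub h1 (h2.const_mul Complex.I)).symm.trans ?_
  refine integral_congr_ae (Eventually.of_forall fun x => ?_)
  simp only
  rw [expFn_neg, expFn_eq]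
  simp
  ring

theorem TestFn.integrableOn (φ : TestFn n) : IntegrableOn (φ : (Fin n → ℝ) → ℝ) (cube n) := by
  have h := TestFn.integrableOn_mul
    (f := fun _ : Fin n → ℝ => (1 : ℝ)) (integrable_const (μ := cubeMeasure n) 1) φ
  simpa using h

theorem fourier_toDist (φ : TestFn n) (ξ : Fin n → ℤ) :
    φ.toDist.fourier ξ = cubeCoeff (fun x => ((φ : (Fin n → ℝ) → ℝ) x : ℂ)) ξ :=
  fourier_ofFun φ.integrableOn ξ

theorem toCube_mem (y : UnitAddTorus (Fin n)) (i : Fin n) : toCube y i ∈ Set.Ico (0 : ℝ) 1 := by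
  have h := (AddCircle.equivIco (1 : ℝ) 0 (y i)).2
  exact ⟨h.1, h.2.trans_eq (zero_add 1)⟩

theorem TestFn.exists_bound (φ : TestFn n) : ∃ C, ∀ x, ‖(φ : (Fin n → ℝ) → ℝ) x‖ ≤ C := by
  obtain ⟨C, hC⟩ := (isCompact_Icc (a := (0 : Fin n → ℝ)) (b := 1)).exists_bound_of_continuousOn
    φ.2.1.continuous.continuousOn
  refine ⟨C, fun x => ?_⟩
  obtain ⟨m, hm⟩ := exists_toCube_toTorus x
  rw [← φ.2.2 x m, ← hm]
  have h : ∀ i, toCube (toTorus x) i ∈ Set.Ico (0 : ℝ) 1 := toCube_mem _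
  exact hC _ ⟨fun i => (h i).1, fun i => (h i).2.le⟩

/-- By translation invariance the integral of `φ(x + s e_j)` does not depend on `s`; differentiating
under the integral at `s = 0` gives the claim without any boundary terms. -/
theorem integral_partialDeriv (j : Fin n) (φ : TestFn n) :
    ∫ x, (TestFn.partialDeriv j φ : (Fin n → ℝ) → ℝ) x ∂cubeMeasure n = 0 := by
  obtain ⟨C, hC⟩ := (TestFn.partialDeriv j φ).exists_bound
  have hcont : Continuous (φ : (Fin n → ℝ) → ℝ) := φ.2.1.continuous
  have hcont' : Continuous (TestFn.partialDeriv j φ : (Fin n → ℝ) → ℝ) :=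
    (TestFn.partialDeriv j φ).2.1.continuous
  set e : Fin n → ℝ := Pi.single j 1 with he
  have hder : ∀ (x : Fin n → ℝ) (s : ℝ), HasDerivAt (fun s : ℝ => (φ : (Fin n → ℝ) → ℝ) (x + s • e))
      ((TestFn.partialDeriv j φ : (Fin n → ℝ) → ℝ) (x + s • e)) s := by
    intro x s
    have h1 : HasDerivAt (fun s : ℝ => x + s • e) ((1 : ℝ) • e) s :=
      ((hasDerivAt_id s).smul_const e).const_add x
    rw [one_smul] at h1
    exact ((φ.2.1.differentiable (by simp)) _).hasFDerivAt.comp_hasDerivAt s h1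
  have hm : ∀ s : ℝ, AEStronglyMeasurable (fun x => (φ : (Fin n → ℝ) → ℝ) (x + s • e))
      (cubeMeasure n) := fun s => (hcont.comp (continuous_add_const _)).aestronglyMeasurable
  have hm' : AEStronglyMeasurable (fun x => (TestFn.partialDeriv j φ : (Fin n → ℝ) → ℝ)
      (x + (0 : ℝ) • e)) (cubeMeasure n) :=
    (hcont'.comp (continuous_add_const _)).aestronglyMeasurable
  have hi : Integrable (fun x => (φ : (Fin n → ℝ) → ℝ) (x + (0 : ℝ) • e)) (cubeMeasure n) := by
    simp only [zero_smul, add_zero]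
    exact φ.integrableOn
  have h := hasDerivAt_integral_of_dominated_loc_of_deriv_le (μ := cubeMeasure n) (𝕜 := ℝ)
    (F := fun (s : ℝ) x => (φ : (Fin n → ℝ) → ℝ) (x + s • e))
    (F' := fun s x => (TestFn.partialDeriv j φ : (Fin n → ℝ) → ℝ) (x + s • e))
    (x₀ := 0) (s := Set.univ) (bound := fun _ => C) Filter.univ_mem
    (Eventually.of_forall hm) hi hm' (Eventually.of_forall fun x s _ => hC _) (integrable_const _)
    (Eventually.of_forall fun x s _ => hder x s)
  have hconst : (fun s : ℝ => ∫ x, (φ : (Fin n → ℝ) → ℝ) (x + s • e)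
      ∂cubeMeasure n) = fun _ => ∫ x, (φ : (Fin n → ℝ) → ℝ) x ∂cubeMeasure n :=
    funext fun s => integral_cube_add hcont φ.2.2 _
  have h2 := h.2
  rw [hconst] at h2
  have h3 := h2.unique (hasDerivAt_const _ _)
  simpa using h3

/-- The product of two test functions. -/
def TestFn.mulFn (φ ψ : TestFn n) : TestFn n :=
  ⟨fun x => (φ : (Fin n → ℝ) → ℝ) x * (ψ : (Fin n → ℝ) → ℝ) x, φ.2.1.mul ψ.2.1, fun x m => by
    simp [φ.2.2 x m, ψ.2.2 x m]⟩

/-- Integration by parts: the derivative of the product of two test functions has zero integral. -/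
theorem toDist_partialDeriv (j : Fin n) (φ : TestFn n) :
    (TestFn.partialDeriv j φ).toDist = φ.toDist.partialDeriv j := by
  refine Subtype.ext (LinearMap.ext fun ψ => ?_)
  have hl : (TestFn.partialDeriv j φ).toDist.1 ψ = ∫ x, (TestFn.partialDeriv j φ :
      (Fin n → ℝ) → ℝ) x * (ψ : (Fin n → ℝ) → ℝ) x ∂cubeMeasure n :=
    ofFun_apply (TestFn.partialDeriv j φ).integrableOn ψ
  have hr : (φ.toDist.partialDeriv j).1 ψ = -∫ x, (φ : (Fin n → ℝ) → ℝ) x *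
      (TestFn.partialDeriv j ψ : (Fin n → ℝ) → ℝ) x ∂cubeMeasure n := by
    change -(φ.toDist.1 (TestFn.partialDeriv j ψ)) = _
    rw [TestFn.toDist, ofFun_apply φ.integrableOn]
  have h := integral_partialDeriv j (φ.mulFn ψ)
  have e : ∀ x, (TestFn.partialDeriv j (φ.mulFn ψ) : (Fin n → ℝ) → ℝ) x =
      (TestFn.partialDeriv j φ : (Fin n → ℝ) → ℝ) x * (ψ : (Fin n → ℝ) → ℝ) x +
        (φ : (Fin n → ℝ) → ℝ) x * (TestFn.partialDeriv j ψ : (Fin n → ℝ) → ℝ) x := by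
    intro x
    have h1 := (φ.2.1.differentiable (by simp) x).hasFDerivAt.mul
      (ψ.2.1.differentiable (by simp) x).hasFDerivAt
    change fderiv ℝ ((φ : (Fin n → ℝ) → ℝ) * (ψ : (Fin n → ℝ) → ℝ)) x _ = _
    rw [h1.fderiv]
    simp only [_root_.add_apply, _root_.smul_apply, smul_eq_mul]
    change _ * (TestFn.partialDeriv j ψ : (Fin n → ℝ) → ℝ) x +
      _ * (TestFn.partialDeriv j φ : (Fin n → ℝ) → ℝ) x = _
    ring
  simp only [e] at h
  have h3 := integral_add (μ := cubeMeasure n)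
    (TestFn.integrableOn_mul (TestFn.partialDeriv j φ).integrableOn ψ)
    (TestFn.integrableOn_mul φ.integrableOn (TestFn.partialDeriv j ψ))
  rw [hl, hr]
  linarith [h3.symm.trans h]

/-! ### Decay of the Fourier coefficients of test functions -/

theorem norm_fourier_toDist_le {φ : TestFn n} {B : ℝ} (hB : ∀ x, ‖(φ : (Fin n → ℝ) → ℝ) x‖ ≤ B)
    (ξ : Fin n → ℤ) : ‖φ.toDist.fourier ξ‖ ≤ B := by
  rw [fourier_toDist, cubeCoeff]
  refine (norm_integral_le_of_norm_le_const (C := B) (Eventually.of_forall fun x => ?_)).trans ?_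
  · rw [norm_mul, norm_expFn, one_mul, Complex.norm_real]
    exact hB x
  · simp

theorem norm_iteratedFDeriv_iterate_partialDeriv_le (j : Fin n) (m : ℕ) (φ : TestFn n) (k : ℕ)
    (x : Fin n → ℝ) :
    ‖iteratedFDeriv ℝ k (((TestFn.partialDeriv j)^[m] φ : TestFn n) : (Fin n → ℝ) → ℝ) x‖ ≤
      ‖iteratedFDeriv ℝ (k + m) (φ : (Fin n → ℝ) → ℝ) x‖ := by
  induction m generalizing k with
  | zero => simp
  | succ m ih =>
    rw [Function.iterate_succ_apply']
    refine (TestFn.norm_iteratedFDeriv_partialDeriv_le j _ k x).trans ((ih (k + 1)).trans ?_)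
    rw [show k + 1 + m = k + (m + 1) by ring]

theorem fourier_toDist_iterate_partialDeriv (j : Fin n) (m : ℕ) (φ : TestFn n) (ξ : Fin n → ℤ) :
    ((TestFn.partialDeriv j)^[m] φ).toDist.fourier ξ =
      (2 * Real.pi * Complex.I * ξ j) ^ m * φ.toDist.fourier ξ := by
  induction m with
  | zero => simp
  | succ m ih =>
    rw [Function.iterate_succ_apply', toDist_partialDeriv, fourier_partialDeriv, ih]
    ring

/-- Rapid decay of the Fourier coefficients of a test function. -/
theorem rho_pow_mul_norm_fourier_toDist_le (N : ℕ) {φ : TestFn n} {B : ℝ}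
    (hB : ∀ k ≤ 2 * N, ∀ x, ‖iteratedFDeriv ℝ k (φ : (Fin n → ℝ) → ℝ) x‖ ≤ B) (ξ : Fin n → ℤ) :
    rho ξ ^ (2 * N) * ‖φ.toDist.fourier ξ‖ ≤ ((2 * Real.pi) ^ 2 * (n + 1)) ^ N * B := by
  have hpi : (1 : ℝ) ≤ (2 * Real.pi) ^ 2 := by nlinarith [Real.pi_gt_three]
  have hB0 : 0 ≤ B := (norm_nonneg _).trans (hB 0 (by omega) 0)
  have h0 : ‖φ.toDist.fourier ξ‖ ≤ B := norm_fourier_toDist_le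
    (fun x => by simpa [norm_iteratedFDeriv_zero] using hB 0 (by omega) x) ξ
  by_cases hξ : ξ = 0
  · have : rho ξ ^ 2 ≤ (2 * Real.pi) ^ 2 * (n + 1) := by
      rw [rho_sq, hξ]
      have : (0 : ℝ) ≤ n := Nat.cast_nonneg n
      simp [freqSq]
      nlinarith
    rw [pow_mul]
    gcongr
  · obtain ⟨i, hi⟩ := Function.ne_iff.mp hξ
    -- The largest coordinate controls the weight, `ϱ(ξ)² ≤ (n+1)(2πξ_j)²`, so `2N` derivatives in
    -- this single direction give all the decay.
    obtain ⟨j, -, hj⟩ := Finset.exists_max_image Finset.univ (fun i => (ξ i : ℝ) ^ 2)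
      ⟨i, Finset.mem_univ i⟩
    have h1 : 1 ≤ (ξ j : ℝ) ^ 2 := by
      refine le_trans ?_ (hj i (Finset.mem_univ i))
      have : 0 < (ξ i) ^ 2 := by have : ξ i ≠ 0 := hi; positivity
      exact_mod_cast this
    have h2 : freqSq ξ ≤ n * (ξ j : ℝ) ^ 2 := by
      have := Finset.sum_le_card_nsmul Finset.univ (fun i => (ξ i : ℝ) ^ 2) _ hj
      simpa [freqSq] using this
    have h3 : rho ξ ^ 2 ≤ (n + 1) * (2 * Real.pi * (ξ j : ℝ)) ^ 2 := by
      rw [rho_sq]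
      have : (0 : ℝ) ≤ (2 * Real.pi) ^ 2 := by positivity
      nlinarith
    have h4 : (2 * Real.pi * (ξ j : ℝ)) ^ (2 * N) * ‖φ.toDist.fourier ξ‖ ≤ B := by
      have h5 := norm_fourier_toDist_le (φ := (TestFn.partialDeriv j)^[2 * N] φ) (B := B)
        (fun x => by
          have h6 := norm_iteratedFDeriv_iterate_partialDeriv_le j (2 * N) φ 0 x
          rw [norm_iteratedFDeriv_zero] at h6
          exact h6.trans (hB _ (by omega) x)) ξ
      rw [fourier_toDist_iterate_partialDeriv, norm_mul, norm_pow] at h5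
      have e : ‖2 * (Real.pi : ℂ) * Complex.I * (ξ j : ℂ)‖ = |2 * Real.pi * (ξ j : ℝ)| := by
        rw [← Complex.ofReal_intCast, norm_mul, norm_mul, norm_mul, Complex.norm_I, mul_one,
          Complex.norm_real, Complex.norm_real, abs_mul, abs_mul]
        simp
      rwa [e, pow_mul, sq_abs, ← pow_mul] at h5
    calc rho ξ ^ (2 * N) * ‖φ.toDist.fourier ξ‖
        ≤ ((n + 1) * (2 * Real.pi * (ξ j : ℝ)) ^ 2) ^ N * ‖φ.toDist.fourier ξ‖ := by
          rw [pow_mul]; gcongr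
      _ = (n + 1) ^ N * ((2 * Real.pi * (ξ j : ℝ)) ^ (2 * N) * ‖φ.toDist.fourier ξ‖) := by
          rw [mul_pow, ← pow_mul]; ring
      _ ≤ (1 * (n + 1)) ^ N * B := by rw [one_mul]; gcongr
      _ ≤ _ := by gcongr

theorem TestFn.exists_iteratedFDeriv_bound (φ : TestFn n) (N : ℕ) :
    ∃ B, ∀ k ≤ N, ∀ x, ‖iteratedFDeriv ℝ k (φ : (Fin n → ℝ) → ℝ) x‖ ≤ B := by
  have h : ∀ k : ℕ, ∃ B, ∀ x, ‖iteratedFDeriv ℝ k (φ : (Fin n → ℝ) → ℝ) x‖ ≤ B := by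
    intro k
    obtain ⟨C, hC⟩ := (isCompact_Icc (a := (0 : Fin n → ℝ)) (b := 1)).exists_bound_of_continuousOn
      (φ.2.1.continuous_iteratedFDeriv (m := k) (by exact_mod_cast le_top)).continuousOn
    refine ⟨C, fun x => ?_⟩
    obtain ⟨m, hm⟩ := exists_toCube_toTorus x
    have hp : (fun y => (φ : (Fin n → ℝ) → ℝ) (y + fun i => (m i : ℝ))) = φ :=
      funext fun y => φ.2.2 y m
    have h1 : iteratedFDeriv ℝ k (φ : (Fin n → ℝ) → ℝ) x =
        iteratedFDeriv ℝ k (φ : (Fin n → ℝ) → ℝ) (x + fun i => (m i : ℝ)) := by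
      rw [← iteratedFDeriv_comp_add_right, hp]
    rw [h1, ← hm]
    have h : ∀ i, toCube (toTorus x) i ∈ Set.Ico (0 : ℝ) 1 := toCube_mem _
    exact hC _ ⟨fun i => (h i).1, fun i => (h i).2.le⟩
  choose B hB using h
  refine ⟨∑ k ∈ Finset.range (N + 1), |B k|, fun k hk x => (hB k x).trans ((le_abs_self _).trans ?_)⟩
  exact Finset.single_le_sum (f := fun k => |B k|) (fun _ _ => abs_nonneg _)
    (Finset.mem_range.mpr (by omega))

/-- The coefficients of a test function are summable against every power of `ϱ`. -/
theorem summable_rho_pow_mul_fourier_toDist (φ : TestFn n) (m : ℕ) :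
    Summable fun ξ => rho ξ ^ m * ‖φ.toDist.fourier ξ‖ := by
  -- Of the `2(m+n)` powers of `ϱ` that are available, `2n` are spent on summability over the
  -- lattice.
  obtain ⟨B, hB⟩ := φ.exists_iteratedFDeriv_bound (2 * (m + n))
  refine Summable.of_nonneg_of_le (fun ξ => by have := rho_pos ξ; positivity) (fun ξ => ?_)
    (summable_rho_rpow_neg (n := n).mul_left (((2 * Real.pi) ^ 2 * (n + 1)) ^ (m + n) * B))
  have h := rho_pow_mul_norm_fourier_toDist_le (m + n) hB ξ
  have hr := rho_pos ξ
  have h1 := one_le_rho ξ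
  rw [Real.rpow_neg hr.le, show (2 * n : ℝ) = ((2 * n : ℕ) : ℝ) by push_cast; ring,
    Real.rpow_natCast, ← div_eq_mul_inv, le_div_iff₀ (by positivity)]
  calc rho ξ ^ m * ‖φ.toDist.fourier ξ‖ * rho ξ ^ (2 * n)
      = rho ξ ^ (m + 2 * n) * ‖φ.toDist.fourier ξ‖ := by ring
    _ ≤ rho ξ ^ (2 * (m + n)) * ‖φ.toDist.fourier ξ‖ := by gcongr; omega
    _ ≤ _ := h

theorem TestFn.hasSum_fourier (φ : TestFn n) (x : Fin n → ℝ) :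
    HasSum (fun ξ => φ.toDist.fourier ξ * expFn ξ x) ((φ : (Fin n → ℝ) → ℝ) x : ℂ) := by
  simp only [fourier_toDist]
  refine hasSum_cubeCoeff_mul_expFn (f := fun x => ((φ : (Fin n → ℝ) → ℝ) x : ℂ))
    (Complex.continuous_ofReal.comp φ.2.1.continuous) (fun x m => by rw [φ.2.2]) ?_ x
  refine Summable.of_norm ?_
  have h := summable_rho_pow_mul_fourier_toDist φ 0
  simpa [fourier_toDist] using h

/-- The phase `x ↦ 2π x·ξ` as a continuous linear form. -/
def phaseCLM (ξ : Fin n → ℤ) : (Fin n → ℝ) →L[ℝ] ℝ :=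
  (2 * Real.pi) • ∑ i, (ξ i : ℝ) • ContinuousLinearMap.proj (R := ℝ) (φ := fun _ : Fin n => ℝ) i

theorem phaseCLM_apply (ξ : Fin n → ℤ) (x : Fin n → ℝ) :
    phaseCLM ξ x = 2 * Real.pi * ∑ i, x i * (ξ i : ℝ) := by
  simp [phaseCLM, mul_comm]

theorem norm_phaseCLM_le (ξ : Fin n → ℤ) : ‖phaseCLM ξ‖ ≤ n * rho ξ := by
  have hr := rho_pos ξ
  refine ContinuousLinearMap.opNorm_le_bound _ (by positivity) fun x => ?_
  rw [phaseCLM_apply, Finset.mul_sum]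
  calc ‖∑ i, 2 * Real.pi * (x i * (ξ i : ℝ))‖ ≤ ∑ _i : Fin n, rho ξ * ‖x‖ := by
        refine norm_sum_le_of_le _ fun i _ => ?_
        have h1 := two_pi_abs_le_rho ξ i
        have h2 := norm_le_pi_norm x i
        have hpi := Real.pi_pos
        rw [norm_mul, norm_mul (x i), Real.norm_of_nonneg (by positivity), Real.norm_eq_abs (ξ i : ℝ)]
        calc _ = (2 * Real.pi * |(ξ i : ℝ)|) * ‖x i‖ := by ring
          _ ≤ _ := by gcongr
    _ = _ := by simp [mul_assoc]

theorem norm_iteratedFDeriv_comp_phaseCLM_le {f : ℝ → ℝ} (hf : ContDiff ℝ ∞ f) {k : ℕ}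
    (hb : ∀ y, |iteratedDeriv k f y| ≤ 1) (ξ : Fin n → ℤ) (x : Fin n → ℝ) :
    ‖iteratedFDeriv ℝ k (fun x => f (phaseCLM ξ x)) x‖ ≤ (n * rho ξ) ^ k := by
  have h := (phaseCLM ξ).iteratedFDeriv_comp_right hf x (i := k) (by exact_mod_cast le_top)
  change ‖iteratedFDeriv ℝ k (f ∘ phaseCLM ξ) x‖ ≤ _
  rw [h]
  refine (ContinuousMultilinearMap.norm_compContinuousLinearMap_le _ _).trans ?_
  rw [norm_iteratedFDeriv_eq_norm_iteratedDeriv, Finset.prod_const, Finset.card_univ,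
    Fintype.card_fin]
  calc _ ≤ 1 * (n * rho ξ) ^ k := by
        gcongr
        · exact hb _
        · exact norm_phaseCLM_le ξ
    _ = _ := one_mul _

theorem norm_iteratedFDeriv_cosFn_le (k : ℕ) (ξ : Fin n → ℤ) (x : Fin n → ℝ) :
    ‖iteratedFDeriv ℝ k (cosFn ξ : (Fin n → ℝ) → ℝ) x‖ ≤ (n * rho ξ) ^ k := by
  have h := norm_iteratedFDeriv_comp_phaseCLM_le Real.contDiff_cos
    (Real.abs_iteratedDeriv_cos_le_one k) ξ x
  simp only [phaseCLM_apply] at h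
  exact h

theorem norm_iteratedFDeriv_sinFn_le (k : ℕ) (ξ : Fin n → ℤ) (x : Fin n → ℝ) :
    ‖iteratedFDeriv ℝ k (sinFn ξ : (Fin n → ℝ) → ℝ) x‖ ≤ (n * rho ξ) ^ k := by
  have h := norm_iteratedFDeriv_comp_phaseCLM_le Real.contDiff_sin
    (Real.abs_iteratedDeriv_sin_le_one k) ξ x
  simp only [phaseCLM_apply] at h
  exact h

/-- The real mode `Re (c e^{2πi x·ξ})` as a test function. -/
def realMode (c : ℂ) (ξ : Fin n → ℤ) : TestFn n := c.re • cosFn ξ - c.im • sinFn ξ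

theorem realMode_apply (c : ℂ) (ξ : Fin n → ℤ) (x : Fin n → ℝ) :
    (realMode c ξ : (Fin n → ℝ) → ℝ) x = (c * expFn ξ x).re := by
  rw [expFn_eq]
  change c.re * (cosFn ξ : (Fin n → ℝ) → ℝ) x - c.im * (sinFn ξ : (Fin n → ℝ) → ℝ) x = _
  simp

theorem dist_realMode (g : TorusDist n) (c : ℂ) (ξ : Fin n → ℤ) :
    g.1 (realMode c ξ) = (g.fourier ξ * conj c).re := by
  simp [realMode, fourier_re, fourier_im]
  ring

theorem norm_iteratedFDeriv_realMode_le (c : ℂ) (ξ : Fin n → ℤ) (k : ℕ) (x : Fin n → ℝ) :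
    ‖iteratedFDeriv ℝ k (realMode c ξ : (Fin n → ℝ) → ℝ) x‖ ≤ 2 * ‖c‖ * (n * rho ξ) ^ k := by
  have hc : ContDiffAt ℝ k (cosFn ξ : (Fin n → ℝ) → ℝ) x :=
    ((cosFn ξ).2.1.of_le (by exact_mod_cast le_top)).contDiffAt
  have hs : ContDiffAt ℝ k (sinFn ξ : (Fin n → ℝ) → ℝ) x :=
    ((sinFn ξ).2.1.of_le (by exact_mod_cast le_top)).contDiffAt
  have h : iteratedFDeriv ℝ k (realMode c ξ : (Fin n → ℝ) → ℝ) x =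
      c.re • iteratedFDeriv ℝ k (cosFn ξ : (Fin n → ℝ) → ℝ) x +
        (-c.im) • iteratedFDeriv ℝ k (sinFn ξ : (Fin n → ℝ) → ℝ) x := by
    have e : (realMode c ξ : (Fin n → ℝ) → ℝ) = c.re • (cosFn ξ : (Fin n → ℝ) → ℝ) +
        (-c.im) • (sinFn ξ : (Fin n → ℝ) → ℝ) := by
      ext y; simp [realMode, sub_eq_add_neg]
    have hs' : ContDiffAt ℝ k ((-c.im) • (sinFn ξ : (Fin n → ℝ) → ℝ)) x := hs.const_smul (-c.im)
    have hc' : ContDiffAt ℝ k (c.re • (cosFn ξ : (Fin n → ℝ) → ℝ)) x := hc.const_smul c.re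
    rw [e, iteratedFDeriv_add_apply hc' hs',
      iteratedFDeriv_const_smul_apply hc, iteratedFDeriv_const_smul_apply hs]
  have hr := rho_pos ξ
  rw [h]
  calc _ ≤ ‖c‖ * (n * rho ξ) ^ k + ‖c‖ * (n * rho ξ) ^ k := by
        refine norm_add_le_of_le ?_ ?_
        · rw [norm_smul]
          gcongr
          · exact Complex.abs_re_le_norm c
          · exact norm_iteratedFDeriv_cosFn_le k ξ x
        · rw [norm_smul, norm_neg]
          gcongr
          · exact Complex.abs_im_le_norm c
          · exact norm_iteratedFDeriv_sinFn_le k ξ x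
    _ = _ := by ring

theorem TestFn.hasSum_realMode (φ : TestFn n) (x : Fin n → ℝ) :
    HasSum (fun ξ => (realMode (φ.toDist.fourier ξ) ξ : (Fin n → ℝ) → ℝ) x)
      ((φ : (Fin n → ℝ) → ℝ) x) := by
  have h := Complex.hasSum_re (φ.hasSum_fourier x)
  simpa only [realMode_apply, Complex.ofReal_re] using h

/-- A torus distribution may be applied to a test function through the Fourier coefficients. -/
theorem TorusDist.hasSum_apply (g : TorusDist n) (φ : TestFn n) :
    HasSum (fun ξ => (g.fourier ξ * φ.toDist.fourier (-ξ)).re) (g.1 φ) := by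
  obtain ⟨N, C, hg⟩ := g.2
  set v : ℕ → (Fin n → ℤ) → ℝ := fun k ξ => 2 * ‖φ.toDist.fourier ξ‖ * (n * rho ξ) ^ k with hv
  have hvs : ∀ k, Summable (v k) := fun k => by
    refine ((summable_rho_pow_mul_fourier_toDist φ k).mul_left (2 * (n : ℝ) ^ k)).congr fun ξ => ?_
    simp only [hv, mul_pow]; ring
  have hv0 : ∀ k ξ, 0 ≤ v k ξ := fun k ξ => by have := rho_pos ξ; positivity
  have hterm : ∀ ξ, (g.fourier ξ * φ.toDist.fourier (-ξ)).re =
      g.1 (realMode (φ.toDist.fourier ξ) ξ) := fun ξ => by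
    rw [dist_realMode, fourier_neg]
  simp only [hterm]
  -- the error of a partial sum
  have herr : ∀ s : Finset (Fin n → ℤ), |g.1 φ - ∑ ξ ∈ s, g.1 (realMode (φ.toDist.fourier ξ) ξ)| ≤
      C * ∑ k ∈ Finset.range (N + 1), ∑' ξ : {ξ // ξ ∉ s}, v k ξ := by
    intro s
    set ψ : TestFn n := φ - ∑ ξ ∈ s, realMode (φ.toDist.fourier ξ) ξ with hψ
    have h1 : g.1 φ - ∑ ξ ∈ s, g.1 (realMode (φ.toDist.fourier ξ) ξ) = g.1 ψ := by
      rw [hψ, map_sub, map_sum]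
    rw [h1]
    refine hg ψ _ fun k hk x => ?_
    -- The remainder is the tail of the mode series. It may be differentiated term by term, so each
    -- of the finitely many seminorms that control `g` is bounded by the tail of a convergent
    -- series.
    have h2 : (ψ : (Fin n → ℝ) → ℝ) = fun x => ∑' ξ : {ξ // ξ ∉ s},
        (realMode (φ.toDist.fourier ξ) (ξ : Fin n → ℤ) : (Fin n → ℝ) → ℝ) x := by
      funext y
      have h3 := (φ.hasSum_realMode y).summable.sum_add_tsum_subtype_compl s
      rw [(φ.hasSum_realMode y).tsum_eq] at h3
      have h4 : (ψ : (Fin n → ℝ) → ℝ) y = (φ : (Fin n → ℝ) → ℝ) y -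
          ∑ ξ ∈ s, (realMode (φ.toDist.fourier ξ) ξ : (Fin n → ℝ) → ℝ) y := by
        rw [hψ]
        simp
      rw [h4, ← h3]
      ring
    rw [h2, iteratedFDeriv_tsum_apply (N := ⊤) (v := fun k (ξ : {ξ // ξ ∉ s}) => v k ξ)
      (fun ξ => (realMode (φ.toDist.fourier ξ) (ξ : Fin n → ℤ)).2.1)
      (fun k _ => (hvs k).subtype _)
      (fun k ξ x _ => norm_iteratedFDeriv_realMode_le _ _ k x) le_top]
    calc _ ≤ ∑' ξ : {ξ // ξ ∉ s}, v k ξ :=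
          tsum_of_norm_bounded ((hvs k).subtype _).hasSum
            fun ξ => norm_iteratedFDeriv_realMode_le _ _ k x
      _ ≤ _ := Finset.single_le_sum
          (f := fun k => ∑' ξ : {ξ // ξ ∉ s}, v k ξ) (fun k _ => tsum_nonneg fun ξ => hv0 k ξ)
          (Finset.mem_range.mpr (by omega))
  have hlim : Tendsto (fun s : Finset (Fin n → ℤ) =>
      C * ∑ k ∈ Finset.range (N + 1), ∑' ξ : {ξ // ξ ∉ s}, v k ξ) atTop (𝓝 0) := by
    have h := (tendsto_finsetSum (Finset.range (N + 1)) fun k _ =>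
      tendsto_tsum_compl_atTop_zero (v k)).const_mul C
    simpa using h
  rw [HasSum]
  refine tendsto_iff_norm_sub_tendsto_zero.mpr
    (squeeze_zero (fun _ => norm_nonneg _) (fun s => ?_) hlim)
  rw [norm_sub_rev]
  exact herr s

/-- The value on every test function is a series in the coefficients, so equality of distributions
can be checked one frequency at a time. -/
theorem fourier_injective {g h : TorusDist n} (hgh : ∀ ξ, g.fourier ξ = h.fourier ξ) : g = h := by
  refine Subtype.ext (LinearMap.ext fun φ => ?_)
  have h1 := g.hasSum_apply φ
  simp only [hgh] at h1
  exact h1.unique (h.hasSum_apply φ)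

/-- Polynomial growth. -/
def PolyGrowth (c : (Fin n → ℤ) → ℂ) : Prop := ∃ (N : ℕ) (C : ℝ), ∀ ξ, ‖c ξ‖ ≤ C * rho ξ ^ N

/-- The continuity bound of `g` is applied to the cosine and sine modes, whose `k`-th derivatives
are at most `(nϱ(ξ))^k`. -/
theorem polyGrowth_fourier (g : TorusDist n) : PolyGrowth g.fourier := by
  obtain ⟨N, C, hg⟩ := g.2
  refine ⟨N, 2 * (|C| * (n + 1) ^ N), fun ξ => ?_⟩
  have hr := one_le_rho ξ
  have hb : ∀ k ≤ N, ((n : ℝ) * rho ξ) ^ k ≤ ((n + 1) * rho ξ) ^ N := fun k hk => by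
    have h0 : (0 : ℝ) ≤ n := Nat.cast_nonneg n
    calc ((n : ℝ) * rho ξ) ^ k ≤ ((n + 1) * rho ξ) ^ k := by gcongr; linarith
      _ ≤ _ := pow_le_pow_right₀ (by nlinarith) hk
  have hc := hg (cosFn ξ) _ fun k hk x => (norm_iteratedFDeriv_cosFn_le k ξ x).trans (hb k hk)
  have hs := hg (sinFn ξ) _ fun k hk x => (norm_iteratedFDeriv_sinFn_le k ξ x).trans (hb k hk)
  have hC : C * ((n + 1) * rho ξ) ^ N ≤ |C| * ((n + 1) * rho ξ) ^ N := by
    gcongr; exact le_abs_self C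
  refine (Complex.norm_le_abs_re_add_abs_im _).trans ?_
  rw [fourier_re, fourier_im, abs_neg]
  rw [mul_pow] at *
  linarith

theorem summable_mul_fourier_toDist {c : (Fin n → ℤ) → ℂ} (hc : PolyGrowth c) (φ : TestFn n) :
    Summable fun ξ => c ξ * φ.toDist.fourier (-ξ) := by
  obtain ⟨N, C, hC⟩ := hc
  refine Summable.of_norm_bounded ((summable_rho_pow_mul_fourier_toDist φ N).mul_left C)
    fun ξ => ?_
  rw [norm_mul, norm_fourier_neg, ← mul_assoc]
  gcongr
  exact hC ξ

theorem dual_toDist (g : TorusDist n) (φ : TestFn n) : dual g φ.toDist = g.1 φ := by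
  rw [dual, Complex.re_tsum (summable_mul_fourier_toDist (polyGrowth_fourier g) φ)]
  exact (g.hasSum_apply φ).tsum_eq

theorem toDist_add (φ ψ : TestFn n) : (φ + ψ).toDist = φ.toDist + ψ.toDist := by
  refine Subtype.ext (LinearMap.ext fun χ => ?_)
  change _ = φ.toDist.1 χ + ψ.toDist.1 χ
  simp only [TestFn.toDist, ofFun_apply φ.integrableOn, ofFun_apply ψ.integrableOn]
  rw [ofFun_apply (φ + ψ).integrableOn]
  refine Eq.trans ?_ (integral_add (μ := cubeMeasure n) (TestFn.integrableOn_mul φ.integrableOn χ)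
    (TestFn.integrableOn_mul ψ.integrableOn χ))
  refine integral_congr_ae (Eventually.of_forall fun x => ?_)
  simp [add_mul]

theorem toDist_smul (c : ℝ) (φ : TestFn n) : (c • φ).toDist = c • φ.toDist := by
  refine Subtype.ext (LinearMap.ext fun χ => ?_)
  change _ = c * φ.toDist.1 χ
  simp only [TestFn.toDist, ofFun_apply φ.integrableOn]
  rw [ofFun_apply (c • φ).integrableOn, ← integral_const_mul]
  refine integral_congr_ae (Eventually.of_forall fun x => ?_)
  simp [mul_assoc]

theorem fourier_toDist_cosFn (η ξ : Fin n → ℤ) : (cosFn η).toDist.fourier ξ =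
    ((if ξ = η then 1 else 0) + if ξ = -η then 1 else 0) / 2 := by
  have h : ∀ x, (((cosFn η : (Fin n → ℝ) → ℝ) x : ℝ) : ℂ) = (expFn η x + expFn (-η) x) / 2 := by
    intro x
    rw [expFn_neg, expFn_eq]
    simp
    ring
  have hi : ∀ ζ : Fin n → ℤ, Integrable (fun x => expFn (-ξ) x * expFn ζ x) (cubeMeasure n) :=
    fun ζ => by
      simp only [← expFn_add]
      exact (integrable_const (1 : ℝ)).mono' (continuous_expFn _).aestronglyMeasurable
        (Eventually.of_forall fun x => (norm_expFn _ x).le)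
  rw [fourier_toDist, ← cubeCoeff_expFn, ← cubeCoeff_expFn, cubeCoeff, cubeCoeff, cubeCoeff,
    ← integral_add (hi _) (hi _), ← integral_div]
  refine integral_congr_ae (Eventually.of_forall fun x => ?_)
  simp only [h]
  ring

theorem fourier_toDist_sinFn (η ξ : Fin n → ℤ) : (sinFn η).toDist.fourier ξ =
    ((if ξ = η then 1 else 0) - if ξ = -η then 1 else 0) / (2 * Complex.I) := by
  have h : ∀ x, (((sinFn η : (Fin n → ℝ) → ℝ) x : ℝ) : ℂ) =
      (expFn η x - expFn (-η) x) / (2 * Complex.I) := by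
    intro x
    rw [expFn_neg, expFn_eq]
    have := Complex.I_ne_zero
    simp
    field_simp
    ring
  have hi : ∀ ζ : Fin n → ℤ, Integrable (fun x => expFn (-ξ) x * expFn ζ x) (cubeMeasure n) :=
    fun ζ => by
      simp only [← expFn_add]
      exact (integrable_const (1 : ℝ)).mono' (continuous_expFn _).aestronglyMeasurable
        (Eventually.of_forall fun x => (norm_expFn _ x).le)
  rw [fourier_toDist, ← cubeCoeff_expFn, ← cubeCoeff_expFn, cubeCoeff, cubeCoeff, cubeCoeff,
    ← integral_sub (hi _) (hi _), ← integral_div]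
  refine integral_congr_ae (Eventually.of_forall fun x => ?_)
  simp only [h]
  ring

/-- Every hermitian family of polynomial growth is the family of Fourier coefficients of a torus
distribution. -/
theorem exists_fourier_eq {c : (Fin n → ℤ) → ℂ} (hc : PolyGrowth c)
    (hsymm : ∀ ξ, c (-ξ) = conj (c ξ)) : ∃ g : TorusDist n, ∀ ξ, g.fourier ξ = c ξ := by
  have hs := fun φ : TestFn n => summable_mul_fourier_toDist hc φ
  let L : TestFn n →ₗ[ℝ] ℝ :=
    { toFun := fun φ => (∑' ξ, c ξ * φ.toDist.fourier (-ξ)).re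
      map_add' := fun φ ψ => by
        rw [← Complex.add_re, ← (hs φ).tsum_add (hs ψ)]
        simp only [toDist_add, fourier_add, mul_add]
      map_smul' := fun a φ => by
        have : ∀ ξ, c ξ * (a • φ).toDist.fourier (-ξ) = a * (c ξ * φ.toDist.fourier (-ξ)) := by
          intro ξ; rw [toDist_smul, fourier_smul]; ring
        simp only [this, tsum_mul_left, Complex.re_ofReal_mul, RingHom.id_apply, smul_eq_mul] }
  obtain ⟨N, C, hC⟩ := hc
  have hL : L ∈ torusDistSpace n := by
    -- The order of the seminorm: `2N` powers of decay more than compensate the growth of `c`, and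
    -- `2n` make the remaining series converge.
    refine ⟨2 * (N + n), ∑' ξ : Fin n → ℤ, |C| * (((2 * Real.pi) ^ 2 * (n + 1)) ^ (N + n)) *
      rho ξ ^ (-(2 * n : ℝ)), fun φ B hB => ?_⟩
    refine (Complex.abs_re_le_norm _).trans ?_
    rw [← tsum_mul_right]
    refine tsum_of_norm_bounded ((summable_rho_rpow_neg.mul_left _).mul_right B).hasSum fun ξ => ?_
    have h := rho_pow_mul_norm_fourier_toDist_le (N + n) hB ξ
    have hr := rho_pos ξ
    have h1 := one_le_rho ξ
    rw [norm_mul, norm_fourier_neg, Real.rpow_neg hr.le,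
      show (2 * n : ℝ) = ((2 * n : ℕ) : ℝ) by push_cast; ring, Real.rpow_natCast]
    have h2 : rho ξ ^ N * ‖φ.toDist.fourier ξ‖ ≤
        (((2 * Real.pi) ^ 2 * (n + 1)) ^ (N + n) * B) * (rho ξ ^ (2 * n))⁻¹ := by
      rw [← div_eq_mul_inv, le_div_iff₀ (by positivity)]
      calc _ = rho ξ ^ (N + 2 * n) * ‖φ.toDist.fourier ξ‖ := by ring
        _ ≤ rho ξ ^ (2 * (N + n)) * ‖φ.toDist.fourier ξ‖ := by gcongr; omega
        _ ≤ _ := h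
    calc ‖c ξ‖ * ‖φ.toDist.fourier ξ‖ ≤ (|C| * rho ξ ^ N) * ‖φ.toDist.fourier ξ‖ := by
          gcongr
          exact (hC ξ).trans (by gcongr; exact le_abs_self C)
      _ = |C| * (rho ξ ^ N * ‖φ.toDist.fourier ξ‖) := by ring
      _ ≤ |C| * ((((2 * Real.pi) ^ 2 * (n + 1)) ^ (N + n) * B) * (rho ξ ^ (2 * n))⁻¹) := by gcongr
      _ = _ := by ring
  refine ⟨⟨L, hL⟩, fun η => ?_⟩
  have hd : ∀ ζ : Fin n → ℤ, HasSum (fun ξ => c ξ * if ξ = ζ then (1 : ℂ) else 0) (c ζ) := by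
    intro ζ
    have h := hasSum_ite_eq ζ (c ζ)
    convert h using 2 with ξ
    by_cases h : ξ = ζ <;> simp [h]
  have e1 : L (cosFn η) = (c η).re := by
    have h := ((hd (-η)).add (hd η)).div_const 2
    have h2 : ∑' ξ, c ξ * (cosFn η).toDist.fourier (-ξ) = (c (-η) + c η) / 2 := by
      rw [← h.tsum_eq]
      congr 1; ext ξ
      rw [fourier_toDist_cosFn]
      simp only [neg_eq_iff_eq_neg, neg_neg]
      ring
    change (∑' ξ, c ξ * (cosFn η).toDist.fourier (-ξ)).re = _
    rw [h2, hsymm]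
    simp
  have e2 : L (sinFn η) = -(c η).im := by
    have h := ((hd (-η)).sub (hd η)).div_const (2 * Complex.I)
    have h2 : ∑' ξ, c ξ * (sinFn η).toDist.fourier (-ξ) = (c (-η) - c η) / (2 * Complex.I) := by
      rw [← h.tsum_eq]
      congr 1; ext ξ
      rw [fourier_toDist_sinFn]
      simp only [neg_eq_iff_eq_neg, neg_neg]
      ring
    change (∑' ξ, c ξ * (sinFn η).toDist.fourier (-ξ)).re = _
    have h3 : (c (-η) - c η) / (2 * Complex.I) = ((-(c η).im : ℝ) : ℂ) := by
      rw [hsymm, div_eq_iff (by simp)]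
      apply Complex.ext <;> simp
      ring
    rw [h2, h3, Complex.ofReal_re]
  apply Complex.ext
  · rw [fourier_re]; exact e1
  · rw [fourier_im]; simp [e2]

/-- Growth and hermitian symmetry together exclude the default value `0` in the definition of
`ofFourier`; both have to be supplied for every multiplier used below. -/
theorem fourier_ofFourier {c : (Fin n → ℤ) → ℂ} (hc : PolyGrowth c)
    (hsymm : ∀ ξ, c (-ξ) = conj (c ξ)) (ξ : Fin n → ℤ) :
    (TorusDist.ofFourier c).fourier ξ = c ξ := by
  have h := exists_fourier_eq hc hsymm
  rw [TorusDist.ofFourier, dif_pos h]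
  exact h.choose_spec ξ

theorem PolyGrowth.mul {c m : (Fin n → ℤ) → ℂ} (hc : PolyGrowth c) (hm : PolyGrowth m) :
    PolyGrowth fun ξ => m ξ * c ξ := by
  obtain ⟨N, C, h⟩ := hc
  obtain ⟨M, D, h'⟩ := hm
  refine ⟨M + N, D * C, fun ξ => ?_⟩
  have h1 := (norm_nonneg _).trans (h' ξ)
  calc ‖m ξ * c ξ‖ = ‖m ξ‖ * ‖c ξ‖ := norm_mul _ _
    _ ≤ (D * rho ξ ^ M) * (C * rho ξ ^ N) :=
        mul_le_mul (h' ξ) (h ξ) (norm_nonneg _) h1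
    _ = _ := by ring

theorem PolyGrowth.add {c m : (Fin n → ℤ) → ℂ} (hc : PolyGrowth c) (hm : PolyGrowth m) :
    PolyGrowth fun ξ => c ξ + m ξ := by
  obtain ⟨N, C, h⟩ := hc
  obtain ⟨M, D, h'⟩ := hm
  refine ⟨N + M, |C| + |D|, fun ξ => (norm_add_le _ _).trans ?_⟩
  have hr := one_le_rho ξ
  have h1 : rho ξ ^ N ≤ rho ξ ^ (N + M) := pow_le_pow_right₀ hr (by omega)
  have h2 : rho ξ ^ M ≤ rho ξ ^ (N + M) := pow_le_pow_right₀ hr (by omega)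
  calc _ ≤ C * rho ξ ^ N + D * rho ξ ^ M := add_le_add (h ξ) (h' ξ)
    _ ≤ |C| * rho ξ ^ N + |D| * rho ξ ^ M := by
        gcongr
        · exact le_abs_self C
        · exact le_abs_self D
    _ ≤ |C| * rho ξ ^ (N + M) + |D| * rho ξ ^ (N + M) := by gcongr
    _ = _ := by ring

theorem PolyGrowth.sum {ι : Type*} (s : Finset ι) {c : ι → (Fin n → ℤ) → ℂ}
    (h : ∀ i, PolyGrowth (c i)) : PolyGrowth fun ξ => ∑ i ∈ s, c i ξ := by
  classical
  induction s using Finset.induction_on with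
  | empty => exact ⟨0, 0, fun ξ => by simp⟩
  | insert i s hi ih =>
    simp only [Finset.sum_insert hi]
    exact (h i).add ih

theorem PolyGrowth.mono {c m : (Fin n → ℤ) → ℂ} (hc : PolyGrowth c) (h : ∀ ξ, ‖m ξ‖ ≤ ‖c ξ‖) :
    PolyGrowth m := by
  obtain ⟨N, C, hC⟩ := hc
  exact ⟨N, C, fun ξ => (h ξ).trans (hC ξ)⟩

theorem polyGrowth_rpow (r : ℝ) : PolyGrowth fun ξ : Fin n → ℤ => ((rho ξ ^ r : ℝ) : ℂ) := by
  refine ⟨⌈r⌉₊, 1, fun ξ => ?_⟩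
  have hr := rho_pos ξ
  rw [Complex.norm_real, Real.norm_of_nonneg (by positivity), one_mul, ← Real.rpow_natCast]
  exact Real.rpow_le_rpow_of_exponent_le (one_le_rho ξ) (Nat.le_ceil r)

/-! ### Bessel potentials and the Leray projector as Fourier multipliers -/

theorem fourier_bessel (r : ℝ) (G : VecDist n) (k : Fin n) (ξ : Fin n → ℤ) :
    (bessel r G k).fourier ξ = ((rho ξ ^ r : ℝ) : ℂ) * (G k).fourier ξ :=
  fourier_ofFourier ((polyGrowth_fourier _).mul (polyGrowth_rpow r))
    (fun ξ => by simp [rho_neg, fourier_neg]) ξ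

/-- The Leray projector on the side of Fourier coefficients. -/
def lerayCoeff (ξ : Fin n → ℤ) (c : Fin n → ℂ) (k : Fin n) : ℂ :=
  if ξ = 0 then 0 else c k - (ξ k : ℂ) * (∑ j, (ξ j : ℂ) * c j) / ((freqSq ξ : ℝ) : ℂ)

theorem one_le_freqSq {ξ : Fin n → ℤ} (h : ξ ≠ 0) : 1 ≤ freqSq ξ := by
  have h1 := freqSq_pos h
  have h2 : freqSq ξ = ((∑ i, ξ i ^ 2 : ℤ) : ℝ) := by simp [freqSq]
  rw [h2] at h1 ⊢
  have h3 : 0 < ∑ i, ξ i ^ 2 := by exact_mod_cast h1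
  exact_mod_cast h3

theorem abs_coord_mul_le_freqSq (ξ : Fin n → ℤ) (j k : Fin n) :
    |(ξ j : ℝ)| * |(ξ k : ℝ)| ≤ freqSq ξ := by
  have hj : (ξ j : ℝ) ^ 2 ≤ freqSq ξ :=
    Finset.single_le_sum (f := fun j => (ξ j : ℝ) ^ 2) (fun _ _ => sq_nonneg _) (Finset.mem_univ j)
  have hk : (ξ k : ℝ) ^ 2 ≤ freqSq ξ :=
    Finset.single_le_sum (f := fun j => (ξ j : ℝ) ^ 2) (fun _ _ => sq_nonneg _) (Finset.mem_univ k)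
  have := two_mul_le_add_sq |(ξ j : ℝ)| |(ξ k : ℝ)|
  rw [sq_abs, sq_abs] at this
  linarith

theorem norm_lerayCoeff_le (ξ : Fin n → ℤ) (c : Fin n → ℂ) (k : Fin n) :
    ‖lerayCoeff ξ c k‖ ≤ 2 * ∑ j, ‖c j‖ := by
  have h0 : 0 ≤ ∑ j, ‖c j‖ := Finset.sum_nonneg fun _ _ => norm_nonneg _
  rw [lerayCoeff]
  split_ifs with h
  · simpa using h0
  · have hq := freqSq_pos h
    have h1 : ‖c k‖ ≤ ∑ j, ‖c j‖ :=
      Finset.single_le_sum (f := fun j => ‖c j‖) (fun _ _ => norm_nonneg _) (Finset.mem_univ k)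
    have h2 : ‖(ξ k : ℂ) * (∑ j, (ξ j : ℂ) * c j) / ((freqSq ξ : ℝ) : ℂ)‖ ≤ ∑ j, ‖c j‖ := by
      rw [norm_div, Complex.norm_real, Real.norm_of_nonneg hq.le, div_le_iff₀ hq, Finset.mul_sum,
        Finset.sum_mul]
      refine norm_sum_le_of_le _ fun j _ => ?_
      rw [norm_mul, norm_mul, ← Complex.ofReal_intCast, ← Complex.ofReal_intCast, Complex.norm_real,
        Complex.norm_real, Real.norm_eq_abs, Real.norm_eq_abs]
      have h3 := abs_coord_mul_le_freqSq ξ j k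
      calc _ = (|(ξ j : ℝ)| * |(ξ k : ℝ)|) * ‖c j‖ := by ring
        _ ≤ freqSq ξ * ‖c j‖ := by gcongr
        _ = _ := mul_comm _ _
    calc _ ≤ ‖c k‖ + _ := norm_sub_le _ _
      _ ≤ _ := by linarith

theorem sum_coord_mul_lerayCoeff (ξ : Fin n → ℤ) (c : Fin n → ℂ) :
    ∑ k, (ξ k : ℂ) * lerayCoeff ξ c k = 0 := by
  by_cases h : ξ = 0
  · simp [h]
  · have hq : ((freqSq ξ : ℝ) : ℂ) ≠ 0 := by exact_mod_cast (freqSq_pos h).ne'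
    simp only [lerayCoeff, if_neg h, mul_sub, Finset.sum_sub_distrib]
    rw [sub_eq_zero]
    have e : ∀ k, (ξ k : ℂ) * ((ξ k : ℂ) * (∑ j, (ξ j : ℂ) * c j) / ((freqSq ξ : ℝ) : ℂ)) =
        (ξ k : ℂ) ^ 2 * ((∑ j, (ξ j : ℂ) * c j) / ((freqSq ξ : ℝ) : ℂ)) := fun k => by ring
    simp only [e]
    rw [← Finset.sum_mul]
    have h2 : ∑ k, (ξ k : ℂ) ^ 2 = ((freqSq ξ : ℝ) : ℂ) := by simp [freqSq]
    rw [h2, mul_div_cancel₀ _ hq]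

theorem fourier_leray (F : VecDist n) (k : Fin n) (ξ : Fin n → ℤ) :
    (leray F k).fourier ξ = lerayCoeff ξ (fun j => (F j).fourier ξ) k := by
  refine fourier_ofFourier (c := fun ξ => lerayCoeff ξ (fun j => (F j).fourier ξ) k) ?_ ?_ ξ
  · have h : PolyGrowth fun ξ => ∑ j, (((2 * ‖(F j).fourier ξ‖ : ℝ)) : ℂ) :=
      PolyGrowth.sum _ fun j => by
        obtain ⟨N, C, hC⟩ := polyGrowth_fourier (F j)
        refine ⟨N, 2 * C, fun ξ => ?_⟩
        rw [Complex.norm_real, norm_mul, norm_norm, Real.norm_two]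
        linarith [hC ξ]
    refine h.mono fun ξ => (norm_lerayCoeff_le _ _ _).trans ?_
    rw [← Complex.ofReal_sum, Complex.norm_real, ← Finset.mul_sum]
    exact le_abs_self _
  · intro ξ
    simp only [lerayCoeff, neg_eq_zero]
    split_ifs
    · simp
    · simp [fourier_neg, freqSq_neg]

/-! ## Square integrable functions on the cell -/

theorem ae_eq_of_ofFun_eq {f g : (Fin n → ℝ) → ℝ} (hf : IntegrableOn f (cube n))
    (hg : IntegrableOn g (cube n)) (h : TorusDist.ofFun f = TorusDist.ofFun g) :
    f =ᵐ[cubeMeasure n] g := by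
  have hf' : Integrable f (cubeMeasure n) := hf
  have hg' : Integrable g (cubeMeasure n) := hg
  have h0 := ae_eq_zero_of_cubeCoeff_eq_zero (f := fun x => ((f x - g x : ℝ) : ℂ))
    ((hf'.sub hg').ofReal) fun ξ => by
      have h1 := fourier_ofFun hf ξ
      have h2 := fourier_ofFun hg ξ
      rw [h, h2, cubeCoeff, cubeCoeff] at h1
      have hi : ∀ {u : (Fin n → ℝ) → ℝ}, Integrable u (cubeMeasure n) →
          Integrable (fun x => expFn (-ξ) x * (u x : ℂ)) (cubeMeasure n) := fun hu =>
        hu.ofReal.bdd_mul (continuous_expFn _).aestronglyMeasurable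
          (Eventually.of_forall fun x => (norm_expFn _ x).le)
      rw [cubeCoeff]
      simp only [Complex.ofReal_sub, mul_sub]
      rw [integral_sub (hi hf') (hi hg'), h1, sub_self]
  filter_upwards [h0] with x hx
  have : f x - g x = 0 := Complex.ofReal_eq_zero.mp hx
  linarith

theorem toFun_spec {g : TorusDist n}
    (h : ∃ f : (Fin n → ℝ) → ℝ, IntegrableOn f (cube n) ∧ TorusDist.ofFun f = g) :
    IntegrableOn g.toFun (cube n) ∧ TorusDist.ofFun g.toFun = g := by
  rw [TorusDist.toFun, dif_pos h]
  exact h.choose_spec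

theorem toFun_ofFun {f : (Fin n → ℝ) → ℝ} (hf : IntegrableOn f (cube n)) :
    (TorusDist.ofFun f).toFun =ᵐ[cubeMeasure n] f := by
  have h := toFun_spec ⟨f, hf, rfl⟩
  exact ae_eq_of_ofFun_eq h.1 hf h.2

theorem MemLp.integrableOn_cube {f : (Fin n → ℝ) → ℝ} (hf : MemLp f 2 (cubeMeasure n)) :
    IntegrableOn f (cube n) :=
  hf.integrable one_le_two

theorem cubeCoeff_conj (f : (Fin n → ℝ) → ℂ) (ξ : Fin n → ℤ) :
    cubeCoeff (fun x => conj (f x)) ξ = conj (cubeCoeff f (-ξ)) := by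
  rw [cubeCoeff, cubeCoeff, ← integral_conj]
  simp only [map_mul, expFn_neg, neg_neg]

/-- Riesz-Fischer provides a complex function with the given coefficients. Passing to its real part
replaces `ĝ(ξ)` by the mean of `ĝ(ξ)` and the conjugate of `ĝ(-ξ)`, which is unchanged by hermitian
symmetry. -/
theorem exists_memLp_ofFun_eq {g : TorusDist n} (hg : MemH 0 g) :
    ∃ f : (Fin n → ℝ) → ℝ, MemLp f 2 (cubeMeasure n) ∧ TorusDist.ofFun f = g := by
  have hs : Summable fun ξ => ‖g.fourier ξ‖ ^ 2 := by simpa [MemH] using hg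
  obtain ⟨F, hF, hFc⟩ := exists_memLp_cubeCoeff hs
  have hre : MemLp (fun x => (F x).re) 2 (cubeMeasure n) := hF.re
  refine ⟨_, hre, fourier_injective fun ξ => ?_⟩
  rw [fourier_ofFun (MemLp.integrableOn_cube hre)]
  have hi : Integrable (fun x => expFn (-ξ) x * F x) (cubeMeasure n) :=
    (hF.integrable one_le_two).bdd_mul (continuous_expFn _).aestronglyMeasurable
      (Eventually.of_forall fun x => (norm_expFn _ x).le)
  have hi' : Integrable (fun x => expFn (-ξ) x * conj (F x)) (cubeMeasure n) :=
    ((hF.integrable one_le_two).mono (Complex.continuous_conj.comp_aestronglyMeasurable hF.1)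
      (Eventually.of_forall fun x => by simp)).bdd_mul (continuous_expFn _).aestronglyMeasurable
      (Eventually.of_forall fun x => (norm_expFn _ x).le)
  have e : cubeCoeff (fun x => ((F x).re : ℂ)) ξ =
      (cubeCoeff F ξ + cubeCoeff (fun x => conj (F x)) ξ) / 2 := by
    rw [cubeCoeff, cubeCoeff, cubeCoeff, ← integral_add hi hi', ← integral_div]
    refine integral_congr_ae (Eventually.of_forall fun x => ?_)
    simp only [Complex.re_eq_add_conj]
    ring
  rw [e, cubeCoeff_conj, hFc, hFc, fourier_neg, Complex.conj_conj]
  ring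

theorem ofFun_toFun {g : TorusDist n} (hg : MemH 0 g) : TorusDist.ofFun g.toFun = g := by
  obtain ⟨f, hf, hfg⟩ := exists_memLp_ofFun_eq hg
  exact (toFun_spec ⟨f, MemLp.integrableOn_cube hf, hfg⟩).2

theorem memLp_toFun {g : TorusDist n} (hg : MemH 0 g) : MemLp g.toFun 2 (cubeMeasure n) := by
  obtain ⟨f, hf, hfg⟩ := exists_memLp_ofFun_eq hg
  have h := toFun_spec ⟨f, MemLp.integrableOn_cube hf, hfg⟩
  exact hf.ae_eq (ae_eq_of_ofFun_eq (MemLp.integrableOn_cube hf) h.1 (hfg.trans h.2.symm))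

theorem ofFun_sum {ι : Type*} (s : Finset ι) {f : ι → (Fin n → ℝ) → ℝ}
    (hf : ∀ i, IntegrableOn (f i) (cube n)) :
    TorusDist.ofFun (fun x => ∑ i ∈ s, f i x) = ∑ i ∈ s, TorusDist.ofFun (f i) := by
  refine Subtype.ext (LinearMap.ext fun φ => ?_)
  rw [ofFun_apply (integrable_finsetSum s fun i _ => hf i)]
  simp only [Finset.sum_mul]
  rw [integral_finsetSum (μ := cubeMeasure n) s fun i _ => TestFn.integrableOn_mul (hf i) φ]
  simp [ofFun_apply (hf _)]

theorem memLp_ofReal {f : (Fin n → ℝ) → ℝ} (hf : MemLp f 2 (cubeMeasure n)) :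
    MemLp (fun x => (f x : ℂ)) 2 (cubeMeasure n) := hf.ofReal

/-- The Fourier coefficients of a product of square integrable functions. -/
theorem hasSum_fourier_mul {f g : (Fin n → ℝ) → ℝ} (hf : MemLp f 2 (cubeMeasure n))
    (hg : MemLp g 2 (cubeMeasure n)) (ξ : Fin n → ℤ) :
    HasSum (fun η => (TorusDist.ofFun f).fourier (ξ - η) * (TorusDist.ofFun g).fourier η)
      ((TorusDist.ofFun fun x => f x * g x).fourier ξ) := by
  have hfg : IntegrableOn (fun x => f x * g x) (cube n) := hf.integrable_mul hg
  -- The convolution formula is Parseval's identity for `e^{2πi x·ξ} f` and `g`: the modulation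
  -- shifts the coefficients of `f`.
  have hF : MemLp (fun x => expFn ξ x * (f x : ℂ)) 2 (cubeMeasure n) := by
    refine MemLp.of_le (memLp_ofReal hf)
      ((continuous_expFn _).aestronglyMeasurable.mul (memLp_ofReal hf).1)
      (Eventually.of_forall fun x => ?_)
    rw [norm_mul, norm_expFn, one_mul]
  have h := hasSum_conj_cubeCoeff_mul hF (memLp_ofReal hg)
  rw [fourier_ofFun hfg]
  have e1 : ∫ x, conj (expFn ξ x * (f x : ℂ)) * (g x : ℂ) ∂cubeMeasure n =
      cubeCoeff (fun x => ((f x * g x : ℝ) : ℂ)) ξ := by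
    refine integral_congr_ae (Eventually.of_forall fun x => ?_)
    simp only [map_mul, expFn_neg, Complex.conj_ofReal, Complex.ofReal_mul]
    ring
  rw [e1] at h
  convert h using 2 with η
  rw [fourier_ofFun (MemLp.integrableOn_cube hg), ← neg_sub, fourier_neg,
    fourier_ofFun (MemLp.integrableOn_cube hf)]
  congr 2
  refine integral_congr_ae (Eventually.of_forall fun x => ?_)
  simp only
  rw [← mul_assoc, ← expFn_add]
  congr 2
  abel

/-! ## Sobolev norms as extended nonnegative numbers -/

/-- The square of the `H^s` norm of a family of Fourier coefficients. -/
def hE (s : ℝ) (c : (Fin n → ℤ) → ℂ) : ℝ≥0∞ := ∑' ξ, wt (2 * s) ξ * ‖c ξ‖ₑ ^ 2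

theorem wt_mul_enorm_sq (r : ℝ) (ξ : Fin n → ℤ) (z : ℂ) :
    wt r ξ * ‖z‖ₑ ^ 2 = ENNReal.ofReal (rho ξ ^ r * ‖z‖ ^ 2) := by
  have := rho_pos ξ
  rw [wt, ENNReal.ofReal_mul (by positivity), ENNReal.ofReal_pow (norm_nonneg _), ofReal_norm]

theorem hE_ne_top_iff (s : ℝ) (c : (Fin n → ℤ) → ℂ) :
    hE s c ≠ ⊤ ↔ Summable fun ξ => rho ξ ^ (2 * s) * ‖c ξ‖ ^ 2 := by
  simp only [hE, wt_mul_enorm_sq]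
  constructor
  · intro h
    refine (ENNReal.summable_toReal h).congr fun ξ => ?_
    have := rho_pos ξ
    rw [ENNReal.toReal_ofReal (by positivity)]
  · intro h
    exact h.tsum_ofReal_ne_top

theorem memH_iff (s : ℝ) (g : TorusDist n) : MemH s g ↔ hE s g.fourier ≠ ⊤ :=
  (hE_ne_top_iff s _).symm

theorem hE_mono_exp {s r : ℝ} (h : s ≤ r) (c : (Fin n → ℤ) → ℂ) : hE s c ≤ hE r c :=
  ENNReal.tsum_le_tsum fun ξ => by gcongr; exact wt_mono (by linarith) ξ

/-- The mapping property of a multiplier of order `r`. It serves for derivatives (`r = 1`), the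
Leray projector (`r = 0`), the potential of a field (`r = -1`) and Bessel potentials. -/
theorem hE_le_of_norm_le {s r : ℝ} {c d : (Fin n → ℤ) → ℂ} {K : ℝ}
    (h : ∀ ξ, ‖c ξ‖ ≤ K * rho ξ ^ r * ‖d ξ‖) :
    hE s c ≤ ENNReal.ofReal (K ^ 2) * hE (s + r) d := by
  rw [hE, hE, ← ENNReal.tsum_mul_left]
  refine ENNReal.tsum_le_tsum fun ξ => ?_
  have hr := rho_pos ξ
  rw [wt_mul_enorm_sq, wt_mul_enorm_sq, ← ENNReal.ofReal_mul (sq_nonneg K)]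
  refine ENNReal.ofReal_le_ofReal ?_
  calc rho ξ ^ (2 * s) * ‖c ξ‖ ^ 2 ≤ rho ξ ^ (2 * s) * (K * rho ξ ^ r * ‖d ξ‖) ^ 2 := by
        have := h ξ
        gcongr
    _ = K ^ 2 * ((rho ξ ^ (2 * s) * (rho ξ ^ r * rho ξ ^ r)) * ‖d ξ‖ ^ 2) := by ring
    _ = _ := by
        rw [← Real.rpow_add hr, ← Real.rpow_add hr, show 2 * s + (r + r) = 2 * (s + r) by ring]

theorem hE_sum_le {ι : Type*} (t : Finset ι) (s : ℝ) (c : ι → (Fin n → ℤ) → ℂ) :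
    hE s (fun ξ => ∑ i ∈ t, c i ξ) ≤ (t.card : ℝ≥0∞) * ∑ i ∈ t, hE s (c i) := by
  simp only [hE]
  rw [← Summable.tsum_finsetSum fun _ _ => ENNReal.summable, ← ENNReal.tsum_mul_left]
  refine ENNReal.tsum_le_tsum fun ξ => ?_
  simp only [wt_mul_enorm_sq]
  have hr := rho_pos ξ
  rw [← ENNReal.ofReal_sum_of_nonneg fun _ _ => by positivity, ← ENNReal.ofReal_natCast,
    ← ENNReal.ofReal_mul (Nat.cast_nonneg _)]
  refine ENNReal.ofReal_le_ofReal ?_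
  rw [← Finset.mul_sum]
  have h1 : ‖∑ i ∈ t, c i ξ‖ ^ 2 ≤ t.card * ∑ i ∈ t, ‖c i ξ‖ ^ 2 :=
    (pow_le_pow_left₀ (norm_nonneg _) (norm_sum_le _ _) 2).trans (sq_sum_le_card_mul_sum_sq)
  calc _ ≤ rho ξ ^ (2 * s) * (t.card * ∑ i ∈ t, ‖c i ξ‖ ^ 2) := by gcongr
    _ = _ := by ring

theorem hE_add_le (s : ℝ) (c d : (Fin n → ℤ) → ℂ) :
    hE s (fun ξ => c ξ + d ξ) ≤ 2 * (hE s c + hE s d) := by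
  have h := hE_sum_le Finset.univ s (fun b : Bool => if b then c else d)
  simpa using h

theorem hE_sub_le (s : ℝ) (c d : (Fin n → ℤ) → ℂ) :
    hE s (fun ξ => c ξ - d ξ) ≤ 2 * (hE s c + hE s d) := by
  have h := hE_add_le s c (fun ξ => -d ξ)
  simpa [hE, sub_eq_add_neg] using h

theorem hE_lerayCoeff_le (s : ℝ) (c : Fin n → (Fin n → ℤ) → ℂ) (k : Fin n) :
    hE s (fun ξ => lerayCoeff ξ (fun j => c j ξ) k) ≤ 4 * (n * ∑ j, hE s (c j)) := by
  have h1 : hE s (fun ξ => lerayCoeff ξ (fun j => c j ξ) k) ≤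
      ENNReal.ofReal (2 ^ 2) * hE (s + 0) (fun ξ => ((∑ j, ‖c j ξ‖ : ℝ) : ℂ)) := by
    refine hE_le_of_norm_le fun ξ => ?_
    rw [Complex.norm_real, Real.norm_of_nonneg (Finset.sum_nonneg fun _ _ => norm_nonneg _),
      Real.rpow_zero, mul_one]
    exact norm_lerayCoeff_le _ _ _
  have h2 := hE_sum_le Finset.univ s (fun j ξ => ((‖c j ξ‖ : ℝ) : ℂ))
  have h3 : ∀ j, hE s (fun ξ => ((‖c j ξ‖ : ℝ) : ℂ)) = hE s (c j) := fun j => by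
    simp only [hE, wt_mul_enorm_sq, Complex.norm_real, norm_norm]
  simp only [h3, Finset.card_univ, Fintype.card_fin] at h2
  simp only [Complex.ofReal_sum, add_zero] at h1
  refine h1.trans ?_
  rw [show ENNReal.ofReal (2 ^ 2) = 4 by norm_num]
  gcongr

/-- Parseval's identity. -/
theorem hE_zero_ofFun {f : (Fin n → ℝ) → ℝ} (hf : MemLp f 2 (cubeMeasure n)) :
    hE 0 (TorusDist.ofFun f).fourier = ENNReal.ofReal (∫ x, f x ^ 2 ∂cubeMeasure n) := by
  have h := Complex.hasSum_re (hasSum_conj_cubeCoeff_mul (memLp_ofReal hf) (memLp_ofReal hf))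
  have e1 : (∫ x, conj (f x : ℂ) * (f x : ℂ) ∂cubeMeasure n).re = ∫ x, f x ^ 2 ∂cubeMeasure n := by
    have : ∀ x, conj (f x : ℂ) * (f x : ℂ) = ((f x ^ 2 : ℝ) : ℂ) := fun x => by
      rw [Complex.conj_ofReal]; push_cast; ring
    simp only [this]
    rw [integral_complex_ofReal, Complex.ofReal_re]
  have e2 : ∀ ξ, (conj (cubeCoeff (fun x => (f x : ℂ)) ξ) * cubeCoeff (fun x => (f x : ℂ)) ξ).re =
      ‖(TorusDist.ofFun f).fourier ξ‖ ^ 2 := fun ξ => by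
    rw [← fourier_ofFun (MemLp.integrableOn_cube hf), mul_comm, Complex.mul_conj,
      Complex.ofReal_re, Complex.normSq_eq_norm_sq]
  rw [e1] at h
  simp only [e2] at h
  rw [← h.tsum_eq, ENNReal.ofReal_tsum_of_nonneg (fun _ => by positivity) h.summable, hE]
  refine tsum_congr fun ξ => ?_
  rw [wt_mul_enorm_sq]
  simp

theorem memH_mono {s r : ℝ} (h : s ≤ r) {g : TorusDist n} (hg : MemH r g) : MemH s g := by
  rw [memH_iff] at *
  exact ne_top_of_le_ne_top hg (hE_mono_exp h _)

theorem norm_fourier_partialDeriv_le (j : Fin n) (g : TorusDist n) (ξ : Fin n → ℤ) :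
    ‖(g.partialDeriv j).fourier ξ‖ ≤ 1 * rho ξ ^ (1 : ℝ) * ‖g.fourier ξ‖ := by
  rw [fourier_partialDeriv, norm_mul, Real.rpow_one, one_mul]
  gcongr
  have h := two_pi_abs_le_rho ξ j
  have hpi := Real.pi_pos
  rw [← Complex.ofReal_intCast, norm_mul, norm_mul, norm_mul, Complex.norm_I, mul_one,
    Complex.norm_real, Complex.norm_real, Real.norm_of_nonneg hpi.le]
  simpa using h

theorem hE_partialDeriv_le (s : ℝ) (j : Fin n) (g : TorusDist n) :
    hE s (g.partialDeriv j).fourier ≤ hE (s + 1) g.fourier := by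
  have h := hE_le_of_norm_le (s := s) (norm_fourier_partialDeriv_le j g)
  simpa using h

theorem memH_partialDeriv {s : ℝ} (j : Fin n) {g : TorusDist n} (hg : MemH (s + 1) g) :
    MemH s (g.partialDeriv j) := by
  rw [memH_iff] at *
  exact ne_top_of_le_ne_top hg (hE_partialDeriv_le s j g)

theorem memH_toDist (s : ℝ) (φ : TestFn n) : MemH s φ.toDist := by
  obtain ⟨B, hB⟩ := φ.exists_iteratedFDeriv_bound 0
  have h0 : ∀ ξ, ‖φ.toDist.fourier ξ‖ ≤ B := fun ξ => norm_fourier_toDist_le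
    (fun x => by simpa [norm_iteratedFDeriv_zero] using hB 0 le_rfl x) ξ
  refine Summable.of_nonneg_of_le (fun ξ => by have := rho_pos ξ; positivity) (fun ξ => ?_)
    ((summable_rho_pow_mul_fourier_toDist φ ⌈2 * s⌉₊).mul_left B)
  have hr := rho_pos ξ
  have h1 : rho ξ ^ (2 * s) ≤ rho ξ ^ ⌈2 * s⌉₊ := by
    rw [← Real.rpow_natCast]
    exact Real.rpow_le_rpow_of_exponent_le (one_le_rho ξ) (Nat.le_ceil _)
  have h2 := h0 ξ
  calc rho ξ ^ (2 * s) * ‖φ.toDist.fourier ξ‖ ^ 2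
      = rho ξ ^ (2 * s) * (‖φ.toDist.fourier ξ‖ * ‖φ.toDist.fourier ξ‖) := by ring
    _ ≤ rho ξ ^ ⌈2 * s⌉₊ * (B * ‖φ.toDist.fourier ξ‖) := by gcongr
    _ = _ := by ring

/-! ## Distributional derivatives on an interval -/

theorem ae_timeMeasure_iff {T : ℝ} {p : ℝ → Prop} :
    (∀ᵐ t ∂timeMeasure T, p t) ↔ ∀ᵐ t : ℝ, t ∈ Set.Ioo 0 T → p t :=
  ae_restrict_iff' measurableSet_Ioo

/-- A closed condition which holds almost everywhere on `(0,T)` holds on `[0,T]`. -/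
theorem forall_mem_Icc_of_ae {T : ℝ} (hT : 0 < T) {p : ℝ → Prop} (hp : IsClosed {t | p t})
    (h : ∀ᵐ t ∂timeMeasure T, p t) : ∀ t ∈ Set.Icc 0 T, p t := by
  have hd : Set.Ioo 0 T ⊆ closure {t | p t} := by
    intro t ht
    rw [mem_closure_iff]
    intro o ho hto
    by_contra hne
    have hsub : o ∩ Set.Ioo 0 T ⊆ {t | ¬(t ∈ Set.Ioo 0 T → p t)} := fun s hs hps =>
      hne ⟨s, hs.1, hps hs.2⟩
    have h0 := measure_mono_null hsub (ae_timeMeasure_iff.mp h)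
    exact ((ho.inter isOpen_Ioo).measure_pos volume ⟨t, hto, ht⟩).ne' h0
  rw [hp.closure_eq] at hd
  intro t ht
  have := (closure_minimal hd hp)
  rw [closure_Ioo hT.ne] at this
  exact this ht

theorem exists_tsupport_subset_Icc {T : ℝ} (hT : 0 < T) {ψ : ℝ → ℝ} (h1 : HasCompactSupport ψ)
    (h2 : tsupport ψ ⊆ Set.Ioo 0 T) :
    ∃ a b, 0 < a ∧ b < T ∧ a ≤ b ∧ ∀ t, t ∉ Set.Icc a b → ψ t = 0 := by
  -- The midpoint is inserted only to make the compact set nonempty, so that it has a least and a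
  -- greatest element even when `ψ = 0`.
  have hK : IsCompact (insert (T / 2) (tsupport ψ)) := h1.isCompact.insert _
  have hsub : insert (T / 2) (tsupport ψ) ⊆ Set.Ioo 0 T :=
    Set.insert_subset ⟨by linarith, by linarith⟩ h2
  obtain ⟨a, ha, hamin⟩ := hK.exists_isLeast ⟨_, Set.mem_insert _ _⟩
  obtain ⟨b, hb, hbmax⟩ := hK.exists_isGreatest ⟨_, Set.mem_insert _ _⟩
  refine ⟨a, b, (hsub ha).1, (hsub hb).2, hamin hb, fun t ht => ?_⟩
  by_contra hne
  have : t ∈ insert (T / 2) (tsupport ψ) := Set.mem_insert_of_mem _ (subset_tsupport ψ hne)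
  exact ht ⟨hamin this, hbmax this⟩

theorem HasDistribDeriv.congr {T : ℝ} {g g' h h' : ℝ → ℝ} (H : HasDistribDeriv T g h)
    (hg : ∀ᵐ t ∂timeMeasure T, g t = g' t) (hh : ∀ᵐ t ∂timeMeasure T, h t = h' t) :
    HasDistribDeriv T g' h' := by
  have hloc : ∀ {u v : ℝ → ℝ}, LocallyIntegrableOn u (Set.Ioo 0 T) →
      (∀ᵐ t ∂timeMeasure T, u t = v t) → LocallyIntegrableOn v (Set.Ioo 0 T) := by
    intro u v hu huv
    rw [locallyIntegrableOn_iff isOpen_Ioo.isLocallyClosed] at hu ⊢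
    intro k hk hkc
    exact (hu k hk hkc).congr (ae_restrict_of_ae_restrict_of_subset hk huv)
  refine ⟨hloc H.1 hg, hloc H.2.1 hh, fun ψ h1 h2 h3 => ?_⟩
  have e1 : ∫ t in Set.Ioo 0 T, g' t * deriv ψ t = ∫ t in Set.Ioo 0 T, g t * deriv ψ t :=
    integral_congr_ae (by filter_upwards [hg] with t ht; rw [ht])
  have e2 : ∫ t in Set.Ioo 0 T, h' t * ψ t = ∫ t in Set.Ioo 0 T, h t * ψ t :=
    integral_congr_ae (by filter_upwards [hh] with t ht; rw [ht])
  rw [e1, e2]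
  exact H.2.2 ψ h1 h2 h3

theorem integrableOn_mul_of_support {T : ℝ} {g ψ : ℝ → ℝ}
    (hg : LocallyIntegrableOn g (Set.Ioo 0 T)) (hψ : Continuous ψ)
    {a b : ℝ} (ha : 0 < a) (hb : b < T) (hs : ∀ t, t ∉ Set.Icc a b → ψ t = 0) :
    IntegrableOn (fun t => g t * ψ t) (Set.Ioo 0 T) := by
  have hsub : Set.Icc a b ⊆ Set.Ioo 0 T := fun t ht => ⟨ha.trans_le ht.1, ht.2.trans_lt hb⟩
  have h1 : IntegrableOn g (Set.Icc a b) := hg.integrableOn_compact_subset hsub isCompact_Icc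
  have h2 : IntegrableOn (fun t => g t * ψ t) (Set.Icc a b) :=
    h1.mul_continuousOn hψ.continuousOn isCompact_Icc
  have h3 : IntegrableOn (fun t => g t * ψ t) Set.univ := by
    refine h2.of_forall_sdiff_eq_zero MeasurableSet.univ fun t ht => ?_
    rw [hs t ht.2, mul_zero]
  exact h3.mono_set (Set.subset_univ _)

theorem HasDistribDeriv.const_mul {T : ℝ} {g h : ℝ → ℝ} (H : HasDistribDeriv T g h) (c : ℝ) :
    HasDistribDeriv T (fun t => c * g t) (fun t => c * h t) := by
  refine ⟨H.1.smul c, H.2.1.smul c, fun ψ h1 h2 h3 => ?_⟩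
  simp only [mul_assoc, integral_const_mul]
  rw [H.2.2 ψ h1 h2 h3]
  ring

theorem HasDistribDeriv.add {T : ℝ} (hT : 0 < T) {g h g' h' : ℝ → ℝ} (H : HasDistribDeriv T g h)
    (H' : HasDistribDeriv T g' h') :
    HasDistribDeriv T (fun t => g t + g' t) (fun t => h t + h' t) := by
  refine ⟨H.1.add H'.1, H.2.1.add H'.2.1, fun ψ h1 h2 h3 => ?_⟩
  obtain ⟨a, b, ha, hb, -, hs⟩ := exists_tsupport_subset_Icc hT h2 h3
  obtain ⟨a', b', ha', hb', -, hs'⟩ := exists_tsupport_subset_Icc hT h2.deriv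
    ((closure_minimal support_deriv_subset (isClosed_tsupport _)).trans h3)
  have hc' : Continuous (deriv ψ) := h1.continuous_deriv (by simp)
  simp only [add_mul]
  rw [integral_add (integrableOn_mul_of_support H.1 hc' ha' hb' hs')
    (integrableOn_mul_of_support H'.1 hc' ha' hb' hs'),
    integral_add (integrableOn_mul_of_support H.2.1 h1.continuous ha hb hs)
    (integrableOn_mul_of_support H'.2.1 h1.continuous ha hb hs), H.2.2 ψ h1 h2 h3,
    H'.2.2 ψ h1 h2 h3]
  ring

theorem HasDistribDeriv.zero (T : ℝ) : HasDistribDeriv T (fun _ => 0) (fun _ => 0) :=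
  ⟨locallyIntegrableOn_zero, locallyIntegrableOn_zero, fun _ _ _ _ => by simp⟩

theorem HasDistribDeriv.sum {T : ℝ} (hT : 0 < T) {ι : Type*} (s : Finset ι) {g h : ι → ℝ → ℝ}
    (H : ∀ i, HasDistribDeriv T (g i) (h i)) :
    HasDistribDeriv T (fun t => ∑ i ∈ s, g i t) (fun t => ∑ i ∈ s, h i t) := by
  classical
  induction s using Finset.induction_on with
  | empty => simpa using HasDistribDeriv.zero T
  | insert i s hi ih =>
    simp only [Finset.sum_insert hi]
    exact (H i).add hT ih

/-- The fundamental lemma of the calculus of variations. It lets linear constraints on `u` be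
inherited by `u'`. -/
theorem HasDistribDeriv.ae_eq_zero {T : ℝ} {h : ℝ → ℝ} (H : HasDistribDeriv T (fun _ => 0) h) :
    ∀ᵐ t ∂timeMeasure T, h t = 0 := by
  rw [ae_timeMeasure_iff]
  refine isOpen_Ioo.ae_eq_zero_of_integral_contDiff_smul_eq_zero H.2.1 fun ψ h1 h2 h3 => ?_
  have h4 := H.2.2 ψ h1 h2 h3
  simp only [zero_mul, integral_zero] at h4
  have e : ∫ x, ψ x • h x = ∫ t in Set.Ioo 0 T, h t * ψ t := by
    rw [setIntegral_eq_integral_of_forall_compl_eq_zero]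
    · simp [mul_comm]
    · intro x hx
      have : ψ x = 0 := by
        by_contra hne
        exact hx (h3 (subset_tsupport ψ hne))
      rw [this, mul_zero]
  rw [e]
  linarith

/-- A function with vanishing distributional derivative is almost everywhere constant. -/
theorem HasDistribDeriv.exists_ae_eq_const {T : ℝ} (hT : 0 < T) {g : ℝ → ℝ}
    (H : HasDistribDeriv T g (fun _ => 0)) : ∃ c, ∀ᵐ t ∂timeMeasure T, g t = c := by
  obtain ⟨ψ₀, hψ₀, hψ₀c, hψ₀s, hψ₀1⟩ : ∃ ψ₀ : ℝ → ℝ, ContDiff ℝ ∞ ψ₀ ∧ HasCompactSupport ψ₀ ∧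
      tsupport ψ₀ ⊆ Set.Ioo 0 T ∧ ∫ t, ψ₀ t = 1 := by
    let f : ContDiffBump (T / 2) := ⟨T / 8, T / 4, by linarith, by linarith⟩
    refine ⟨f.normed volume, f.contDiff_normed, f.hasCompactSupport_normed, ?_,
      f.integral_normed⟩
    rw [f.tsupport_normed_eq, Real.closedBall_eq_Icc]
    intro t ht
    change T / 2 - T / 4 ≤ t ∧ t ≤ T / 2 + T / 4 at ht
    exact ⟨by linarith [ht.1], by linarith [ht.2]⟩
  obtain ⟨a₀, b₀, ha₀, hb₀, hab₀, hs₀⟩ := exists_tsupport_subset_Icc hT hψ₀c hψ₀s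
  set c := ∫ t in Set.Ioo 0 T, g t * ψ₀ t with hc
  refine ⟨c, ?_⟩
  have hloc : LocallyIntegrableOn (fun t => g t - c) (Set.Ioo 0 T) :=
    H.1.sub (locallyIntegrableOn_const c)
  suffices h : ∀ᵐ t : ℝ, t ∈ Set.Ioo 0 T → g t - c = 0 by
    rw [ae_timeMeasure_iff]
    filter_upwards [h] with t ht hm
    linarith [ht hm]
  refine isOpen_Ioo.ae_eq_zero_of_integral_contDiff_smul_eq_zero hloc fun ψ h1 h2 h3 => ?_
  obtain ⟨a, b, ha, hb, hab, hs⟩ := exists_tsupport_subset_Icc hT h2 h3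
  set m := ∫ t, ψ t with hm
  -- Subtracting a multiple of the fixed bump makes the mean zero. The primitive `χ` of `θ` is then
  -- compactly supported, hence an admissible test function, and testing with it gives `∫ g θ = 0`,
  -- that is `∫ g ψ = c ∫ ψ`.
  set θ : ℝ → ℝ := fun t => ψ t - m * ψ₀ t with hθ
  have hθd : ContDiff ℝ ∞ θ := h1.sub (contDiff_const.mul hψ₀)
  have hθs : ∀ t, t ∉ Set.Icc (min a a₀) (max b b₀) → θ t = 0 := by
    intro t ht
    have e1 : ψ t = 0 := hs t fun h => ht ⟨(min_le_left _ _).trans h.1, h.2.trans (le_max_left _ _)⟩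
    have e2 : ψ₀ t = 0 :=
      hs₀ t fun h => ht ⟨(min_le_right _ _).trans h.1, h.2.trans (le_max_right _ _)⟩
    simp [hθ, e1, e2]
  have hθi : Integrable θ := (h1.continuous.integrable_of_hasCompactSupport h2).sub
    ((hψ₀.continuous.integrable_of_hasCompactSupport hψ₀c).const_mul m)
  have hθ0 : ∫ t, θ t = 0 := by
    rw [hθ, integral_sub (h1.continuous.integrable_of_hasCompactSupport h2)
      ((hψ₀.continuous.integrable_of_hasCompactSupport hψ₀c).const_mul m), integral_const_mul,
      hψ₀1, ← hm]
    ring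
  set χ : ℝ → ℝ := fun t => ∫ s in (0 : ℝ)..t, θ s with hχ
  have hχd : ∀ t, HasDerivAt χ (θ t) t := fun t =>
    intervalIntegral.integral_hasDerivAt_right hθi.intervalIntegrable
      (hθd.continuous.stronglyMeasurableAtFilter _ _) hθd.continuous.continuousAt
  have hχ' : deriv χ = θ := funext fun t => (hχd t).deriv
  have hχc : ContDiff ℝ ∞ χ := contDiff_infty_iff_deriv.mpr
    ⟨fun t => (hχd t).differentiableAt, by rwa [hχ']⟩
  have hmin : 0 < min a a₀ := lt_min ha ha₀
  have hmax : max b b₀ < T := max_lt hb hb₀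
  have hχs : ∀ t, t ∉ Set.Icc (min a a₀) (max b b₀) → χ t = 0 := by
    intro t ht
    rcases lt_or_ge t (min a a₀) with h | h
    · refine intervalIntegral.integral_zero_ae (Eventually.of_forall fun s hs => hθs s fun h' => ?_)
      have := h'.1
      rw [Set.uIoc, Set.mem_Ioc] at hs
      rcases max_cases 0 t with h'' | h'' <;> linarith [hs.2]
    · have h4 : max b b₀ < t := by
        by_contra h5
        exact ht ⟨h, not_lt.mp h5⟩
      have h6 : (0 : ℝ) ≤ t := by
        have : min a a₀ ≤ max b b₀ := (min_le_left _ _).trans (hab.trans (le_max_left _ _))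
        linarith
      rw [hχ]
      simp only
      rw [intervalIntegral.integral_of_le h6, setIntegral_eq_integral_of_forall_compl_eq_zero, hθ0]
      intro s hs
      refine hθs s fun h' => hs ⟨hmin.trans_le h'.1, h'.2.trans h4.le⟩
  have hχts : tsupport χ ⊆ Set.Icc (min a a₀) (max b b₀) :=
    closure_minimal (fun t ht => by by_contra h; exact ht (hχs t h)) isClosed_Icc
  have hsub : Set.Icc (min a a₀) (max b b₀) ⊆ Set.Ioo 0 T :=
    fun t ht => ⟨hmin.trans_le ht.1, ht.2.trans_lt hmax⟩
  have h5 := H.2.2 χ hχc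
    (isCompact_Icc.of_isClosed_subset (isClosed_tsupport _) hχts) (hχts.trans hsub)
  simp only [hχ', zero_mul, integral_zero, neg_zero] at h5
  have i1 := integrableOn_mul_of_support H.1 h1.continuous ha hb hs
  have i2 := integrableOn_mul_of_support H.1 hψ₀.continuous ha₀ hb₀ hs₀
  have h6 : ∫ t in Set.Ioo 0 T, g t * θ t = (∫ t in Set.Ioo 0 T, g t * ψ t) - m * c := by
    rw [hc, ← integral_const_mul, ← integral_sub i1 (i2.const_mul m)]
    congr 1; ext t; simp only [hθ]; ring
  have h7 : ∫ t in Set.Ioo 0 T, ψ t = m := by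
    rw [hm, setIntegral_eq_integral_of_forall_compl_eq_zero]
    intro t ht
    exact hs t fun h => ht ⟨ha.trans_le h.1, h.2.trans_lt hb⟩
  have e : ∫ x, ψ x • (g x - c) = ∫ t in Set.Ioo 0 T, (g t * ψ t - c * ψ t) := by
    rw [setIntegral_eq_integral_of_forall_compl_eq_zero]
    · congr 1; ext t; simp only [smul_eq_mul]; ring
    · intro t ht
      rw [hs t fun h => ht ⟨ha.trans_le h.1, h.2.trans_lt hb⟩]
      ring
  rw [e, integral_sub i1 ((h1.continuous.integrable_of_hasCompactSupport h2).integrableOn.const_mul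
    c), integral_const_mul, h7]
  linarith

/-- The absolutely continuous function `t ↦ c + ∫₀ᵗ h`. -/
def prim (c : ℝ) (h : ℝ → ℝ) (t : ℝ) : ℝ := c + ∫ s in (0 : ℝ)..t, h s

theorem prim_zero (c : ℝ) (h : ℝ → ℝ) : prim c h 0 = c := by simp [prim]

theorem continuous_prim (c : ℝ) {h : ℝ → ℝ} (hh : Integrable h) : Continuous (prim c h) :=
  continuous_const.add
    (intervalIntegral.continuous_primitive (fun _ _ => hh.intervalIntegrable) 0)

theorem ae_hasDerivAt_prim (c : ℝ) {h : ℝ → ℝ} (hh : Integrable h) :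
    ∀ᵐ t, HasDerivAt (prim c h) (h t) t := by
  filter_upwards [LocallyIntegrable.ae_hasDerivAt_integral hh.locallyIntegrable] with t ht
  exact (ht 0).const_add c

/-- Integration by parts for absolutely continuous functions on `[0,T]`; the boundary terms vanish
because `ψ` is zero at both ends. -/
theorem hasDistribDeriv_prim {T : ℝ} (hT : 0 < T) (c : ℝ) {h : ℝ → ℝ} (hh : Integrable h) :
    HasDistribDeriv T (prim c h) h := by
  refine ⟨(continuous_prim c hh).locallyIntegrable.locallyIntegrableOn _,
    hh.locallyIntegrable.locallyIntegrableOn _, fun ψ h1 h2 h3 => ?_⟩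
  obtain ⟨a, b, ha, hb, hab, hs⟩ := exists_tsupport_subset_Icc hT h2 h3
  have hψ0 : ψ 0 = 0 := hs 0 fun h => by linarith [h.1]
  have hψT : ψ T = 0 := hs T fun h => by linarith [h.2]
  have hc' : Continuous (deriv ψ) := h1.continuous_deriv (by simp)
  have hint : ∀ t, ∫ s in (0 : ℝ)..t, deriv ψ s = ψ t := fun t => by
    rw [intervalIntegral.integral_deriv_eq_sub
      (fun x _ => (h1.differentiable (by simp)) x) (hc'.intervalIntegrable _ _), hψ0, sub_zero]
  have hac : AbsolutelyContinuousOnInterval ψ 0 T := by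
    have := (hc'.intervalIntegrable 0 T).absolutelyContinuousOnInterval_intervalIntegral
      (c := 0) (by simp)
    simpa only [hint] using this
  have hac2 := (hh.intervalIntegrable (a := 0) (b := T)).absolutelyContinuousOnInterval_intervalIntegral
    (c := 0) (by simp)
  have h4 := hac2.integral_mul_deriv_eq_deriv_mul hac
  rw [hψ0, hψT] at h4
  have h5 : ∫ x in (0 : ℝ)..T, deriv (fun x => ∫ v in (0 : ℝ)..x, h v) x * ψ x =
      ∫ x in (0 : ℝ)..T, h x * ψ x := by
    refine intervalIntegral.integral_congr_ae ?_
    filter_upwards [LocallyIntegrable.ae_hasDerivAt_integral hh.locallyIntegrable] with t ht _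
    rw [(ht 0).deriv]
  rw [h5] at h4
  rw [← integral_Ioc_eq_integral_Ioo, ← integral_Ioc_eq_integral_Ioo,
    ← intervalIntegral.integral_of_le hT.le, ← intervalIntegral.integral_of_le hT.le]
  have h6 : ∫ t in (0 : ℝ)..T, prim c h t * deriv ψ t =
      (∫ t in (0 : ℝ)..T, c * deriv ψ t) +
        ∫ t in (0 : ℝ)..T, (∫ s in (0 : ℝ)..t, h s) * deriv ψ t := by
    have hV : Continuous fun t => (∫ s in (0 : ℝ)..t, h s) * deriv ψ t :=
      (intervalIntegral.continuous_primitive (fun _ _ => hh.intervalIntegrable) 0).mul hc'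
    rw [← intervalIntegral.integral_add ((hc'.const_mul c).intervalIntegrable _ _)
      (hV.intervalIntegrable _ _)]
    simp only [prim, add_mul]
  rw [h6, h4, intervalIntegral.integral_const_mul, hint, hψT]
  ring

/-- A function with integrable distributional derivative is almost everywhere equal to a primitive
of that derivative. -/
theorem HasDistribDeriv.exists_ae_eq_prim {T : ℝ} (hT : 0 < T) {g h : ℝ → ℝ}
    (H : HasDistribDeriv T g h) (hh : IntegrableOn h (Set.Ioo 0 T)) :
    ∃ c, ∀ᵐ t ∂timeMeasure T, g t = prim c ((Set.Ioo 0 T).indicator h) t := by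
  set k := (Set.Ioo 0 T).indicator h with hk
  have hki : Integrable k := (integrable_indicator_iff measurableSet_Ioo).mpr hh
  have hkh : ∀ᵐ t ∂timeMeasure T, k t = h t := by
    filter_upwards [ae_restrict_mem measurableSet_Ioo] with t ht
    rw [hk, Set.indicator_of_mem ht]
  -- The difference of `g` and the primitive of its derivative has zero distributional derivative,
  -- so it is a constant.
  have H1 := (H.add hT ((hasDistribDeriv_prim hT 0 hki).const_mul (-1))).congr
    (Eventually.of_forall fun _ => rfl) (h' := fun _ => 0)
    (by filter_upwards [hkh] with t ht; rw [ht]; ring)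
  obtain ⟨c, hc⟩ := H1.exists_ae_eq_const hT
  refine ⟨c, ?_⟩
  filter_upwards [hc] with t ht
  simp only [prim] at ht ⊢
  linarith

/-- The product rule for absolutely continuous functions. This is the scalar form of the energy
identity, to be summed over components and frequencies later. -/
theorem prim_sq (c : ℝ) {h : ℝ → ℝ} (hh : Integrable h) (t : ℝ) :
    prim c h t ^ 2 = c ^ 2 + ∫ s in (0 : ℝ)..t, 2 * (h s * prim c h s) := by
  have hac := (hh.intervalIntegrable (a := 0) (b := t)).absolutelyContinuousOnInterval_intervalIntegral
    (c := 0) (by simp)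
  have h1 := hac.integral_deriv_mul_eq_sub hac
  simp only [intervalIntegral.integral_same, mul_zero, sub_zero] at h1
  have hV : Continuous fun t => ∫ s in (0 : ℝ)..t, h s :=
    intervalIntegral.continuous_primitive (fun _ _ => hh.intervalIntegrable) 0
  have h2 : ∫ x in (0 : ℝ)..t, 2 * (h x * ∫ v in (0 : ℝ)..x, h v) =
      (∫ v in (0 : ℝ)..t, h v) * ∫ v in (0 : ℝ)..t, h v := by
    rw [← h1]
    refine intervalIntegral.integral_congr_ae ?_
    filter_upwards [LocallyIntegrable.ae_hasDerivAt_integral hh.locallyIntegrable] with s hs _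
    rw [(hs 0).deriv]
    ring
  have h3 : ∫ s in (0 : ℝ)..t, 2 * (h s * prim c h s) =
      (∫ s in (0 : ℝ)..t, (2 * c) * h s) + ∫ s in (0 : ℝ)..t, 2 * (h s * ∫ v in (0 : ℝ)..s, h v) := by
    rw [← intervalIntegral.integral_add (hh.intervalIntegrable.const_mul _)
      ((hh.intervalIntegrable.mul_continuousOn hV.continuousOn).const_mul _)]
    congr 1; ext s; simp only [prim]; ring
  rw [h3, h2, intervalIntegral.integral_const_mul, prim]
  ring

/-! ## Square integrable functions of time with values in Sobolev spaces -/

theorem hE_eq_enorm_sq {s : ℝ} {c : (Fin n → ℤ) → ℂ} {G : lp (fun _ : Fin n → ℤ => ℂ) 2}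
    (h : ∀ ξ, G ξ = ((rho ξ ^ s : ℝ) : ℂ) * c ξ) : hE s c = ‖G‖ₑ ^ 2 := by
  have h1 := lp.norm_rpow_eq_tsum (p := 2) (by simp) G
  have h2 := (lp.memℓp G).summable (by simp)
  simp only [ENNReal.toReal_ofNat, Real.rpow_two] at h1 h2
  rw [← ofReal_norm, ← ENNReal.ofReal_pow (norm_nonneg _), h1,
    ENNReal.ofReal_tsum_of_nonneg (fun _ => by positivity) h2, hE]
  refine tsum_congr fun ξ => ?_
  have hr := rho_pos ξ
  rw [wt_mul_enorm_sq, h, norm_mul, Complex.norm_real, Real.norm_of_nonneg (by positivity), mul_pow,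
    ← Real.rpow_natCast (rho ξ ^ s), ← Real.rpow_mul hr.le]
  rw [mul_comm s, Nat.cast_ofNat]

theorem continuous_lp_eval (ξ : Fin n → ℤ) :
    Continuous fun G : lp (fun _ : Fin n → ℤ => ℂ) 2 => G ξ := by
  have : LipschitzWith 1 fun G : lp (fun _ : Fin n → ℤ => ℂ) 2 => G ξ :=
    LipschitzWith.of_dist_le_mul fun G H => by
      rw [dist_eq_norm, dist_eq_norm, NNReal.coe_one, one_mul]
      exact lp.norm_apply_le_norm (by simp) (G - H) ξ
  exact this.continuous

theorem MemLqH.aestronglyMeasurable_fourier {q : ℝ≥0∞} {T s : ℝ} {g : ℝ → TorusDist n}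
    (h : MemLqH q T s g) (ξ : Fin n → ℤ) :
    AEStronglyMeasurable (fun t => (g t).fourier ξ) (timeMeasure T) := by
  obtain ⟨G, hG, hGg⟩ := h
  have h1 : AEStronglyMeasurable (fun t => ((rho ξ ^ s : ℝ) : ℂ)⁻¹ * G t ξ) (timeMeasure T) :=
    ((continuous_lp_eval ξ).comp_aestronglyMeasurable hG.1).const_mul _
  refine h1.congr ?_
  filter_upwards [hGg] with t ht
  have : ((rho ξ ^ s : ℝ) : ℂ) ≠ 0 := by
    have := rho_pos ξ
    exact_mod_cast (by positivity : rho ξ ^ s ≠ 0)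
  rw [ht, inv_mul_cancel_left₀ this]

theorem MemLqH.lintegral_ne_top {T s : ℝ} {g : ℝ → TorusDist n} (h : MemLqH 2 T s g) :
    ∫⁻ t, hE s (g t).fourier ∂timeMeasure T ≠ ⊤ := by
  obtain ⟨G, hG, hGg⟩ := h
  have h1 : ∫⁻ t, hE s (g t).fourier ∂timeMeasure T = ∫⁻ t, ‖G t‖ₑ ^ 2 ∂timeMeasure T :=
    lintegral_congr_ae (by filter_upwards [hGg] with t ht using hE_eq_enorm_sq ht)
  rw [h1]
  have h2 := (lintegral_rpow_enorm_lt_top_of_eLpNorm_lt_top (p := 2) (by simp) (by simp) hG.2).ne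
  simpa using h2

theorem MemLqH.exists_ae_le {T s : ℝ} {g : ℝ → TorusDist n} (h : MemLqH ∞ T s g) :
    ∃ M : ℝ≥0∞, M ≠ ⊤ ∧ ∀ᵐ t ∂timeMeasure T, hE s (g t).fourier ≤ M := by
  obtain ⟨G, hG, hGg⟩ := h
  refine ⟨eLpNorm G ∞ (timeMeasure T) ^ 2, ENNReal.pow_ne_top hG.2.ne, ?_⟩
  have h1 := ae_le_eLpNormEssSup (f := G) (μ := timeMeasure T)
  rw [← eLpNorm_exponent_top] at h1
  filter_upwards [hGg, h1] with t ht h2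
  rw [hE_eq_enorm_sq ht]
  gcongr

theorem measurable_hE {T s : ℝ} {c : ℝ → (Fin n → ℤ) → ℂ}
    (h : ∀ ξ, AEStronglyMeasurable (fun t => c t ξ) (timeMeasure T)) :
    AEMeasurable (fun t => hE s (c t)) (timeMeasure T) := by
  unfold hE
  exact AEMeasurable.tsum fun ξ => ((h ξ).enorm.pow_const 2).const_mul _

/-- Bochner measurability is recovered from the coordinates: the finite sections of an element of
`ℓ²` converge to it, and each section is a finite sum of measurable coordinates. -/
theorem memLqH_two_of {T s : ℝ} {g : ℝ → TorusDist n}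
    (hm : ∀ ξ, AEStronglyMeasurable (fun t => (g t).fourier ξ) (timeMeasure T))
    (hi : ∫⁻ t, hE s (g t).fourier ∂timeMeasure T ≠ ⊤) : MemLqH 2 T s g := by
  classical
  have hfin : ∀ᵐ t ∂timeMeasure T, hE s (g t).fourier ≠ ⊤ := by
    filter_upwards [ae_lt_top' (measurable_hE hm) hi] with t ht using ht.ne
  have hmem : ∀ t, hE s (g t).fourier ≠ ⊤ →
      Memℓp (fun ξ => ((rho ξ ^ s : ℝ) : ℂ) * (g t).fourier ξ) 2 := by
    intro t ht
    refine memℓp_gen ?_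
    rw [hE_ne_top_iff] at ht
    refine ht.congr fun ξ => ?_
    have hr := rho_pos ξ
    simp only [ENNReal.toReal_ofNat, Real.rpow_two]
    rw [norm_mul, Complex.norm_real, Real.norm_of_nonneg (by positivity), mul_pow,
      ← Real.rpow_natCast (rho ξ ^ s), ← Real.rpow_mul hr.le]
    rw [mul_comm s, Nat.cast_ofNat]
  -- The default `0` is taken only where the norm is infinite, which is a null set of times.
  set G : ℝ → lp (fun _ : Fin n → ℤ => ℂ) 2 := fun t =>
    if h : hE s (g t).fourier ≠ ⊤ then ⟨_, hmem t h⟩ else 0 with hG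
  have hGg : ∀ᵐ t ∂timeMeasure T, ∀ ξ, G t ξ = ((rho ξ ^ s : ℝ) : ℂ) * (g t).fourier ξ := by
    filter_upwards [hfin] with t ht ξ
    simp only [hG, dif_pos ht]
  have hcoord : ∀ ξ, AEStronglyMeasurable (fun t => G t ξ) (timeMeasure T) := fun ξ =>
    ((hm ξ).const_mul ((rho ξ ^ s : ℝ) : ℂ)).congr
      (by filter_upwards [hGg] with t ht using (ht ξ).symm)
  have hGm : AEStronglyMeasurable G (timeMeasure T) := by
    refine aestronglyMeasurable_of_tendsto_ae (atTop : Filter (Finset (Fin n → ℤ)))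
      (f := fun S t => ∑ ξ ∈ S, lp.single 2 ξ (G t ξ)) (fun S => ?_)
      (Eventually.of_forall fun t => lp.hasSum_single (by simp) (G t))
    refine Finset.aestronglyMeasurable_fun_sum S fun ξ _ => ?_
    have hc : Continuous fun z : ℂ => (lp.single 2 ξ z : lp (fun _ : Fin n → ℤ => ℂ) 2) := by
      have : Isometry fun z : ℂ => (lp.single 2 ξ z : lp (fun _ : Fin n → ℤ => ℂ) 2) :=
        Isometry.of_dist_eq fun z w => by
          rw [dist_eq_norm, dist_eq_norm, ← lp.single_sub]
          exact lp.norm_single (by simp) ξ _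
      exact this.continuous
    exact hc.comp_aestronglyMeasurable (hcoord ξ)
  refine ⟨G, ⟨hGm, ?_⟩, hGg⟩
  rw [eLpNorm_lt_top_iff_lintegral_rpow_enorm_lt_top (by simp) (by simp)]
  have h1 : ∫⁻ t, hE s (g t).fourier ∂timeMeasure T = ∫⁻ t, ‖G t‖ₑ ^ 2 ∂timeMeasure T :=
    lintegral_congr_ae (by filter_upwards [hGg] with t ht using hE_eq_enorm_sq ht)
  rw [h1] at hi
  simpa using hi.lt_top

/-! ## The convection term -/

/-- Interpolation between `H⁰` and `H¹`, by Cauchy-Schwarz applied to `|c| · ϱ|c|`. -/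
theorem hE_half_sq_le (c : (Fin n → ℤ) → ℂ) : hE (1 / 2) c ^ 2 ≤ hE 0 c * hE 1 c := by
  have h := ENNReal_tsum_mul_sq_le (fun ξ => ‖c ξ‖ₑ) (fun ξ => wt 1 ξ * ‖c ξ‖ₑ)
  have e1 : ∀ ξ, ‖c ξ‖ₑ * (wt 1 ξ * ‖c ξ‖ₑ) = wt (2 * (1 / 2)) ξ * ‖c ξ‖ₑ ^ 2 := fun ξ => by
    rw [show (2 * (1 / 2) : ℝ) = 1 by norm_num]; ring
  have e2 : ∀ ξ, ‖c ξ‖ₑ ^ 2 = wt (2 * 0) ξ * ‖c ξ‖ₑ ^ 2 := fun ξ => by simp [wt_zero]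
  have e3 : ∀ ξ, (wt 1 ξ * ‖c ξ‖ₑ) ^ 2 = wt (2 * 1) ξ * ‖c ξ‖ₑ ^ 2 := fun ξ => by
    rw [mul_pow, sq (wt 1 ξ), wt_mul]; norm_num
  have e4 : ∑' ξ, ‖c ξ‖ₑ ^ 2 = hE 0 c := tsum_congr e2
  simp only [e1, e3] at h
  rw [e4] at h
  exact h

/-- The product `f g` of two `H⁰` distributions. -/
def distMul (f g : TorusDist n) : TorusDist n := TorusDist.ofFun fun x => f.toFun x * g.toFun x

theorem hasSum_fourier_distMul {f g : TorusDist n} (hf : MemH 0 f) (hg : MemH 0 g)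
    (ξ : Fin n → ℤ) :
    HasSum (fun η => f.fourier (ξ - η) * g.fourier η) ((distMul f g).fourier ξ) := by
  have h := hasSum_fourier_mul (memLp_toFun hf) (memLp_toFun hg) ξ
  rwa [ofFun_toFun hf, ofFun_toFun hg] at h

/-- The coefficients of a product form a convolution, so the lattice estimate applies to their
moduli. -/
theorem exists_hE_distMul_le (hn : 2 ≤ n) : ∃ C : ℝ≥0∞, C ≠ ⊤ ∧ ∀ f g : TorusDist n,
    MemH 0 f → MemH 0 g → hE (1 - (n : ℝ) / 2) (distMul f g).fourier ≤
      C * (hE (1 / 2) f.fourier * hE (1 / 2) g.fourier) := by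
  obtain ⟨C, hC, h⟩ := exists_tsum_conv_le hn
  refine ⟨C, hC, fun f g hf hg => ?_⟩
  have h1 := h (fun η => ‖g.fourier η‖ₑ) (fun η => ‖f.fourier η‖ₑ)
  have e : ∀ F : (Fin n → ℤ) → ℂ, ∑' η, wt 1 η * ‖F η‖ₑ ^ 2 = hE (1 / 2) F := fun F => by
    rw [hE]; norm_num
  rw [e, e, mul_comm (hE (1 / 2) g.fourier)] at h1
  refine le_trans (ENNReal.tsum_le_tsum fun ξ => ?_) h1
  rw [show 2 * (1 - (n : ℝ) / 2) = 2 - n by ring]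
  gcongr
  rw [← (hasSum_fourier_distMul hf hg ξ).tsum_eq]
  refine (enorm_tsum_le_tsum_enorm).trans_eq ?_
  refine tsum_congr fun η => ?_
  rw [enorm_mul, mul_comm]

/-- `(u·∇)u = ∑_j ∂_j (u_j u)` for divergence free `u`. -/
theorem convection_eq {u : VecDist n} (hu : MemVecH 1 u) (hdiv : divergence u = 0) (k : Fin n) :
    convection u k = ∑ j, (distMul (u j) (u k)).partialDeriv j := by
  have h0 : ∀ j, MemH 0 (u j) := fun j => memH_mono zero_le_one (hu j)
  have h1 : ∀ j, MemH 0 ((u k).partialDeriv j) := fun j =>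
    memH_partialDeriv j (by rw [zero_add]; exact hu k)
  have hc : convection u k = ∑ j, distMul (u j) ((u k).partialDeriv j) := by
    rw [convection]
    exact ofFun_sum Finset.univ fun j => (memLp_toFun (h0 j)).integrable_mul (memLp_toFun (h1 j))
  refine fourier_injective fun ξ => ?_
  rw [hc, fourier_sum, fourier_sum]
  have hs1 := hasSum_sum (s := Finset.univ) fun j _ => hasSum_fourier_distMul (h0 j) (h1 j) ξ
  have hs2 := hasSum_sum (s := Finset.univ) fun j _ =>
    (hasSum_fourier_distMul (h0 j) (h0 k) ξ).mul_left (2 * Real.pi * Complex.I * (ξ j : ℂ))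
  simp only [fourier_partialDeriv] at hs1 ⊢
  -- The two convolution series agree term by term: their terms differ by a multiple of
  -- `(ξ-η)·û(ξ-η)`, which vanishes because `u` is divergence free.
  suffices hfun : (fun η => ∑ j, (u j).fourier (ξ - η) *
      (2 * Real.pi * Complex.I * (η j : ℂ) * (u k).fourier η)) = fun η => ∑ j,
      2 * Real.pi * Complex.I * (ξ j : ℂ) * ((u j).fourier (ξ - η) * (u k).fourier η) by
    rw [hfun] at hs1
    exact hs1.unique hs2
  funext η
  have hd : ∑ j, ((ξ - η) j : ℂ) * (u j).fourier (ξ - η) = 0 := by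
    have h := fourier_divergence u (ξ - η)
    rw [hdiv, fourier_zero_dist] at h
    have hpi : (2 * Real.pi * Complex.I : ℂ) ≠ 0 := by simp [Real.pi_ne_zero]
    exact (mul_eq_zero.mp h.symm).resolve_left hpi
  have key : ∑ j, ((ξ j : ℂ) - (η j : ℂ)) * (u j).fourier (ξ - η) = 0 := by
    rw [← hd]
    refine Finset.sum_congr rfl fun j _ => ?_
    simp
  rw [← sub_eq_zero, ← Finset.sum_sub_distrib]
  calc _ = ∑ j, -(2 * Real.pi * Complex.I * (u k).fourier η) *
        (((ξ j : ℂ) - (η j : ℂ)) * (u j).fourier (ξ - η)) :=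
        Finset.sum_congr rfl fun j _ => by ring
    _ = 0 := by rw [← Finset.mul_sum, key, mul_zero]

/-- The divergence form costs one derivative, from `1-n/2` to `-n/2`. Interpolation leaves a bound
that is only linear in the squared `H¹` norm, and this linearity is what makes the term square
integrable in time. -/
theorem exists_hE_convection_le (hn : 2 ≤ n) : ∃ C : ℝ≥0∞, C ≠ ⊤ ∧ ∀ (u : VecDist n) (M : ℝ≥0∞),
    MemVecH 1 u → divergence u = 0 → (∀ k, hE 0 (u k).fourier ≤ M) → ∀ k,
      hE (-(n : ℝ) / 2) (convection u k).fourier ≤ C * (M * ∑ i, hE 1 (u i).fourier) := by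
  obtain ⟨C, hC, h⟩ := exists_hE_distMul_le hn
  refine ⟨n * (n * C), ENNReal.mul_ne_top (by simp) (ENNReal.mul_ne_top (by simp) hC),
    fun u M hu hdiv hM k => ?_⟩
  have h0 : ∀ j, MemH 0 (u j) := fun j => memH_mono zero_le_one (hu j)
  set E := ∑ i, hE 1 (u i).fourier with hEdef
  have hle : ∀ i, hE 1 (u i).fourier ≤ E := fun i =>
    Finset.single_le_sum (f := fun i => hE 1 (u i).fourier) (fun _ _ => zero_le)
      (Finset.mem_univ i)
  have hprod : ∀ j, hE (1 / 2) (u j).fourier * hE (1 / 2) (u k).fourier ≤ M * E := by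
    intro j
    -- The interpolation inequality controls the square of each factor, so the product is compared
    -- after squaring.
    have h2 : (hE (1 / 2) (u j).fourier * hE (1 / 2) (u k).fourier) ^ 2 ≤ (M * E) ^ 2 := by
      rw [mul_pow]
      calc _ ≤ (hE 0 (u j).fourier * hE 1 (u j).fourier) *
            (hE 0 (u k).fourier * hE 1 (u k).fourier) :=
            mul_le_mul' (hE_half_sq_le _) (hE_half_sq_le _)
        _ ≤ (M * E) * (M * E) :=
            mul_le_mul' (mul_le_mul' (hM j) (hle j)) (mul_le_mul' (hM k) (hle k))
        _ = _ := by ring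
    exact (ENNReal.pow_le_pow_left_iff two_ne_zero).mp h2
  have hconv : (convection u k).fourier = fun ξ => ∑ j, ((distMul (u j) (u k)).partialDeriv
      j).fourier ξ := by
    funext ξ; rw [convection_eq hu hdiv k, fourier_sum]
  rw [hconv]
  refine (hE_sum_le _ _ _).trans ?_
  rw [Finset.card_univ, Fintype.card_fin]
  calc _ ≤ (n : ℝ≥0∞) * ∑ _j : Fin n, C * (M * E) := by
        gcongr with j
        refine (hE_partialDeriv_le _ _ _).trans ?_
        rw [show -(n : ℝ) / 2 + 1 = 1 - n / 2 by ring]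
        refine (h _ _ (h0 j) (h0 k)).trans ?_
        exact mul_le_mul_right (hprod j) _
    _ = _ := by
        rw [Finset.sum_const, Finset.card_univ, Fintype.card_fin, nsmul_eq_mul]; ring

/-! ## The viscous term -/

/-- The stress `S_{iα} = a_{ij}^{αβ} E_{jβ}(u)`. -/
def stress (b : Fin n → Fin n → Fin n → Fin n → (Fin n → ℝ) → ℝ) (u : VecDist n) (i α : Fin n) :
    TorusDist n :=
  ∑ j, ∑ β, TorusDist.ofFun fun x => b i j α β x * (strain u j β).toFun x

/-- The distribution `w ↦ a(t; u, w)`. -/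
def viscDist (b : Fin n → Fin n → Fin n → Fin n → (Fin n → ℝ) → ℝ) (u : VecDist n) : VecDist n :=
  fun k => -∑ i, ((1 / 2 : ℝ) • (stress b u i k + stress b u k i)).partialDeriv i

theorem memH_strain {u : VecDist n} (hu : MemVecH 1 u) (j β : Fin n) : MemH 0 (strain u j β) := by
  rw [memH_iff]
  have h1 : hE 0 (strain u j β).fourier ≤ ENNReal.ofReal ((1 / 2) ^ 2) * hE (0 + 0)
      (fun ξ => ((u β).partialDeriv j).fourier ξ + ((u j).partialDeriv β).fourier ξ) :=
    hE_le_of_norm_le fun ξ => by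
      rw [strain, fourier_smul, fourier_add, norm_mul, Real.rpow_zero, mul_one]
      simp
  have h2 : ∀ j β, hE 0 ((u β).partialDeriv j).fourier ≠ ⊤ := fun j β =>
    (memH_iff _ _).mp (memH_partialDeriv j (by rw [zero_add]; exact hu β))
  refine ne_top_of_le_ne_top (ENNReal.mul_ne_top ENNReal.ofReal_ne_top ?_) h1
  rw [zero_add]
  exact ne_top_of_le_ne_top (ENNReal.mul_ne_top (by simp)
    (ENNReal.add_ne_top.mpr ⟨h2 _ _, h2 _ _⟩)) (hE_add_le _ _ _)

theorem hE_strain_le (u : VecDist n) (j β : Fin n) :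
    hE 0 (strain u j β).fourier ≤ hE 1 (u β).fourier + hE 1 (u j).fourier := by
  have h1 : hE 0 (strain u j β).fourier ≤ ENNReal.ofReal ((1 / 2) ^ 2) * hE (0 + 0)
      (fun ξ => ((u β).partialDeriv j).fourier ξ + ((u j).partialDeriv β).fourier ξ) :=
    hE_le_of_norm_le fun ξ => by
      rw [strain, fourier_smul, fourier_add, norm_mul, Real.rpow_zero, mul_one]
      simp
  have h2 : ∀ j β, hE 0 ((u β).partialDeriv j).fourier ≤ hE 1 (u β).fourier := fun j β => by
    simpa using hE_partialDeriv_le 0 j (u β)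
  have h3 : ENNReal.ofReal ((1 / 2) ^ 2) * 2 ≤ 1 := by
    rw [← ENNReal.ofReal_ofNat 2, ← ENNReal.ofReal_mul (by norm_num), ← ENNReal.ofReal_one]
    exact ENNReal.ofReal_le_ofReal (by norm_num)
  rw [zero_add] at h1
  calc _ ≤ ENNReal.ofReal ((1 / 2) ^ 2) * (2 * (hE 0 ((u β).partialDeriv j).fourier +
        hE 0 ((u j).partialDeriv β).fourier)) := h1.trans (by gcongr; exact hE_add_le _ _ _)
    _ = (ENNReal.ofReal ((1 / 2) ^ 2) * 2) * (hE 0 ((u β).partialDeriv j).fourier +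
        hE 0 ((u j).partialDeriv β).fourier) := by ring
    _ ≤ 1 * (hE 1 (u β).fourier + hE 1 (u j).fourier) := by
        gcongr
        · exact h2 _ _
        · exact h2 _ _
    _ = _ := one_mul _

theorem memLp_mul_bounded {b f : (Fin n → ℝ) → ℝ} {K : ℝ}
    (hb : AEStronglyMeasurable b (cubeMeasure n)) (hK : ∀ᵐ x ∂cubeMeasure n, ‖b x‖ ≤ K)
    (hf : MemLp f 2 (cubeMeasure n)) : MemLp (fun x => b x * f x) 2 (cubeMeasure n) := by
  refine MemLp.of_le_mul (c := K) hf (hb.mul hf.1) ?_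
  filter_upwards [hK] with x hx
  rw [norm_mul]
  gcongr

theorem hE_zero_mul_le {b f : (Fin n → ℝ) → ℝ} {K : ℝ}
    (hb : AEStronglyMeasurable b (cubeMeasure n)) (hK : ∀ᵐ x ∂cubeMeasure n, ‖b x‖ ≤ K)
    (hf : MemLp f 2 (cubeMeasure n)) :
    hE 0 (TorusDist.ofFun fun x => b x * f x).fourier ≤
      ENNReal.ofReal (K ^ 2) * hE 0 (TorusDist.ofFun f).fourier := by
  rw [hE_zero_ofFun (memLp_mul_bounded hb hK hf), hE_zero_ofFun hf,
    ← ENNReal.ofReal_mul (sq_nonneg K), ← integral_const_mul]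
  refine ENNReal.ofReal_le_ofReal (integral_mono_ae (memLp_mul_bounded hb hK hf).integrable_sq
    (hf.integrable_sq.const_mul _) ?_)
  filter_upwards [hK] with x hx
  simp only [mul_pow]
  refine mul_le_mul_of_nonneg_right ?_ (sq_nonneg _)
  rw [← sq_abs]
  exact pow_le_pow_left₀ (abs_nonneg _) hx 2

/-- Bounded measurable coefficients. -/
structure BoundedCoeff (K : ℝ) (b : Fin n → Fin n → Fin n → Fin n → (Fin n → ℝ) → ℝ) : Prop where
  aestronglyMeasurable : ∀ i j α β, AEStronglyMeasurable (b i j α β) (cubeMeasure n)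
  bound : ∀ i j α β, ∀ᵐ x ∂cubeMeasure n, ‖b i j α β x‖ ≤ K

theorem hE_stress_le {K : ℝ} {b : Fin n → Fin n → Fin n → Fin n → (Fin n → ℝ) → ℝ}
    (hb : BoundedCoeff K b) {u : VecDist n} (hu : MemVecH 1 u) (i α : Fin n) :
    hE 0 (stress b u i α).fourier ≤
      (n * (n * (n * (n * (2 * ENNReal.ofReal (K ^ 2)))))) * ∑ i, hE 1 (u i).fourier := by
  set E := ∑ i, hE 1 (u i).fourier with hEdef
  have hle : ∀ i, hE 1 (u i).fourier ≤ E := fun i =>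
    Finset.single_le_sum (f := fun i => hE 1 (u i).fourier) (fun _ _ => zero_le)
      (Finset.mem_univ i)
  have h1 : ∀ j β, hE 0 (TorusDist.ofFun fun x => b i j α β x * (strain u j β).toFun x).fourier ≤
      ENNReal.ofReal (K ^ 2) * (E + E) := by
    intro j β
    have hs := memH_strain hu j β
    refine (hE_zero_mul_le (hb.1 i j α β) (hb.2 i j α β) (memLp_toFun hs)).trans ?_
    rw [ofFun_toFun hs]
    gcongr
    exact (hE_strain_le u j β).trans (add_le_add (hle _) (hle _))
  have e : (stress b u i α).fourier = fun ξ => ∑ j, ∑ β,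
      (TorusDist.ofFun fun x => b i j α β x * (strain u j β).toFun x).fourier ξ := by
    funext ξ; simp only [stress, fourier_sum]
  rw [e]
  refine (hE_sum_le _ _ _).trans ?_
  rw [Finset.card_univ, Fintype.card_fin]
  calc _ ≤ (n : ℝ≥0∞) * ∑ _j : Fin n, (n : ℝ≥0∞) * ∑ _β : Fin n,
        ENNReal.ofReal (K ^ 2) * (E + E) := by
        gcongr with j
        refine (hE_sum_le _ _ _).trans ?_
        rw [Finset.card_univ, Fintype.card_fin]
        gcongr with β
        exact h1 j β
    _ = _ := by
        simp only [Finset.sum_const, Finset.card_univ, Fintype.card_fin, nsmul_eq_mul]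
        ring

theorem hE_viscDist_le {K : ℝ} {b : Fin n → Fin n → Fin n → Fin n → (Fin n → ℝ) → ℝ}
    (hb : BoundedCoeff K b) {u : VecDist n} (hu : MemVecH 1 u) (k : Fin n) :
    hE (-1) (viscDist b u k).fourier ≤
      (n * (n * 4 * (n * (n * (n * (n * (2 * ENNReal.ofReal (K ^ 2)))))))) *
        ∑ i, hE 1 (u i).fourier := by
  set B := (n * (n * (n * (n * (2 * ENNReal.ofReal (K ^ 2)))))) * ∑ i, hE 1 (u i).fourier with hB
  have h1 : ∀ i, hE (-1) (((1 / 2 : ℝ) • (stress b u i k + stress b u k i)).partialDeriv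
      i).fourier ≤ 4 * B := by
    intro i
    refine (hE_partialDeriv_le _ _ _).trans ?_
    rw [neg_add_cancel]
    have h2 : hE 0 ((1 / 2 : ℝ) • (stress b u i k + stress b u k i)).fourier ≤
        ENNReal.ofReal (1 ^ 2) * hE (0 + 0)
          (fun ξ => (stress b u i k).fourier ξ + (stress b u k i).fourier ξ) :=
      hE_le_of_norm_le fun ξ => by
        rw [fourier_smul, fourier_add, norm_mul, Real.rpow_zero, mul_one]
        gcongr
        simp
        norm_num
    rw [one_pow, ENNReal.ofReal_one, one_mul, zero_add] at h2
    refine h2.trans ((hE_add_le _ _ _).trans ?_)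
    calc _ ≤ 2 * (B + B) := by
          gcongr
          · exact hE_stress_le hb hu i k
          · exact hE_stress_le hb hu k i
      _ = _ := by ring
  have e : hE (-1) (viscDist b u k).fourier = hE (-1) (fun ξ => ∑ i,
      (((1 / 2 : ℝ) • (stress b u i k + stress b u k i)).partialDeriv i).fourier ξ) := by
    simp only [hE, viscDist, fourier_neg_dist, fourier_sum, enorm_neg]
  rw [e]
  refine (hE_sum_le _ _ _).trans ?_
  rw [Finset.card_univ, Fintype.card_fin]
  calc _ ≤ (n : ℝ≥0∞) * ∑ _i : Fin n, 4 * B := by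
        gcongr with i
        exact h1 i
    _ = _ := by
        simp only [Finset.sum_const, Finset.card_univ, Fintype.card_fin, nsmul_eq_mul, hB]
        ring

/-- The strain of a smooth vector field, as a test function. -/
def testStrain (w : Fin n → TestFn n) (i α : Fin n) : TestFn n :=
  (1 / 2 : ℝ) • (TestFn.partialDeriv i (w α) + TestFn.partialDeriv α (w i))

theorem strain_toDist (w : Fin n → TestFn n) (i α : Fin n) :
    strain (fun k => (w k).toDist) i α = (testStrain w i α).toDist := by
  rw [strain, testStrain, toDist_smul, toDist_add, toDist_partialDeriv, toDist_partialDeriv]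

/-- The strain of `w` is symmetrised in its two indices, so reindexing moves the symmetrisation onto
the stress; the definition of the distributional derivative then moves the derivative off `w`.
Bounded coefficients ensure that each stress is a square integrable function, so `ofFun` does not
take its default value. -/
theorem viscForm_toDist {K : ℝ} {a : Tensor n} {t : ℝ}
    (hb : BoundedCoeff K (fun i j α β x => a i j α β x t)) {u : VecDist n} (hu : MemVecH 1 u)
    (w : Fin n → TestFn n) :
    viscForm a t u (fun k => (w k).toDist) =
      vecApply (viscDist (fun i j α β x => a i j α β x t) u) w := by
  set b : Fin n → Fin n → Fin n → Fin n → (Fin n → ℝ) → ℝ := fun i j α β x => a i j α β x t with hbd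
  have h1 : ∀ i j α β, ∫ x in cube n, a i j α β x t * (strain u j β).toFun x *
      (strain (fun k => (w k).toDist) i α).toFun x =
      (TorusDist.ofFun fun x => b i j α β x * (strain u j β).toFun x).1 (testStrain w i α) := by
    intro i j α β
    have hm := memLp_mul_bounded (hb.1 i j α β) (hb.2 i j α β) (memLp_toFun (memH_strain hu j β))
    rw [ofFun_apply (MemLp.integrableOn_cube hm), strain_toDist]
    refine integral_congr_ae ?_
    filter_upwards [toFun_ofFun (testStrain w i α).integrableOn] with x hx
    rw [← hx]
    rfl
  have h2 : viscForm a t u (fun k => (w k).toDist) =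
      ∑ i, ∑ α, (stress b u i α).1 (testStrain w i α) := by
    simp only [viscForm, h1]
    refine Finset.sum_congr rfl fun i _ => ?_
    rw [Finset.sum_comm]
    refine Finset.sum_congr rfl fun α _ => ?_
    simp [stress]
  have h3 : ∀ (g : TorusDist n) i α, g.1 (testStrain w i α) =
      (1 / 2) * g.1 (TestFn.partialDeriv i (w α)) + (1 / 2) * g.1 (TestFn.partialDeriv α (w i)) := by
    intro g i α
    rw [testStrain, map_smul, map_add, smul_eq_mul]; ring
  have h4 : ∀ k, (viscDist b u k).1 (w k) = ∑ i, ((1 / 2) * (stress b u i k).1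
      (TestFn.partialDeriv i (w k)) + (1 / 2) * (stress b u k i).1 (TestFn.partialDeriv i (w k))) := by
    intro k
    have h5 : ∀ g : TorusDist n, ∀ i, (g.partialDeriv i).1 (w k) =
        -g.1 (TestFn.partialDeriv i (w k)) := fun g i => rfl
    simp only [viscDist, Submodule.coe_neg, LinearMap.neg_apply, Submodule.coe_sum,
      LinearMap.coe_sum, Finset.sum_apply, h5, Finset.sum_neg_distrib, neg_neg]
    refine Finset.sum_congr rfl fun i _ => ?_
    change (1 / 2) * ((stress b u i k).1 _ + (stress b u k i).1 _) = _
    ring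
  rw [h2]
  simp only [h3, vecApply, h4, Finset.sum_add_distrib]
  rw [Finset.sum_comm]

theorem viscDist_fourier_zero (b : Fin n → Fin n → Fin n → Fin n → (Fin n → ℝ) → ℝ) (u : VecDist n)
    (k : Fin n) : (viscDist b u k).fourier 0 = 0 := by
  simp [viscDist, fourier_neg_dist, fourier_sum, fourier_partialDeriv]

theorem convection_fourier_zero {u : VecDist n} (hu : MemVecH 1 u) (hdiv : divergence u = 0)
    (k : Fin n) : (convection u k).fourier 0 = 0 := by
  simp [convection_eq hu hdiv k, fourier_sum, fourier_partialDeriv]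

/-! ## Testing with divergence free fields -/

/-- `I - ξ ⊗ ξ / |ξ|²`. -/
def projVec (ξ : Fin n → ℤ) (k i : Fin n) : ℝ :=
  (if i = k then 1 else 0) - (ξ k : ℝ) * (ξ i : ℝ) / freqSq ξ

theorem sum_projVec_mul {ξ : Fin n → ℤ} (hξ : ξ ≠ 0) (k : Fin n) (X : Fin n → ℂ) :
    ∑ i, (projVec ξ k i : ℂ) * X i = lerayCoeff ξ X k := by
  rw [lerayCoeff, if_neg hξ]
  simp only [projVec, Complex.ofReal_sub, sub_mul, Finset.sum_sub_distrib]
  congr 1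
  · simp [apply_ite]
  · rw [Finset.mul_sum, Finset.sum_div]
    refine Finset.sum_congr rfl fun i _ => ?_
    push_cast; ring

theorem sum_coord_mul_projVec {ξ : Fin n → ℤ} (hξ : ξ ≠ 0) (k : Fin n) :
    ∑ i, (ξ i : ℂ) * (projVec ξ k i : ℂ) = 0 := by
  have hq : ((freqSq ξ : ℝ) : ℂ) ≠ 0 := by exact_mod_cast (freqSq_pos hξ).ne'
  simp only [mul_comm (Int.cast _ : ℂ)]
  rw [sum_projVec_mul hξ, lerayCoeff, if_neg hξ]
  have h2 : ∑ k, (ξ k : ℂ) * (ξ k : ℂ) = ((freqSq ξ : ℝ) : ℂ) := by simp [freqSq, sq]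
  rw [h2, mul_div_cancel_right₀ _ hq, sub_self]

/-- The constant vector is a column of the projection orthogonal to `ξ`, and `φ` only has the
frequencies `±ξ`, both nonzero. Hence the field is divergence free and has zero mean. -/
theorem memHdotSigma_smul {ξ : Fin n → ℤ} (hξ : ξ ≠ 0) {φ : TestFn n}
    (hφ : ∀ ζ, ζ ≠ ξ → ζ ≠ -ξ → φ.toDist.fourier ζ = 0) (k : Fin n) :
    MemHdotSigma 1 (fun i => (projVec ξ k i • φ).toDist) := by
  refine ⟨⟨fun i => memH_toDist _ _, fun i => ?_⟩, fourier_injective fun ζ => ?_⟩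
  · beta_reduce
    rw [MeanZero, toDist_smul, fourier_smul, hφ 0 hξ.symm (neg_ne_zero.mpr hξ).symm, mul_zero]
  · rw [fourier_divergence, fourier_zero_dist]
    simp only [toDist_smul, fourier_smul]
    have h0 := sum_coord_mul_projVec hξ k
    have h1 : ∑ i, (ζ i : ℂ) * ((projVec ξ k i : ℂ) * φ.toDist.fourier ζ) =
        (∑ i, (ζ i : ℂ) * (projVec ξ k i : ℂ)) * φ.toDist.fourier ζ := by
      rw [Finset.sum_mul]
      exact Finset.sum_congr rfl fun i _ => by ring
    rw [h1]
    by_cases h2 : ζ = ξ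
    · rw [h2, h0]; simp
    by_cases h3 : ζ = -ξ
    · have h4 : ∑ i, (ζ i : ℂ) * (projVec ξ k i : ℂ) = 0 := by
        simp [h3, h0]
      rw [h4]; simp
    · rw [hφ ζ h2 h3]; simp

theorem vecDual_toDist (G : VecDist n) (w : Fin n → TestFn n) :
    vecDual G (fun k => (w k).toDist) = vecApply G w := by
  simp [vecDual, vecApply, dual_toDist]

/-- A divergence free distribution that agrees with `R` on smooth divergence free fields is the
Leray projection of `R`. -/
theorem fourier_eq_lerayCoeff {G R : VecDist n}
    (h : ∀ w : Fin n → TestFn n, MemHdotSigma 1 (fun k => (w k).toDist) →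
      vecApply G w = vecApply R w)
    (hmean : ∀ k, (G k).fourier 0 = 0) (hdiv : ∀ ξ : Fin n → ℤ, ∑ k, (ξ k : ℂ) * (G k).fourier ξ = 0)
    (k : Fin n) (ξ : Fin n → ℤ) :
    (G k).fourier ξ = lerayCoeff ξ (fun j => (R j).fourier ξ) k := by
  by_cases hξ : ξ = 0
  · rw [hξ, hmean, lerayCoeff, if_pos rfl]
  -- The cosine field yields the real part and the sine field the imaginary part of the `k`-th
  -- component of the projected coefficient, for `G` and for `R` alike. On `G` the projection acts
  -- as the identity.
  have hcos := h (fun i => projVec ξ k i • cosFn ξ) (memHdotSigma_smul hξ (fun ζ h1 h2 => by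
    simp [fourier_toDist_cosFn, h1, h2]) k)
  have hsin := h (fun i => projVec ξ k i • sinFn ξ) (memHdotSigma_smul hξ (fun ζ h1 h2 => by
    simp [fourier_toDist_sinFn, h1, h2]) k)
  simp only [vecApply, map_smul, smul_eq_mul] at hcos hsin
  have h1 : ∑ i, (projVec ξ k i : ℂ) * (G i).fourier ξ =
      ∑ i, (projVec ξ k i : ℂ) * (R i).fourier ξ := by
    have e : ∀ F : VecDist n, ∑ i, (projVec ξ k i : ℂ) * (F i).fourier ξ =
        ((∑ i, projVec ξ k i * (F i).1 (cosFn ξ) : ℝ) : ℂ) -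
          Complex.I * ((∑ i, projVec ξ k i * (F i).1 (sinFn ξ) : ℝ) : ℂ) := by
      intro F
      push_cast
      rw [Finset.mul_sum, ← Finset.sum_sub_distrib]
      refine Finset.sum_congr rfl fun i _ => ?_
      rw [TorusDist.fourier]; ring
    rw [e, e, hcos, hsin]
  rw [sum_projVec_mul hξ, sum_projVec_mul hξ] at h1
  rw [← h1, lerayCoeff, if_neg hξ, hdiv]
  simp

/-! ## Measurability in time -/

instance isFiniteMeasure_timeMeasure (T : ℝ) : IsFiniteMeasure (timeMeasure T) := by
  unfold timeMeasure; infer_instance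

/-- All Fourier coefficients of `g(t)` are measurable functions of `t ∈ (0,T)`. -/
def FourierMeasurable (T : ℝ) (g : ℝ → TorusDist n) : Prop :=
  ∀ ξ, AEStronglyMeasurable (fun t => (g t).fourier ξ) (timeMeasure T)

namespace FourierMeasurable

variable {T : ℝ} {g h : ℝ → TorusDist n}

theorem congr (hg : FourierMeasurable T g) (hgh : ∀ᵐ t ∂timeMeasure T, g t = h t) :
    FourierMeasurable T h := fun ξ =>
  (hg ξ).congr (by filter_upwards [hgh] with t ht; rw [ht])

theorem add (hg : FourierMeasurable T g) (hh : FourierMeasurable T h) :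
    FourierMeasurable T fun t => g t + h t := fun ξ => by
  simp only [fourier_add]; exact (hg ξ).add (hh ξ)

theorem neg (hg : FourierMeasurable T g) : FourierMeasurable T fun t => -g t := fun ξ => by
  simp only [fourier_neg_dist]; exact (hg ξ).neg

theorem sub (hg : FourierMeasurable T g) (hh : FourierMeasurable T h) :
    FourierMeasurable T fun t => g t - h t := fun ξ => by
  simp only [fourier_sub]; exact (hg ξ).sub (hh ξ)

theorem smul (hg : FourierMeasurable T g) (c : ℝ) : FourierMeasurable T fun t => c • g t :=
  fun ξ => by simpa only [fourier_smul] using (hg ξ).const_mul (c : ℂ)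

theorem partialDeriv (hg : FourierMeasurable T g) (j : Fin n) :
    FourierMeasurable T fun t => (g t).partialDeriv j := fun ξ => by
  simpa only [fourier_partialDeriv] using (hg ξ).const_mul (2 * Real.pi * Complex.I * (ξ j : ℂ))

theorem sum {ι : Type*} (s : Finset ι) {g : ι → ℝ → TorusDist n}
    (hg : ∀ i, FourierMeasurable T (g i)) : FourierMeasurable T fun t => ∑ i ∈ s, g i t :=
  fun ξ => by
    simpa only [fourier_sum] using Finset.aestronglyMeasurable_fun_sum s fun i _ => hg i ξ

/-- Coefficients of products are limits of finite convolution sums, so measurability in time passes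
from the factors to the product. -/
theorem of_hasSum {c d : ℝ → (Fin n → ℤ) → ℂ}
    (hc : ∀ ξ, AEStronglyMeasurable (fun t => c t ξ) (timeMeasure T))
    (hd : ∀ ξ, AEStronglyMeasurable (fun t => d t ξ) (timeMeasure T))
    (H : ∀ᵐ t ∂timeMeasure T, ∀ ξ, HasSum (fun η => c t (ξ - η) * d t η) ((g t).fourier ξ)) :
    FourierMeasurable T g := fun ξ => by
  refine aestronglyMeasurable_of_tendsto_ae (atTop : Filter (Finset (Fin n → ℤ)))
    (f := fun S t => ∑ η ∈ S, c t (ξ - η) * d t η) (fun S => ?_) ?_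
  · exact Finset.aestronglyMeasurable_fun_sum S fun η _ => (hc _).mul (hd _)
  · filter_upwards [H] with t ht using ht ξ

theorem leray {F : ℝ → VecDist n} (hF : ∀ k, FourierMeasurable T fun t => F t k) (k : Fin n) :
    FourierMeasurable T fun t => PeriodicNS.leray (F t) k := fun ξ => by
  simp only [fourier_leray, lerayCoeff]
  by_cases h : ξ = 0
  · simpa only [if_pos h] using aestronglyMeasurable_const
  · simp only [if_neg h, div_eq_mul_inv]
    exact (hF k ξ).sub (((Finset.aestronglyMeasurable_fun_sum _ fun j _ =>
      (hF j ξ).const_mul _).const_mul _).mul_const _)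

end FourierMeasurable

/-- A bounded function of `(x,t)`: its slices are bounded and measurable, and their Fourier
coefficients are measurable in `t`. -/
theorem slice_of_memLp_top {T : ℝ} {b : (Fin n → ℝ) × ℝ → ℝ}
    (hb : MemLp b ∞ (volume.restrict (Set.univ ×ˢ Set.Ioo 0 T))) :
    (∀ᵐ t ∂timeMeasure T, AEStronglyMeasurable (fun x => b (x, t)) (cubeMeasure n)) ∧
      (∀ᵐ t ∂timeMeasure T, ∀ᵐ x ∂cubeMeasure n,
        ‖b (x, t)‖ ≤ (eLpNorm b ∞ (volume.restrict (Set.univ ×ˢ Set.Ioo 0 T))).toReal) ∧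
      FourierMeasurable T fun t => TorusDist.ofFun fun x => b (x, t) := by
  set K := eLpNorm b ∞ (volume.restrict (Set.univ ×ˢ Set.Ioo 0 T)) with hK
  -- The hypothesis lives on `ℝⁿ × (0,T)`; restricting it to one cell makes the space finite, so
  -- Fubini's theorem gives information about almost every time slice.
  have hle : (cubeMeasure n).prod (timeMeasure T) ≤
      volume.restrict (Set.univ ×ˢ Set.Ioo (0 : ℝ) T) := by
    rw [cubeMeasure, timeMeasure, Measure.prod_restrict, ← Measure.volume_eq_prod]
    exact Measure.restrict_mono (Set.prod_mono (Set.subset_univ _) le_rfl) le_rfl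
  have h1 : AEStronglyMeasurable b ((cubeMeasure n).prod (timeMeasure T)) := hb.1.mono_measure hle
  have h2 : ∀ᵐ z ∂(cubeMeasure n).prod (timeMeasure T), ‖b z‖ ≤ K.toReal := by
    have h3 : ∀ᵐ z ∂(volume.restrict (Set.univ ×ˢ Set.Ioo (0 : ℝ) T)), ‖b z‖ₑ ≤ K := by
      rw [hK, eLpNorm_exponent_top]; exact ae_le_eLpNormEssSup
    filter_upwards [Measure.absolutelyContinuous_of_le hle h3] with z hz
    rw [← toReal_enorm]
    exact ENNReal.toReal_mono hb.2.ne hz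
  have hs : AEStronglyMeasurable (fun z : ℝ × (Fin n → ℝ) => b z.swap)
      ((timeMeasure T).prod (cubeMeasure n)) := h1.prod_swap
  have h4 : ∀ᵐ t ∂timeMeasure T, AEStronglyMeasurable (fun x => b (x, t)) (cubeMeasure n) :=
    hs.prodMk_left
  have h5 : ∀ᵐ t ∂timeMeasure T, ∀ᵐ x ∂cubeMeasure n, ‖b (x, t)‖ ≤ K.toReal := by
    have h6 : ∀ᵐ z ∂(timeMeasure T).prod (cubeMeasure n), ‖b z.swap‖ ≤ K.toReal :=
      (Measure.measurePreserving_swap (μ := timeMeasure T)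
        (ν := cubeMeasure n)).quasiMeasurePreserving.ae h2
    exact Measure.ae_ae_of_ae_prod h6
  refine ⟨h4, h5, fun ξ => ?_⟩
  have h7 : AEStronglyMeasurable (fun z : ℝ × (Fin n → ℝ) => expFn (-ξ) z.2 * ((b z.swap : ℝ) : ℂ))
      ((timeMeasure T).prod (cubeMeasure n)) :=
    ((continuous_expFn (-ξ)).comp continuous_snd).aestronglyMeasurable.mul
      (Complex.continuous_ofReal.comp_aestronglyMeasurable hs)
  refine h7.integral_prod_right'.congr ?_
  filter_upwards [h4, h5] with t ht1 ht2
  have hi : Integrable (fun x => b (x, t)) (cubeMeasure n) := Integrable.of_bound ht1 _ ht2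
  exact (fourier_ofFun hi ξ).symm

theorem IsViscosity.exists_boundedCoeff {T : ℝ} {a : Tensor n} (ha : IsViscosity T a) :
    ∃ K : ℝ, ∀ᵐ t ∂timeMeasure T, BoundedCoeff K fun i j α β x => a i j α β x t := by
  set κ : Fin n → Fin n → Fin n → Fin n → ℝ := fun i j α β =>
    (eLpNorm (fun z : (Fin n → ℝ) × ℝ => a i j α β z.1 z.2) ∞
      (volume.restrict (Set.univ ×ˢ Set.Ioo 0 T))).toReal with hκ
  have hle : ∀ i j α β, κ i j α β ≤ ∑ i, ∑ j, ∑ α, ∑ β, κ i j α β := by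
    intro i j α β
    have h0 : ∀ i j α β, 0 ≤ κ i j α β := fun i j α β => ENNReal.toReal_nonneg
    calc κ i j α β ≤ ∑ β, κ i j α β :=
          Finset.single_le_sum (f := fun β => κ i j α β) (fun β _ => h0 _ _ _ _) (Finset.mem_univ β)
      _ ≤ ∑ α, ∑ β, κ i j α β :=
          Finset.single_le_sum (f := fun α => ∑ β, κ i j α β)
            (fun α _ => Finset.sum_nonneg fun β _ => h0 _ _ _ _) (Finset.mem_univ α)
      _ ≤ ∑ j, ∑ α, ∑ β, κ i j α β :=
          Finset.single_le_sum (f := fun j => ∑ α, ∑ β, κ i j α β)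
            (fun j _ => Finset.sum_nonneg fun α _ => Finset.sum_nonneg fun β _ => h0 _ _ _ _)
            (Finset.mem_univ j)
      _ ≤ _ :=
          Finset.single_le_sum (f := fun i => ∑ j, ∑ α, ∑ β, κ i j α β)
            (fun i _ => Finset.sum_nonneg fun j _ => Finset.sum_nonneg fun α _ =>
              Finset.sum_nonneg fun β _ => h0 _ _ _ _) (Finset.mem_univ i)
  refine ⟨∑ i, ∑ j, ∑ α, ∑ β, κ i j α β, ?_⟩
  have h1 : ∀ᵐ t ∂timeMeasure T, ∀ i j α β,
      AEStronglyMeasurable (a i j α β · t) (cubeMeasure n) := by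
    simp only [ae_all_iff]
    exact fun i j α β => (slice_of_memLp_top (ha.bounded i j α β)).1
  have h2 : ∀ᵐ t ∂timeMeasure T, ∀ i j α β, ∀ᵐ x ∂cubeMeasure n,
      ‖a i j α β x t‖ ≤ κ i j α β := by
    simp only [ae_all_iff]
    exact fun i j α β => (slice_of_memLp_top (ha.bounded i j α β)).2.1
  filter_upwards [h1, h2] with t ht1 ht2
  refine ⟨ht1, fun i j α β => ?_⟩
  filter_upwards [ht2 i j α β] with x hx using hx.trans (hle i j α β)

theorem FourierMeasurable.strain {T : ℝ} {u : ℝ → VecDist n}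
    (hu : ∀ k, FourierMeasurable T fun t => u t k) (j β : Fin n) :
    FourierMeasurable T fun t => PeriodicNS.strain (u t) j β :=
  (((hu β).partialDeriv j).add ((hu j).partialDeriv β)).smul _

theorem FourierMeasurable.viscDist {T : ℝ} {a : Tensor n} (ha : IsViscosity T a)
    {u : ℝ → VecDist n} (hu : ∀ k, FourierMeasurable T fun t => u t k)
    (hu1 : ∀ᵐ t ∂timeMeasure T, MemVecH 1 (u t)) (k : Fin n) :
    FourierMeasurable T fun t => PeriodicNS.viscDist (fun i j α β x => a i j α β x t) (u t) k := by
  obtain ⟨K, hK⟩ := ha.exists_boundedCoeff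
  have hstress : ∀ i α, FourierMeasurable T fun t =>
      stress (fun i j α β x => a i j α β x t) (u t) i α := by
    intro i α
    refine FourierMeasurable.sum _ fun j => FourierMeasurable.sum _ fun β => ?_
    refine FourierMeasurable.of_hasSum
      (c := fun t => (TorusDist.ofFun fun x => a i j α β x t).fourier)
      (d := fun t => (PeriodicNS.strain (u t) j β).fourier)
      (slice_of_memLp_top (ha.bounded i j α β)).2.2 (FourierMeasurable.strain hu j β) ?_
    filter_upwards [hK, hu1] with t ht1 ht2 ξ
    have hs := memH_strain ht2 j β
    have h := hasSum_fourier_mul (f := fun x => a i j α β x t)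
      (MemLp.of_bound (ht1.1 i j α β) K (ht1.2 i j α β)) (memLp_toFun hs) ξ
    rwa [ofFun_toFun hs] at h
  exact (FourierMeasurable.sum _ fun i =>
    (((hstress i k).add (hstress k i)).smul _).partialDeriv i).neg

theorem FourierMeasurable.convection {T : ℝ} {u : ℝ → VecDist n}
    (hu : ∀ k, FourierMeasurable T fun t => u t k)
    (hu1 : ∀ᵐ t ∂timeMeasure T, MemVecH 1 (u t)) (hdiv : ∀ᵐ t ∂timeMeasure T, divergence (u t) = 0)
    (k : Fin n) : FourierMeasurable T fun t => PeriodicNS.convection (u t) k := by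
  have h : FourierMeasurable T fun t => ∑ j, (distMul (u t j) (u t k)).partialDeriv j := by
    refine FourierMeasurable.sum _ fun j => FourierMeasurable.partialDeriv ?_ j
    refine FourierMeasurable.of_hasSum (c := fun t => (u t j).fourier)
      (d := fun t => (u t k).fourier) (hu j) (hu k) ?_
    filter_upwards [hu1] with t ht ξ
    exact hasSum_fourier_distMul (memH_mono zero_le_one (ht j)) (memH_mono zero_le_one (ht k)) ξ
  refine h.congr ?_
  filter_upwards [hu1, hdiv] with t ht1 ht2
  exact (convection_eq ht1 ht2 k).symm

/-! ## Square integrability in time -/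

theorem memLqH_two_iff {T s : ℝ} {g : ℝ → TorusDist n} :
    MemLqH 2 T s g ↔ FourierMeasurable T g ∧ ∫⁻ t, hE s (g t).fourier ∂timeMeasure T ≠ ⊤ :=
  ⟨fun h => ⟨h.aestronglyMeasurable_fourier, h.lintegral_ne_top⟩, fun h => memLqH_two_of h.1 h.2⟩

theorem memLqH_two_of_le {T s : ℝ} {g : ℝ → TorusDist n} (hg : FourierMeasurable T g)
    {h : ℝ → ℝ≥0∞} (hle : ∀ᵐ t ∂timeMeasure T, hE s (g t).fourier ≤ h t)
    (hh : ∫⁻ t, h t ∂timeMeasure T ≠ ⊤) : MemLqH 2 T s g :=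
  memLqH_two_of hg (ne_top_of_le_ne_top hh (lintegral_mono_ae hle))

theorem MemLqH.ae_memH {T s : ℝ} {g : ℝ → TorusDist n} (h : MemLqH 2 T s g) :
    ∀ᵐ t ∂timeMeasure T, MemH s (g t) := by
  obtain ⟨h1, h2⟩ := memLqH_two_iff.mp h
  filter_upwards [ae_lt_top' (measurable_hE h1) h2] with t ht
  exact (memH_iff _ _).mpr ht.ne

theorem lintegral_mul_sum_hE_ne_top {T s : ℝ} {F : ℝ → VecDist n}
    (h : ∀ k, MemLqH 2 T s fun t => F t k) {C : ℝ≥0∞} (hC : C ≠ ⊤) :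
    ∫⁻ t, C * ∑ i, hE s (F t i).fourier ∂timeMeasure T ≠ ⊤ := by
  rw [lintegral_const_mul' _ _ hC,
    lintegral_finsetSum' _ fun i _ => measurable_hE (h i).aestronglyMeasurable_fourier]
  exact ENNReal.mul_ne_top hC (ENNReal.sum_ne_top.mpr fun i _ => (h i).lintegral_ne_top)

theorem MemLqH.mono_exp {T s r : ℝ} (hsr : s ≤ r) {g : ℝ → TorusDist n} (h : MemLqH 2 T r g) :
    MemLqH 2 T s g :=
  memLqH_two_of_le h.aestronglyMeasurable_fourier
    (Eventually.of_forall fun _ => hE_mono_exp hsr _) h.lintegral_ne_top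

theorem MemLqH.sub {T s : ℝ} {g h : ℝ → TorusDist n} (hg : MemLqH 2 T s g) (hh : MemLqH 2 T s h) :
    MemLqH 2 T s fun t => g t - h t := by
  have hgm : FourierMeasurable T g := hg.aestronglyMeasurable_fourier
  refine memLqH_two_of_le (hgm.sub hh.aestronglyMeasurable_fourier)
    (h := fun t => 2 * (hE s (g t).fourier + hE s (h t).fourier))
    (Eventually.of_forall fun t => ?_) ?_
  · have e : (g t - h t).fourier = fun ξ => (g t).fourier ξ - (h t).fourier ξ :=
      funext fun ξ => fourier_sub _ _ ξ
    rw [e]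
    exact hE_sub_le _ _ _
  · rw [lintegral_const_mul' _ _ (by simp), lintegral_add_left' (measurable_hE hgm)]
    exact ENNReal.mul_ne_top (by simp)
      (ENNReal.add_ne_top.mpr ⟨hg.lintegral_ne_top, hh.lintegral_ne_top⟩)

theorem hE_leray_le (s : ℝ) (F : VecDist n) (k : Fin n) :
    hE s (leray F k).fourier ≤ 4 * n * ∑ j, hE s (F j).fourier := by
  have e : (leray F k).fourier = fun ξ => lerayCoeff ξ (fun j => (F j).fourier ξ) k :=
    funext fun ξ => fourier_leray F k ξ
  rw [e, mul_assoc]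
  exact hE_lerayCoeff_le s (fun j => (F j).fourier) k

theorem MemLqH.leray {T s : ℝ} {F : ℝ → VecDist n} (h : ∀ k, MemLqH 2 T s fun t => F t k)
    (k : Fin n) : MemLqH 2 T s fun t => PeriodicNS.leray (F t) k :=
  memLqH_two_of_le (FourierMeasurable.leray (fun k => (h k).aestronglyMeasurable_fourier) k)
    (Eventually.of_forall fun t => hE_leray_le s (F t) k)
    (lintegral_mul_sum_hE_ne_top h (ENNReal.mul_ne_top (by simp) (by simp)))

theorem leray_fourier_zero (F : VecDist n) (k : Fin n) : (leray F k).fourier 0 = 0 := by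
  rw [fourier_leray, lerayCoeff, if_pos rfl]

theorem sum_coord_mul_fourier_eq_zero {G : VecDist n} (h : divergence G = 0) (ξ : Fin n → ℤ) :
    ∑ k, (ξ k : ℂ) * (G k).fourier ξ = 0 := by
  have h1 := fourier_divergence G ξ
  rw [h, fourier_zero_dist] at h1
  have hpi : (2 * Real.pi * Complex.I : ℂ) ≠ 0 := by simp [Real.pi_ne_zero]
  exact (mul_eq_zero.mp h1.symm).resolve_left hpi

theorem divergence_eq_zero {G : VecDist n}
    (h : ∀ ξ : Fin n → ℤ, ∑ k, (ξ k : ℂ) * (G k).fourier ξ = 0) : divergence G = 0 :=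
  fourier_injective fun ξ => by rw [fourier_divergence, h, fourier_zero_dist, mul_zero]

/-! ## The time derivative -/

section TimeDeriv

variable {T : ℝ} {u u' : ℝ → VecDist n}

theorem vecApply_single (G : VecDist n) (k : Fin n) (φ : TestFn n) :
    vecApply G (Pi.single k φ) = (G k).1 φ := by
  rw [vecApply, Finset.sum_eq_single k]
  · simp
  · intro j _ hj
    simp [Pi.single_eq_of_ne hj]
  · simp

theorem IsTimeDeriv.apply (h : IsTimeDeriv T u u') (k : Fin n) (φ : TestFn n) :
    HasDistribDeriv T (fun t => (u t k).1 φ) fun t => (u' t k).1 φ := by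
  simpa only [vecApply_single] using h (Pi.single k φ)

theorem IsTimeDeriv.re (h : IsTimeDeriv T u u') (k : Fin n) (ξ : Fin n → ℤ) :
    HasDistribDeriv T (fun t => ((u t k).fourier ξ).re) fun t => ((u' t k).fourier ξ).re := by
  simpa only [fourier_re] using h.apply k (cosFn ξ)

theorem IsTimeDeriv.im (h : IsTimeDeriv T u u') (k : Fin n) (ξ : Fin n → ℤ) :
    HasDistribDeriv T (fun t => ((u t k).fourier ξ).im) fun t => ((u' t k).fourier ξ).im := by
  simpa only [fourier_im, neg_one_mul] using (h.apply k (sinFn ξ)).const_mul (-1)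

/-- The zeroth coefficient of `u` vanishes almost everywhere, and so does its distributional
derivative: zero mean of `u'` is a consequence of the equation being understood in the sense of
distributions in time. -/
theorem IsTimeDeriv.ae_meanZero (h : IsTimeDeriv T u u') (k : Fin n)
    (hu : ∀ᵐ t ∂timeMeasure T, (u t k).fourier 0 = 0) :
    ∀ᵐ t ∂timeMeasure T, (u' t k).fourier 0 = 0 := by
  have h1 := ((h.re k 0).congr (g' := fun _ => 0)
    (by filter_upwards [hu] with t ht; simp [ht]) (Eventually.of_forall fun _ => rfl)).ae_eq_zero
  have h2 := ((h.im k 0).congr (g' := fun _ => 0)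
    (by filter_upwards [hu] with t ht; simp [ht]) (Eventually.of_forall fun _ => rfl)).ae_eq_zero
  filter_upwards [h1, h2] with t ht1 ht2 using Complex.ext ht1 ht2

/-- At each frequency `ξ·û(ξ) = 0` is a linear relation between coefficients, hence is inherited by
`u'`; countability of the lattice gives one null set for all frequencies. -/
theorem IsTimeDeriv.ae_divergence (hT : 0 < T) (h : IsTimeDeriv T u u')
    (hu : ∀ᵐ t ∂timeMeasure T, divergence (u t) = 0) :
    ∀ᵐ t ∂timeMeasure T, divergence (u' t) = 0 := by
  have hre : ∀ (G : VecDist n) (ξ : Fin n → ℤ), (∑ k, (ξ k : ℂ) * (G k).fourier ξ).re =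
      ∑ k, (ξ k : ℝ) * ((G k).fourier ξ).re := fun G ξ => by simp
  have him : ∀ (G : VecDist n) (ξ : Fin n → ℤ), (∑ k, (ξ k : ℂ) * (G k).fourier ξ).im =
      ∑ k, (ξ k : ℝ) * ((G k).fourier ξ).im := fun G ξ => by simp
  have h1 : ∀ᵐ t ∂timeMeasure T, ∀ ξ : Fin n → ℤ, ∑ k, (ξ k : ℝ) * ((u' t k).fourier ξ).re = 0 := by
    rw [ae_all_iff]
    intro ξ
    refine ((HasDistribDeriv.sum hT Finset.univ fun k =>
      (h.re k ξ).const_mul (ξ k : ℝ)).congr (g' := fun _ => 0) ?_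
      (Eventually.of_forall fun _ => rfl)).ae_eq_zero
    filter_upwards [hu] with t ht
    rw [← hre, sum_coord_mul_fourier_eq_zero ht, Complex.zero_re]
  have h2 : ∀ᵐ t ∂timeMeasure T, ∀ ξ : Fin n → ℤ, ∑ k, (ξ k : ℝ) * ((u' t k).fourier ξ).im = 0 := by
    rw [ae_all_iff]
    intro ξ
    refine ((HasDistribDeriv.sum hT Finset.univ fun k =>
      (h.im k ξ).const_mul (ξ k : ℝ)).congr (g' := fun _ => 0) ?_
      (Eventually.of_forall fun _ => rfl)).ae_eq_zero
    filter_upwards [hu] with t ht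
    rw [← him, sum_coord_mul_fourier_eq_zero ht, Complex.zero_im]
  filter_upwards [h1, h2] with t ht1 ht2
  refine divergence_eq_zero fun ξ => Complex.ext ?_ ?_
  · rw [hre, ht1]; rfl
  · rw [him, ht2]; rfl

end TimeDeriv

/-! ## Regularity of the terms of the equation -/

section Regularity

variable {T : ℝ} {a : Tensor n} {f u u' : ℝ → VecDist n}

theorem memLqH_convection (hn : 2 ≤ n) (hu_inf : MemLqHdotSigma ∞ T 0 u)
    (hu_two : MemLqHdotSigma 2 T 1 u) (k : Fin n) :
    MemLqH 2 T (-(n : ℝ) / 2) fun t => convection (u t) k := by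
  obtain ⟨C, hC, h⟩ := exists_hE_convection_le hn
  choose M hM hMle using fun k => (hu_inf.1 k).exists_ae_le
  have hM' : ∀ᵐ t ∂timeMeasure T, ∀ k, hE 0 (u t k).fourier ≤ ∑ k, M k := by
    rw [ae_all_iff]
    intro k
    filter_upwards [hMle k] with t ht
    exact ht.trans (Finset.single_le_sum (f := M) (fun _ _ => zero_le) (Finset.mem_univ k))
  refine memLqH_two_of_le (FourierMeasurable.convection
    (fun k => (hu_two.1 k).aestronglyMeasurable_fourier)
    (by filter_upwards [hu_two.2] with t ht using ht.1.1)
    (by filter_upwards [hu_two.2] with t ht using ht.2) k)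
    (h := fun t => (C * ∑ k, M k) * ∑ i, hE 1 (u t i).fourier) ?_
    (lintegral_mul_sum_hE_ne_top hu_two.1
      (ENNReal.mul_ne_top hC (ENNReal.sum_ne_top.mpr fun i _ => hM i)))
  filter_upwards [hM', hu_two.2] with t ht1 ht2
  rw [mul_assoc]
  exact h (u t) _ ht2.1.1 ht2.2 ht1 k

theorem memLqH_viscDist (ha : IsViscosity T a) (hu_two : MemLqHdotSigma 2 T 1 u) (k : Fin n) :
    MemLqH 2 T (-1) fun t => viscDist (fun i j α β x => a i j α β x t) (u t) k := by
  obtain ⟨K, hK⟩ := ha.exists_boundedCoeff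
  have hu1 : ∀ᵐ t ∂timeMeasure T, MemVecH 1 (u t) := by
    filter_upwards [hu_two.2] with t ht using ht.1.1
  refine memLqH_two_of_le (FourierMeasurable.viscDist ha
    (fun k => (hu_two.1 k).aestronglyMeasurable_fourier) hu1 k)
    (h := fun t => (n * (n * 4 * (n * (n * (n * (n * (2 * ENNReal.ofReal (K ^ 2)))))))) *
        ∑ i, hE 1 (u t i).fourier) ?_ (lintegral_mul_sum_hE_ne_top hu_two.1 (by finiteness))
  filter_upwards [hK, hu1] with t ht1 ht2 using hE_viscDist_le ht1 ht2 k

/-- The right-hand side `f - A u` of the equation. -/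
def forcing (a : Tensor n) (f u : ℝ → VecDist n) (t : ℝ) : VecDist n :=
  f t - viscDist (fun i j α β x => a i j α β x t) (u t)

theorem memLqH_forcing (ha : IsViscosity T a) (hf : MemLqVecHdot 2 T (-1) f)
    (hu_two : MemLqHdotSigma 2 T 1 u) (k : Fin n) : MemLqH 2 T (-1) fun t => forcing a f u t k :=
  (hf.1 k).sub (memLqH_viscDist ha hu_two k)

/-- `u' + ℙ_σ[(u·∇)u] = ℙ_σ(f - A u)`. -/
theorem SolvesWeakEquation.ae_eq_leray (hT : 0 < T) (ha : IsViscosity T a)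
    (hu_two : MemLqHdotSigma 2 T 1 u) (hu : SolvesWeakEquation T a f u u') :
    ∀ᵐ t ∂timeMeasure T, u' t + leray (convection (u t)) = leray (forcing a f u t) := by
  obtain ⟨K, hK⟩ := ha.exists_boundedCoeff
  have hmean : ∀ᵐ t ∂timeMeasure T, ∀ k, (u' t k).fourier 0 = 0 := by
    rw [ae_all_iff]
    exact fun k => hu.timeDeriv.ae_meanZero k
      (by filter_upwards [hu_two.2] with t ht using ht.1.2 k)
  have hdiv := hu.timeDeriv.ae_divergence hT (by filter_upwards [hu_two.2] with t ht using ht.2)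
  filter_upwards [hK, hu_two.2, hmean, hdiv, hu.equation] with t ht1 ht2 ht3 ht4 ht5
  funext k
  refine fourier_injective fun ξ => ?_
  rw [fourier_leray]
  -- Smooth fields suffice as tests because the left-hand side is already solenoidal with zero mean:
  -- `u'` inherits this from `u`, and the projection has it by construction.
  refine fourier_eq_lerayCoeff (fun w hw => ?_) (fun k => ?_) (fun ξ => ?_) k ξ
  · have h1 := ht5 _ hw
    rw [vecDual_toDist, vecDual_toDist, viscForm_toDist ht1 ht2.1.1] at h1
    have h2 : vecApply (forcing a f u t) w = vecApply (f t) w -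
        vecApply (viscDist (fun i j α β x => a i j α β x t) (u t)) w := by
      simp only [vecApply, forcing, ← Finset.sum_sub_distrib]
      rfl
    rw [h2]
    linarith
  · rw [Pi.add_apply, fourier_add, ht3, leray_fourier_zero, add_zero]
  · simp only [Pi.add_apply, fourier_add, mul_add, Finset.sum_add_distrib, fourier_leray]
    rw [sum_coord_mul_fourier_eq_zero ht4, sum_coord_mul_lerayCoeff, add_zero]

theorem divergence_leray (F : VecDist n) : divergence (leray F) = 0 :=
  divergence_eq_zero fun ξ => by simp only [fourier_leray, sum_coord_mul_lerayCoeff]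

theorem memLqHdotSigma_leray {s : ℝ} {F : ℝ → VecDist n} (h : ∀ k, MemLqH 2 T s fun t => F t k) :
    MemLqHdotSigma 2 T s fun t => leray (F t) := by
  refine ⟨MemLqH.leray h, ?_⟩
  have h1 : ∀ᵐ t ∂timeMeasure T, ∀ k, MemH s (leray (F t) k) := by
    rw [ae_all_iff]
    exact fun k => (MemLqH.leray h k).ae_memH
  filter_upwards [h1] with t ht
  exact ⟨⟨ht, leray_fourier_zero _⟩, divergence_leray _⟩

theorem MemLqHdotSigma.congr {s : ℝ} {F G : ℝ → VecDist n} (h : MemLqHdotSigma 2 T s F)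
    (hFG : ∀ᵐ t ∂timeMeasure T, F t = G t) : MemLqHdotSigma 2 T s G := by
  refine ⟨fun k => ?_, ?_⟩
  · obtain ⟨G', h1, h2⟩ := h.1 k
    refine ⟨G', h1, ?_⟩
    filter_upwards [h2, hFG] with t ht1 ht2
    rwa [← ht2]
  · filter_upwards [h.2, hFG] with t ht1 ht2
    rwa [← ht2]

theorem memLqHdotSigma_add_leray (hT : 0 < T) (ha : IsViscosity T a)
    (hf : MemLqVecHdot 2 T (-1) f) (hu_two : MemLqHdotSigma 2 T 1 u)
    (hu : SolvesWeakEquation T a f u u') :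
    MemLqHdotSigma 2 T (-1) fun t => u' t + leray (convection (u t)) :=
  (memLqHdotSigma_leray (memLqH_forcing ha hf hu_two)).congr
    (by filter_upwards [hu.ae_eq_leray hT ha hu_two] with t ht using ht.symm)

theorem memLqVecHdot_convection (hn : 2 ≤ n) (hu_inf : MemLqHdotSigma ∞ T 0 u)
    (hu_two : MemLqHdotSigma 2 T 1 u) :
    MemLqVecHdot 2 T (-(n : ℝ) / 2) fun t => convection (u t) := by
  refine ⟨memLqH_convection hn hu_inf hu_two, ?_⟩
  have h1 : ∀ᵐ t ∂timeMeasure T, ∀ k, MemH (-(n : ℝ) / 2) (convection (u t) k) := by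
    rw [ae_all_iff]
    exact fun k => (memLqH_convection hn hu_inf hu_two k).ae_memH
  filter_upwards [h1, hu_two.2] with t ht1 ht2
  exact ⟨ht1, convection_fourier_zero ht2.1.1 ht2.2⟩

/-- By linearity of the projector, `u' = ℙ_σ(f - Au - (u·∇)u)`. The forcing is in `H^{-1}`, and
`-n/2 ≤ -1`, so the convection term decides the regularity. -/
theorem memLqHdotSigma_timeDeriv (hn : 2 ≤ n) (hT : 0 < T) (ha : IsViscosity T a)
    (hf : MemLqVecHdot 2 T (-1) f) (hu_inf : MemLqHdotSigma ∞ T 0 u)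
    (hu_two : MemLqHdotSigma 2 T 1 u) (hu : SolvesWeakEquation T a f u u') :
    MemLqHdotSigma 2 T (-(n : ℝ) / 2) u' := by
  have hn' : (2 : ℝ) ≤ n := by exact_mod_cast hn
  have h := memLqHdotSigma_leray (T := T) (s := -(n : ℝ) / 2)
    (F := fun t => forcing a f u t - convection (u t)) fun k =>
      ((memLqH_forcing ha hf hu_two k).mono_exp (by linarith)).sub
        (memLqH_convection hn hu_inf hu_two k)
  refine h.congr ?_
  filter_upwards [hu.ae_eq_leray hT ha hu_two] with t ht
  funext k
  refine fourier_injective fun ξ => ?_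
  have h1 := congrArg (fun g : TorusDist n => g.fourier ξ) (congrFun ht k)
  simp only [Pi.add_apply, fourier_add] at h1
  rw [eq_sub_of_add_eq h1, fourier_leray, fourier_leray, fourier_leray]
  simp only [lerayCoeff, Pi.sub_apply, fourier_sub, mul_sub, Finset.sum_sub_distrib, sub_div]
  split_ifs <;> ring

end Regularity

/-! ## Sums of squares of absolutely continuous functions -/

/-- The absolutely continuous complex function `t ↦ c + ∫₀ᵗ h`. -/
def cprim (c : ℂ) (h : ℝ → ℂ) (t : ℝ) : ℂ :=
  (prim c.re (fun s => (h s).re) t : ℂ) + (prim c.im (fun s => (h s).im) t : ℂ) * Complex.I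

theorem cprim_re (c : ℂ) (h : ℝ → ℂ) (t : ℝ) : (cprim c h t).re = prim c.re (fun s => (h s).re) t := by
  simp [cprim]

theorem cprim_im (c : ℂ) (h : ℝ → ℂ) (t : ℝ) : (cprim c h t).im = prim c.im (fun s => (h s).im) t := by
  simp [cprim]

theorem cprim_zero (c : ℂ) (h : ℝ → ℂ) : cprim c h 0 = c := by
  simp [cprim, prim_zero]

theorem continuous_cprim (c : ℂ) {h : ℝ → ℂ} (hh : Integrable h) : Continuous (cprim c h) :=
  (Complex.continuous_ofReal.comp (continuous_prim _ hh.re)).add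
    ((Complex.continuous_ofReal.comp (continuous_prim _ hh.im)).mul continuous_const)

theorem integrable_mul_prim_of_integrable (c : ℝ) {h k : ℝ → ℝ} (hh : Integrable h)
    (hk : Integrable k) (a b : ℝ) :
    IntervalIntegrable (fun s => h s * prim c k s) volume a b :=
  hh.intervalIntegrable.mul_continuousOn (continuous_prim c hk).continuousOn

theorem normSq_cprim (c : ℂ) {h : ℝ → ℂ} (hh : Integrable h) (t : ℝ) :
    ‖cprim c h t‖ ^ 2 = ‖c‖ ^ 2 + ∫ s in (0 : ℝ)..t, 2 * (h s * conj (cprim c h s)).re := by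
  have h1 := prim_sq c.re hh.re t
  have h2 := prim_sq c.im hh.im t
  simp only [Complex.sq_norm, Complex.normSq_apply, cprim_re, cprim_im, ← sq]
  have i1 := (integrable_mul_prim_of_integrable c.re hh.re hh.re 0 t).const_mul 2
  have i2 := (integrable_mul_prim_of_integrable c.im hh.im hh.im 0 t).const_mul 2
  simp only [RCLike.re_to_complex, RCLike.im_to_complex] at h1 h2 i1 i2
  rw [h1, h2]
  have e : ∀ s, 2 * (h s * conj (cprim c h s)).re =
      2 * ((h s).re * prim c.re (fun s => (h s).re) s) +
        2 * ((h s).im * prim c.im (fun s => (h s).im) s) := fun s => by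
    rw [Complex.mul_re, Complex.conj_re, Complex.conj_im, cprim_re, cprim_im]; ring
  simp only [e]
  rw [intervalIntegral.integral_add i1 i2]
  ring

theorem integrable_tsum_of_lintegral {α ι : Type*} [MeasurableSpace α] {μ : Measure α} [Countable ι]
    {F : ι → α → ℝ} (hF : ∀ i, AEStronglyMeasurable (F i) μ)
    (hsum : ∑' i, ∫⁻ a, ‖F i a‖ₑ ∂μ ≠ ⊤) : Integrable (fun a => ∑' i, F i a) μ := by
  rw [← lintegral_tsum fun i => (hF i).enorm] at hsum
  refine ⟨?_, ?_⟩
  · refine aestronglyMeasurable_of_tendsto_ae (atTop : Filter (Finset ι))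
      (f := fun S a => ∑ i ∈ S, F i a)
      (fun S => Finset.aestronglyMeasurable_fun_sum S fun i _ => hF i) ?_
    filter_upwards [ae_lt_top' (AEMeasurable.tsum fun i => (hF i).enorm) hsum] with a ha
    exact (Summable.of_enorm ha.ne).hasSum
  · refine lt_of_le_of_lt (lintegral_mono fun a => ?_) hsum.lt_top
    exact enorm_tsum_le_tsum_enorm

/-- A weighted sum of squares of absolutely continuous functions is absolutely continuous. -/
theorem hasSum_normSq_cprim {ι : Type*} [Countable ι] {w : ι → ℝ} {c : ι → ℂ} {h : ι → ℝ → ℂ}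
    (hh : ∀ i, Integrable (h i)) (h0 : Summable fun i => w i * ‖c i‖ ^ 2)
    (hsum : ∑' i, ∫⁻ s, ‖w i * (2 * (h i s * conj (cprim (c i) (h i) s)).re)‖ₑ ≠ ⊤) {t : ℝ}
    (ht : 0 ≤ t) :
    HasSum (fun i => w i * ‖cprim (c i) (h i) t‖ ^ 2)
      (prim (∑' i, w i * ‖c i‖ ^ 2)
        (fun s => ∑' i, w i * (2 * (h i s * conj (cprim (c i) (h i) s)).re)) t) := by
  set F : ι → ℝ → ℝ := fun i s => w i * (2 * (h i s * conj (cprim (c i) (h i) s)).re) with hF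
  have hFm : ∀ i, AEStronglyMeasurable (F i) := fun i =>
    (((Complex.continuous_re.comp_aestronglyMeasurable ((hh i).1.mul
      (Complex.continuous_conj.comp (continuous_cprim (c i) (hh i))).aestronglyMeasurable)).const_mul
        2).const_mul _)
  have hFi : ∀ i, Integrable (F i) := fun i =>
    ⟨hFm i, (ENNReal.ne_top_of_tsum_ne_top hsum i).lt_top⟩
  have hs : Summable fun i => ∫ s in Set.Ioc 0 t, ‖F i s‖ := by
    have h1 : ∑' i, ∫⁻ s in Set.Ioc 0 t, ‖F i s‖ₑ ≠ ⊤ :=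
      ne_top_of_le_ne_top hsum (ENNReal.tsum_le_tsum fun i => setLIntegral_le_lintegral _ _)
    refine (ENNReal.summable_toReal h1).congr fun i => ?_
    rw [integral_norm_eq_lintegral_enorm (hFm i).restrict]
  -- Absolute summability of the integrated rates allows the sum over frequencies to be interchanged
  -- with the time integral.
  have h2 := h0.hasSum.add
    (hasSum_integral_of_summable_integral_norm (fun i => (hFi i).integrableOn) hs)
  rw [prim, intervalIntegral.integral_of_le ht]
  refine (congrArg (HasSum · _) (funext fun i => ?_)).mpr h2
  rw [normSq_cprim (c i) (hh i), mul_add, ← intervalIntegral.integral_const_mul,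
    intervalIntegral.integral_of_le ht]

/-! ## Weak continuity -/

/-- The finite sections of `W` converge in norm and `V` is bounded, so the pairings with these
sections converge uniformly; each involves only finitely many continuous coordinates. -/
theorem continuousOn_inner_lp {ι : Type*} {S : Set ℝ} {V : ℝ → lp (fun _ : ι => ℂ) 2} {R : ℝ}
    (hV : ∀ t ∈ S, ‖V t‖ ≤ R) (hc : ∀ i, ContinuousOn (fun t => V t i) S)
    (W : lp (fun _ : ι => ℂ) 2) : ContinuousOn (fun t => inner ℂ W (V t)) S := by
  classical
  have hlim := lp.hasSum_single (p := 2) (by simp) W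
  have hu : TendstoUniformlyOn
      (fun (A : Finset ι) t => inner ℂ (∑ i ∈ A, lp.single 2 i (W i)) (V t))
      (fun t => inner ℂ W (V t)) atTop S := by
    rw [Metric.tendstoUniformlyOn_iff]
    intro ε hε
    have h1 := Metric.tendsto_nhds.mp hlim (ε / (|R| + 1)) (by positivity)
    filter_upwards [h1] with A hA t ht
    rw [dist_eq_norm] at hA ⊢
    rw [← inner_sub_left]
    refine (norm_inner_le_norm _ _).trans_lt ?_
    rw [norm_sub_rev] at hA
    have h2 : ‖V t‖ ≤ |R| := (hV t ht).trans (le_abs_self R)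
    calc _ ≤ ‖W - ∑ i ∈ A, lp.single 2 i (W i)‖ * (|R| + 1) := by gcongr; linarith
      _ < ε / (|R| + 1) * (|R| + 1) := by gcongr
      _ = ε := by field_simp
  refine hu.continuousOn (Frequently.of_forall fun A => ?_)
  simp only [sum_inner, lp.inner_single_left]
  exact continuousOn_finsetSum _ fun i _ => continuousOn_const.inner (hc i)

theorem memℓp_of_hE {c : (Fin n → ℤ) → ℂ} (h : hE 0 c ≠ ⊤) : Memℓp c 2 := by
  rw [hE_ne_top_iff] at h
  refine memℓp_gen (h.congr fun ξ => ?_)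
  simp

/-- A square summable family as an element of `ℓ²`. -/
def toLpTwo (c : (Fin n → ℤ) → ℂ) (h : hE 0 c ≠ ⊤) : lp (fun _ : Fin n → ℤ => ℂ) 2 :=
  ⟨c, memℓp_of_hE h⟩

theorem toLpTwo_apply (c : (Fin n → ℤ) → ℂ) (h : hE 0 c ≠ ⊤) (ξ : Fin n → ℤ) :
    toLpTwo c h ξ = c ξ := rfl

theorem norm_toLpTwo_sq (c : (Fin n → ℤ) → ℂ) (h : hE 0 c ≠ ⊤) :
    ‖toLpTwo c h‖ ^ 2 = (hE 0 c).toReal := by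
  have h1 : hE 0 c = ‖toLpTwo c h‖ₑ ^ 2 := hE_eq_enorm_sq fun ξ => by simp [toLpTwo_apply]
  rw [h1, ENNReal.toReal_pow, toReal_enorm]

/-- A coordinatewise continuous bounded family in `ℓ²` is weakly continuous. -/
theorem continuousOn_tsum_mul_conj {S : Set ℝ} {V : ℝ → (Fin n → ℤ) → ℂ} {M : ℝ≥0∞} (hM : M ≠ ⊤)
    (hV : ∀ t ∈ S, hE 0 (V t) ≤ M) (hc : ∀ ξ, ContinuousOn (fun t => V t ξ) S)
    {W : (Fin n → ℤ) → ℂ} (hW : hE 0 W ≠ ⊤) :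
    ContinuousOn (fun t => ∑' ξ, V t ξ * conj (W ξ)) S := by
  classical
  have hV' : ∀ t ∈ S, hE 0 (V t) ≠ ⊤ := fun t ht => ne_top_of_le_ne_top hM (hV t ht)
  set V' : ℝ → lp (fun _ : Fin n → ℤ => ℂ) 2 := fun t =>
    if h : hE 0 (V t) ≠ ⊤ then toLpTwo (V t) h else 0 with hV'def
  have e : ∀ t (ht : t ∈ S), V' t = toLpTwo (V t) (hV' t ht) := fun t ht => dif_pos (hV' t ht)
  -- The bound `M` is on the squared norm, and `‖V‖² ≤ M` implies `‖V‖ ≤ M + 1`; this avoids a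
  -- square root.
  have h1 := continuousOn_inner_lp (S := S) (V := V') (R := M.toReal + 1)
    (fun t ht => by
      have h2 := norm_toLpTwo_sq (V t) (hV' t ht)
      have h3 := ENNReal.toReal_mono hM (hV t ht)
      rw [← h2, ← e t ht] at h3
      nlinarith [norm_nonneg (V' t)])
    (fun ξ => (hc ξ).congr fun t ht => by rw [e t ht, toLpTwo_apply]) (toLpTwo W hW)
  refine h1.congr fun t ht => ?_
  beta_reduce
  rw [e t ht, lp.inner_eq_tsum]
  exact tsum_congr fun ξ => rfl

theorem dual_eq_tsum_conj (g f : TorusDist n) :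
    dual g f = (∑' ξ, g.fourier ξ * conj (f.fourier ξ)).re := by
  simp only [dual, fourier_neg]

/-! ## The absolutely continuous representative of the Fourier coefficients -/

section Scalar

variable {T : ℝ} {g g' : ℝ → TorusDist n}

/-- The Fourier coefficients of `g'(t)`, extended by zero to all times. -/
def coefDeriv (T : ℝ) (g' : ℝ → TorusDist n) (ξ : Fin n → ℤ) : ℝ → ℂ :=
  (Set.Ioo 0 T).indicator fun t => (g' t).fourier ξ

theorem coefDeriv_of_mem {t : ℝ} (ht : t ∈ Set.Ioo 0 T) (ξ : Fin n → ℤ) :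
    coefDeriv T g' ξ t = (g' t).fourier ξ := Set.indicator_of_mem ht _

theorem coefDeriv_of_notMem {t : ℝ} (ht : t ∉ Set.Ioo 0 T) (ξ : Fin n → ℤ) :
    coefDeriv T g' ξ t = 0 := Set.indicator_of_notMem ht _

theorem integrableOn_fourier {r : ℝ} (hg' : MemLqH 2 T r g') (ξ : Fin n → ℤ) :
    IntegrableOn (fun t => (g' t).fourier ξ) (Set.Ioo 0 T) := by
  obtain ⟨G, hG, hGg⟩ := id hg'
  have hr : 0 < rho ξ ^ r := Real.rpow_pos_of_pos (rho_pos ξ) r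
  have hGi : Integrable G (timeMeasure T) := hG.integrable (by norm_num)
  refine Integrable.mono' (hGi.norm.const_mul (rho ξ ^ r)⁻¹)
    (hg'.aestronglyMeasurable_fourier ξ) ?_
  filter_upwards [hGg] with t ht
  have h1 := lp.norm_apply_le_norm (by simp) (G t) ξ
  rw [ht ξ, norm_mul, Complex.norm_real, Real.norm_of_nonneg hr.le] at h1
  rw [inv_mul_eq_div, le_div_iff₀ hr, mul_comm]
  exact h1

theorem integrable_coefDeriv {r : ℝ} (hg' : MemLqH 2 T r g') (ξ : Fin n → ℤ) :
    Integrable (coefDeriv T g' ξ) :=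
  (integrable_indicator_iff measurableSet_Ioo).mpr (integrableOn_fourier hg' ξ)

/-- Real and imaginary parts are separately primitives of their integrable derivatives. One null set
of times serves all the countably many frequencies. -/
theorem exists_fourier_eq_cprim (hT : 0 < T) {r : ℝ} (hg' : MemLqH 2 T r g')
    (hre : ∀ ξ, HasDistribDeriv T (fun t => ((g t).fourier ξ).re) fun t => ((g' t).fourier ξ).re)
    (him : ∀ ξ, HasDistribDeriv T (fun t => ((g t).fourier ξ).im) fun t => ((g' t).fourier ξ).im) :
    ∃ c : (Fin n → ℤ) → ℂ, ∀ᵐ t ∂timeMeasure T, ∀ ξ,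
      (g t).fourier ξ = cprim (c ξ) (coefDeriv T g' ξ) t := by
  choose a ha using fun ξ => (hre ξ).exists_ae_eq_prim hT (integrableOn_fourier hg' ξ).re
  choose b hb using fun ξ => (him ξ).exists_ae_eq_prim hT (integrableOn_fourier hg' ξ).im
  refine ⟨fun ξ => ⟨a ξ, b ξ⟩, ?_⟩
  rw [ae_all_iff]
  intro ξ
  have e1 : (Set.Ioo 0 T).indicator (fun t => ((g' t).fourier ξ).re) =
      fun t => (coefDeriv T g' ξ t).re := by
    funext t
    by_cases ht : t ∈ Set.Ioo 0 T
    · rw [Set.indicator_of_mem ht, coefDeriv_of_mem ht]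
    · rw [Set.indicator_of_notMem ht, coefDeriv_of_notMem ht, Complex.zero_re]
  have e2 : (Set.Ioo 0 T).indicator (fun t => ((g' t).fourier ξ).im) =
      fun t => (coefDeriv T g' ξ t).im := by
    funext t
    by_cases ht : t ∈ Set.Ioo 0 T
    · rw [Set.indicator_of_mem ht, coefDeriv_of_mem ht]
    · rw [Set.indicator_of_notMem ht, coefDeriv_of_notMem ht, Complex.zero_im]
  filter_upwards [ha ξ, hb ξ] with t h1 h2
  rw [e1] at h1
  rw [e2] at h2
  refine Complex.ext ?_ ?_
  · rw [cprim_re]; exact h1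
  · rw [cprim_im]; exact h2

/-- Young's inequality after splitting the weight as `ϱ^{1-n/2} = ϱ^{-n/2} · ϱ`: this is the duality
between the regularity of `u'` and that of `u`. -/
theorem norm_mul_re_le {ξ : Fin n → ℤ} (z y : ℂ) :
    ‖rho ξ ^ (1 - (n : ℝ) / 2) * (2 * (z * conj y).re)‖ ≤
      rho ξ ^ (2 * (-(n : ℝ) / 2)) * ‖z‖ ^ 2 + rho ξ ^ (2 * (1 : ℝ)) * ‖y‖ ^ 2 := by
  have hr := rho_pos ξ
  have h1 : |(z * conj y).re| ≤ ‖z‖ * ‖y‖ := by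
    refine (Complex.abs_re_le_norm _).trans_eq ?_
    rw [norm_mul, RCLike.norm_conj]
  have e0 : rho ξ ^ (1 - (n : ℝ) / 2) = rho ξ ^ (-(n : ℝ) / 2) * rho ξ := by
    rw [show 1 - (n : ℝ) / 2 = -(n : ℝ) / 2 + 1 by ring, Real.rpow_add hr, Real.rpow_one]
  have e1 : rho ξ ^ (2 * (-(n : ℝ) / 2)) = (rho ξ ^ (-(n : ℝ) / 2)) ^ 2 := by
    rw [mul_comm, Real.rpow_mul hr.le, Real.rpow_two]
  have e2 : rho ξ ^ (2 * (1 : ℝ)) = rho ξ ^ 2 := by rw [mul_one, Real.rpow_two]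
  rw [e0, e1, e2, Real.norm_eq_abs, abs_mul, abs_mul 2, abs_of_pos (a := (2 : ℝ)) two_pos,
    abs_of_pos (a := rho ξ ^ (-(n : ℝ) / 2) * rho ξ) (by positivity)]
  have hp : 0 < rho ξ ^ (-(n : ℝ) / 2) := by positivity
  calc _ ≤ (rho ξ ^ (-(n : ℝ) / 2) * rho ξ) * (2 * (‖z‖ * ‖y‖)) := by gcongr
    _ ≤ _ := by nlinarith [sq_nonneg (rho ξ ^ (-(n : ℝ) / 2) * ‖z‖ - rho ξ * ‖y‖)]

theorem summable_mul_conj {z y : (Fin n → ℤ) → ℂ} (hz : hE (-(n : ℝ) / 2) z ≠ ⊤)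
    (hy : hE 1 y ≠ ⊤) :
    Summable fun ξ => ((rho ξ ^ (1 - (n : ℝ) / 2) : ℝ) : ℂ) * (z ξ * conj (y ξ)) := by
  rw [hE_ne_top_iff] at hz hy
  refine Summable.of_norm_bounded (hz.add hy) fun ξ => ?_
  have hr := rho_pos ξ
  have h := norm_mul_re_le (ξ := ξ) (‖z ξ‖ : ℂ) (‖y ξ‖ : ℂ)
  have e : ((‖z ξ‖ : ℂ) * conj (‖y ξ‖ : ℂ)).re = ‖z ξ‖ * ‖y ξ‖ := by
    rw [Complex.conj_ofReal, ← Complex.ofReal_mul, Complex.ofReal_re]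
  rw [e, Complex.norm_real, Complex.norm_real, norm_norm, norm_norm] at h
  refine le_trans ?_ h
  have hp : 0 < rho ξ ^ (1 - (n : ℝ) / 2) := by positivity
  rw [norm_mul, Complex.norm_real, norm_mul, RCLike.norm_conj, norm_mul, Real.norm_of_nonneg hp.le,
    Real.norm_of_nonneg (by positivity : (0 : ℝ) ≤ 2 * (‖z ξ‖ * ‖y ξ‖))]
  refine mul_le_mul_of_nonneg_left ?_ hp.le
  linarith [mul_nonneg (norm_nonneg (z ξ)) (norm_nonneg (y ξ))]

/-- Summed over the frequencies, the Young majorant is `‖g'‖²_{H^{-n/2}} + ‖g‖²_{H¹}`, which is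
integrable in time. Outside `(0,T)` the rate is zero by the extension of `g'`. -/
theorem tsum_lintegral_ne_top {c : (Fin n → ℤ) → ℂ} (hg : MemLqH 2 T 1 g)
    (hg' : MemLqH 2 T (-(n : ℝ) / 2) g')
    (hc : ∀ᵐ t ∂timeMeasure T, ∀ ξ, (g t).fourier ξ = cprim (c ξ) (coefDeriv T g' ξ) t) :
    ∑' ξ : Fin n → ℤ, ∫⁻ s, ‖rho ξ ^ (1 - (n : ℝ) / 2) *
      (2 * (coefDeriv T g' ξ s * conj (cprim (c ξ) (coefDeriv T g' ξ) s)).re)‖ₑ ≠ ⊤ := by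
  have hm := hg.aestronglyMeasurable_fourier
  have hm' := hg'.aestronglyMeasurable_fourier
  have h1 : ∀ ξ : Fin n → ℤ, ∫⁻ s, ‖rho ξ ^ (1 - (n : ℝ) / 2) *
      (2 * (coefDeriv T g' ξ s * conj (cprim (c ξ) (coefDeriv T g' ξ) s)).re)‖ₑ ≤
      ∫⁻ s, (wt (2 * (-(n : ℝ) / 2)) ξ * ‖(g' s).fourier ξ‖ₑ ^ 2 +
        wt (2 * 1) ξ * ‖(g s).fourier ξ‖ₑ ^ 2) ∂timeMeasure T := by
    intro ξ
    have e : (fun s => ‖rho ξ ^ (1 - (n : ℝ) / 2) *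
        (2 * (coefDeriv T g' ξ s * conj (cprim (c ξ) (coefDeriv T g' ξ) s)).re)‖ₑ) =
        (Set.Ioo 0 T).indicator fun s => ‖rho ξ ^ (1 - (n : ℝ) / 2) *
          (2 * (coefDeriv T g' ξ s * conj (cprim (c ξ) (coefDeriv T g' ξ) s)).re)‖ₑ := by
      funext s
      by_cases hs : s ∈ Set.Ioo 0 T
      · rw [Set.indicator_of_mem hs]
      · rw [Set.indicator_of_notMem hs, coefDeriv_of_notMem hs]; simp
    rw [e, lintegral_indicator measurableSet_Ioo]
    refine lintegral_mono_ae ?_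
    have hmem : ∀ᵐ s ∂timeMeasure T, s ∈ Set.Ioo 0 T := ae_restrict_mem measurableSet_Ioo
    have hgoal : ∀ᵐ s ∂timeMeasure T, ‖rho ξ ^ (1 - (n : ℝ) / 2) *
        (2 * (coefDeriv T g' ξ s * conj (cprim (c ξ) (coefDeriv T g' ξ) s)).re)‖ₑ ≤
        wt (2 * (-(n : ℝ) / 2)) ξ * ‖(g' s).fourier ξ‖ₑ ^ 2 +
          wt (2 * 1) ξ * ‖(g s).fourier ξ‖ₑ ^ 2 := by
      filter_upwards [hc, hmem] with s hs1 hs2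
      have hr := rho_pos ξ
      rw [← hs1 ξ, coefDeriv_of_mem hs2, wt_mul_enorm_sq, wt_mul_enorm_sq,
        ← ENNReal.ofReal_add (by positivity) (by positivity), ← ofReal_norm]
      exact ENNReal.ofReal_le_ofReal (norm_mul_re_le _ _)
    exact hgoal
  refine ne_top_of_le_ne_top ?_ (ENNReal.tsum_le_tsum h1)
  have hmeas : ∀ ξ : Fin n → ℤ, AEMeasurable (fun s => wt (2 * (-(n : ℝ) / 2)) ξ *
      ‖(g' s).fourier ξ‖ₑ ^ 2 + wt (2 * 1) ξ * ‖(g s).fourier ξ‖ₑ ^ 2) (timeMeasure T) := fun ξ =>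
    (((hm' ξ).enorm.pow_const 2).const_mul _).add (((hm ξ).enorm.pow_const 2).const_mul _)
  rw [← lintegral_tsum hmeas]
  simp only [ENNReal.tsum_add]
  change ∫⁻ t, (hE (-(n : ℝ) / 2) (g' t).fourier + hE 1 (g t).fourier) ∂timeMeasure T ≠ ⊤
  rw [lintegral_add_left' (measurable_hE hm')]
  exact ENNReal.add_ne_top.mpr ⟨hg'.lintegral_ne_top, hg.lintegral_ne_top⟩

/-- The density of `d/dt ‖g‖²`. -/
def energyRate (T : ℝ) (g' : ℝ → TorusDist n) (c : (Fin n → ℤ) → ℂ) (t : ℝ) : ℝ :=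
  ∑' ξ : Fin n → ℤ, rho ξ ^ (1 - (n : ℝ) / 2) *
    (2 * (coefDeriv T g' ξ t * conj (cprim (c ξ) (coefDeriv T g' ξ) t)).re)

theorem integrable_energyRate {c : (Fin n → ℤ) → ℂ} (hg : MemLqH 2 T 1 g)
    (hg' : MemLqH 2 T (-(n : ℝ) / 2) g')
    (hc : ∀ᵐ t ∂timeMeasure T, ∀ ξ, (g t).fourier ξ = cprim (c ξ) (coefDeriv T g' ξ) t) :
    Integrable (energyRate T g' c) :=
  integrable_tsum_of_lintegral (fun ξ =>
    ((Complex.continuous_re.comp_aestronglyMeasurable ((integrable_coefDeriv hg' ξ).1.mul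
      (Complex.continuous_conj.comp
        (continuous_cprim (c ξ) (integrable_coefDeriv hg' ξ))).aestronglyMeasurable)).const_mul
        2).const_mul _) (tsum_lintegral_ne_top hg hg' hc)

theorem hasSum_energy {c : (Fin n → ℤ) → ℂ} (hg : MemLqH 2 T 1 g)
    (hg' : MemLqH 2 T (-(n : ℝ) / 2) g')
    (hc : ∀ᵐ t ∂timeMeasure T, ∀ ξ, (g t).fourier ξ = cprim (c ξ) (coefDeriv T g' ξ) t)
    (h0 : Summable fun ξ => rho ξ ^ (1 - (n : ℝ) / 2) * ‖c ξ‖ ^ 2) {t : ℝ} (ht : 0 ≤ t) :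
    HasSum (fun ξ => rho ξ ^ (1 - (n : ℝ) / 2) * ‖cprim (c ξ) (coefDeriv T g' ξ) t‖ ^ 2)
      (prim (∑' ξ, rho ξ ^ (1 - (n : ℝ) / 2) * ‖c ξ‖ ^ 2) (energyRate T g' c) t) :=
  hasSum_normSq_cprim (integrable_coefDeriv hg') h0 (tsum_lintegral_ne_top hg hg' hc) ht

theorem ae_energyRate_eq {c : (Fin n → ℤ) → ℂ} (hg : MemLqH 2 T 1 g)
    (hg' : MemLqH 2 T (-(n : ℝ) / 2) g')
    (hc : ∀ᵐ t ∂timeMeasure T, ∀ ξ, (g t).fourier ξ = cprim (c ξ) (coefDeriv T g' ξ) t) :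
    ∀ᵐ t ∂timeMeasure T, energyRate T g' c t =
      2 * (∑' ξ, ((rho ξ ^ (1 - (n : ℝ) / 2) : ℝ) : ℂ) *
        ((g' t).fourier ξ * conj ((g t).fourier ξ))).re := by
  have hmem : ∀ᵐ s ∂timeMeasure T, s ∈ Set.Ioo 0 T := ae_restrict_mem measurableSet_Ioo
  filter_upwards [hc, hmem, hg.ae_memH, hg'.ae_memH] with t h1 h2 h3 h4
  rw [Complex.re_tsum (summable_mul_conj ((memH_iff _ _).mp h4) ((memH_iff _ _).mp h3)),
    energyRate, ← tsum_mul_left]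
  refine tsum_congr fun ξ => ?_
  rw [← h1 ξ, coefDeriv_of_mem h2, Complex.re_ofReal_mul]
  ring

end Scalar

/-! ## The continuous representative -/

/-- The data of a representative of `u` with absolutely continuous Fourier coefficients, which are
bounded in `H⁰`; `c` are the Fourier coefficients at time zero. -/
structure IsInitial (T : ℝ) (u u' : ℝ → VecDist n) (c : Fin n → (Fin n → ℤ) → ℂ) (M : ℝ≥0∞) :
    Prop where
  pos : 0 < T
  memH_one : MemLqHdotSigma 2 T 1 u
  memH_deriv : MemLqHdotSigma 2 T (-(n : ℝ) / 2) u'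
  ne_top : M ≠ ⊤
  bound : ∀ᵐ t ∂timeMeasure T, ∀ k, hE 0 (u t k).fourier ≤ M
  fourier_eq : ∀ᵐ t ∂timeMeasure T, ∀ k ξ,
    (u t k).fourier ξ = cprim (c k ξ) (coefDeriv T (fun t => u' t k) ξ) t

/-- The Fourier coefficients of the continuous representative. -/
def reprCoeff (T : ℝ) (u' : ℝ → VecDist n) (c : Fin n → (Fin n → ℤ) → ℂ) (k : Fin n)
    (t : ℝ) (ξ : Fin n → ℤ) : ℂ := cprim (c k ξ) (coefDeriv T (fun t => u' t k) ξ) t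

/-- The continuous representative. -/
def contRepr (T : ℝ) (u' : ℝ → VecDist n) (c : Fin n → (Fin n → ℤ) → ℂ) (t : ℝ) : VecDist n :=
  fun k => TorusDist.ofFourier (reprCoeff T u' c k t)

theorem exists_isInitial {T : ℝ} (hT : 0 < T) {u u' : ℝ → VecDist n}
    (hu_inf : MemLqHdotSigma ∞ T 0 u) (hu_two : MemLqHdotSigma 2 T 1 u)
    (hu' : MemLqHdotSigma 2 T (-(n : ℝ) / 2) u') (h : IsTimeDeriv T u u') :
    ∃ c M, IsInitial T u u' c M := by
  choose M hM hMle using fun k => (hu_inf.1 k).exists_ae_le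
  choose c hc using fun k => exists_fourier_eq_cprim hT (hu'.1 k) (h.re k) (h.im k)
  refine ⟨c, ∑ k, M k, hT, hu_two, hu', ENNReal.sum_ne_top.mpr fun i _ => hM i, ?_, ?_⟩
  · rw [ae_all_iff]
    intro k
    filter_upwards [hMle k] with t ht
    exact ht.trans (Finset.single_le_sum (f := M) (fun _ _ => zero_le) (Finset.mem_univ k))
  · rw [ae_all_iff]
    exact hc

theorem polyGrowth_of_hE {c : (Fin n → ℤ) → ℂ} (h : hE 0 c ≠ ⊤) : PolyGrowth c := by
  refine ⟨0, ‖toLpTwo c h‖, fun ξ => ?_⟩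
  rw [pow_zero, mul_one]
  exact lp.norm_apply_le_norm (by simp) (toLpTwo c h) ξ

theorem summable_rpow_mul_sq {c : (Fin n → ℤ) → ℂ} {r : ℝ} (h : hE r c ≠ ⊤) :
    Summable fun ξ => rho ξ ^ (2 * r) * ‖c ξ‖ ^ 2 := (hE_ne_top_iff _ _).mp h

namespace IsInitial

variable {T : ℝ} {u u' : ℝ → VecDist n} {c : Fin n → (Fin n → ℤ) → ℂ} {M : ℝ≥0∞}

theorem continuous_reprCoeff (H : IsInitial T u u' c M) (k : Fin n) (ξ : Fin n → ℤ) :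
    Continuous fun t => reprCoeff T u' c k t ξ :=
  continuous_cprim _ (integrable_coefDeriv (H.memH_deriv.1 k) ξ)

/-- A sum of nonnegative continuous functions is lower semicontinuous, so the set of times where the
bound holds is closed; it contains almost every time and hence all of `[0,T]`. -/
theorem hE_reprCoeff_le (H : IsInitial T u u' c M) (k : Fin n) {t : ℝ} (ht : t ∈ Set.Icc 0 T) :
    hE 0 (reprCoeff T u' c k t) ≤ M := by
  refine forall_mem_Icc_of_ae H.pos (p := fun t => hE 0 (reprCoeff T u' c k t) ≤ M) ?_ ?_ t ht
  · refine LowerSemicontinuous.isClosed_preimage (lowerSemicontinuous_tsum fun ξ => ?_) M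
    refine Continuous.lowerSemicontinuous ?_
    exact (ENNReal.continuous_const_mul (wt_ne_top _ _)).comp
      ((ENNReal.continuous_pow 2).comp (H.continuous_reprCoeff k ξ).enorm)
  · filter_upwards [H.bound, H.fourier_eq] with t h1 h2
    have e : reprCoeff T u' c k t = (u t k).fourier := funext fun ξ => (h2 k ξ).symm
    rw [e]
    exact h1 k

theorem hE_reprCoeff_ne_top (H : IsInitial T u u' c M) (k : Fin n) {t : ℝ}
    (ht : t ∈ Set.Icc 0 T) : hE 0 (reprCoeff T u' c k t) ≠ ⊤ :=
  ne_top_of_le_ne_top H.ne_top (H.hE_reprCoeff_le k ht)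

/-- Hermitian symmetry holds almost everywhere because the coefficients come from the real
distribution `u(t)`, and by continuity at every time; square summability gives the growth bound. -/
theorem fourier_contRepr (H : IsInitial T u u' c M) (k : Fin n) {t : ℝ} (ht : t ∈ Set.Icc 0 T)
    (ξ : Fin n → ℤ) : (contRepr T u' c t k).fourier ξ = reprCoeff T u' c k t ξ := by
  refine fourier_ofFourier (polyGrowth_of_hE (H.hE_reprCoeff_ne_top k ht)) (fun η => ?_) ξ
  refine forall_mem_Icc_of_ae H.pos
    (p := fun t => reprCoeff T u' c k t (-η) = conj (reprCoeff T u' c k t η)) ?_ ?_ t ht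
  · exact isClosed_eq (H.continuous_reprCoeff k _)
      (Complex.continuous_conj.comp (H.continuous_reprCoeff k _))
  · filter_upwards [H.fourier_eq] with t h
    simp only [reprCoeff, ← h k]
    exact fourier_neg _ _

theorem fourier_contRepr_eq (H : IsInitial T u u' c M) (k : Fin n) {t : ℝ}
    (ht : t ∈ Set.Icc 0 T) : (contRepr T u' c t k).fourier = reprCoeff T u' c k t :=
  funext (H.fourier_contRepr k ht)

theorem mem_Icc (_ : IsInitial T u u' c M) : ∀ᵐ t ∂timeMeasure T, t ∈ Set.Icc 0 T := by
  have h : ∀ᵐ t ∂timeMeasure T, t ∈ Set.Ioo 0 T := ae_restrict_mem measurableSet_Ioo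
  filter_upwards [h] with t ht using Set.Ioo_subset_Icc_self ht

theorem ae_eq (H : IsInitial T u u' c M) : ∀ᵐ t ∂timeMeasure T, u t = contRepr T u' c t := by
  filter_upwards [H.fourier_eq, H.mem_Icc] with t h1 h2
  funext k
  refine fourier_injective fun ξ => ?_
  rw [H.fourier_contRepr k h2, h1 k ξ, reprCoeff]

theorem memHdotSigma_zero (H : IsInitial T u u' c M) {t : ℝ} (ht : t ∈ Set.Icc 0 T) :
    MemHdotSigma 0 (contRepr T u' c t) := by
  refine ⟨⟨fun k => ?_, fun k => ?_⟩, divergence_eq_zero fun ξ => ?_⟩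
  · rw [memH_iff, H.fourier_contRepr_eq k ht]
    exact H.hE_reprCoeff_ne_top k ht
  · rw [MeanZero, H.fourier_contRepr k ht]
    refine forall_mem_Icc_of_ae H.pos (p := fun t => reprCoeff T u' c k t 0 = 0)
      (isClosed_eq (H.continuous_reprCoeff k _) continuous_const) ?_ t ht
    filter_upwards [H.fourier_eq, H.memH_one.2] with t h1 h2
    rw [reprCoeff, ← h1 k]
    exact h2.1.2 k
  · simp only [H.fourier_contRepr _ ht]
    refine forall_mem_Icc_of_ae H.pos
      (p := fun t => ∑ k, (ξ k : ℂ) * reprCoeff T u' c k t ξ = 0)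
      (isClosed_eq (continuous_finsetSum _ fun k _ =>
        continuous_const.mul (H.continuous_reprCoeff k _)) continuous_const) ?_ t ht
    filter_upwards [H.fourier_eq, H.memH_one.2] with t h1 h2
    simp only [reprCoeff, ← h1]
    exact sum_coord_mul_fourier_eq_zero h2.2 ξ

theorem memHdotSigma_of_nonpos (H : IsInitial T u u' c M) {s : ℝ} (hs : s ≤ 0) {t : ℝ}
    (ht : t ∈ Set.Icc 0 T) : MemHdotSigma s (contRepr T u' c t) := by
  have h := H.memHdotSigma_zero ht
  exact ⟨⟨fun k => memH_mono hs (h.1.1 k), h.1.2⟩, h.2⟩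

theorem tendsto_vecDual (H : IsInitial T u u' c M) {w : VecDist n} (hw : MemVecH 0 w) {t₀ : ℝ}
    (ht₀ : t₀ ∈ Set.Icc 0 T) :
    Tendsto (fun t => vecDual (contRepr T u' c t) w) (𝓝[Set.Icc 0 T] t₀)
      (𝓝 (vecDual (contRepr T u' c t₀) w)) := by
  have h : ContinuousOn (fun t => vecDual (contRepr T u' c t) w) (Set.Icc 0 T) := by
    refine continuousOn_finsetSum _ fun k _ => ?_
    have h1 := Complex.continuous_re.comp_continuousOn
      (continuousOn_tsum_mul_conj (S := Set.Icc 0 T) H.ne_top (fun t ht => H.hE_reprCoeff_le k ht)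
        (fun ξ => (H.continuous_reprCoeff k ξ).continuousOn) ((memH_iff _ _).mp (hw k)))
    refine h1.congr fun t ht => ?_
    simp only [dual_eq_tsum_conj, H.fourier_contRepr k ht, Function.comp_apply]
  exact h t₀ ht₀

/-! ### The energy identity -/

theorem summable_initial (H : IsInitial T u u' c M) (hn : 2 ≤ n) (k : Fin n) {t : ℝ}
    (ht : t ∈ Set.Icc 0 T) :
    Summable fun ξ => rho ξ ^ (1 - (n : ℝ) / 2) * ‖reprCoeff T u' c k t ξ‖ ^ 2 := by
  have hn' : (2 : ℝ) ≤ n := by exact_mod_cast hn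
  have h := summable_rpow_mul_sq (r := (1 - (n : ℝ) / 2) / 2)
    (ne_top_of_le_ne_top (H.hE_reprCoeff_ne_top k ht) (hE_mono_exp (by linarith) _))
  rwa [mul_div_cancel₀ _ (two_ne_zero' ℝ)] at h

/-- The energy identity for the components. -/
theorem hasSum_energy_reprCoeff (H : IsInitial T u u' c M) (hn : 2 ≤ n) (k : Fin n) {t : ℝ}
    (ht : t ∈ Set.Icc 0 T) :
    HasSum (fun ξ => rho ξ ^ (1 - (n : ℝ) / 2) * ‖reprCoeff T u' c k t ξ‖ ^ 2)
      (prim (∑' ξ, rho ξ ^ (1 - (n : ℝ) / 2) * ‖c k ξ‖ ^ 2)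
        (energyRate T (fun t => u' t k) (c k)) t) := by
  have h0 := H.summable_initial hn k (Set.left_mem_Icc.mpr H.pos.le)
  simp only [reprCoeff, cprim_zero] at h0
  exact hasSum_energy (H.memH_one.1 k) (H.memH_deriv.1 k)
    (by filter_upwards [H.fourier_eq] with t ht using ht k) h0 ht.1

theorem integrable_energyRate (H : IsInitial T u u' c M) (k : Fin n) :
    Integrable (energyRate T (fun t => u' t k) (c k)) :=
  PeriodicNS.integrable_energyRate (H.memH_one.1 k) (H.memH_deriv.1 k)
    (by filter_upwards [H.fourier_eq] with t ht using ht k)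

theorem normSqH_contRepr (H : IsInitial T u u' c M) (hn : 2 ≤ n) {t : ℝ} (ht : t ∈ Set.Icc 0 T) :
    normSqH (-((n : ℝ) - 2) / 4) (contRepr T u' c t) =
      ∑ k, prim (∑' ξ, rho ξ ^ (1 - (n : ℝ) / 2) * ‖c k ξ‖ ^ 2)
        (energyRate T (fun t => u' t k) (c k)) t := by
  refine Finset.sum_congr rfl fun k _ => ?_
  rw [← (H.hasSum_energy_reprCoeff hn k ht).tsum_eq, H.fourier_contRepr_eq k ht,
    show 2 * (-((n : ℝ) - 2) / 4) = 1 - n / 2 by ring]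

theorem ae_sum_energyRate (H : IsInitial T u u' c M) :
    ∀ᵐ t ∂timeMeasure T, ∑ k, energyRate T (fun t => u' t k) (c k) t =
      2 * ∑ k, (∑' ξ, ((rho ξ ^ (1 - (n : ℝ) / 2) : ℝ) : ℂ) *
        ((u' t k).fourier ξ * conj ((u t k).fourier ξ))).re := by
  have h : ∀ᵐ t ∂timeMeasure T, ∀ k, energyRate T (fun t => u' t k) (c k) t =
      2 * (∑' ξ, ((rho ξ ^ (1 - (n : ℝ) / 2) : ℝ) : ℂ) *
        ((u' t k).fourier ξ * conj ((u t k).fourier ξ))).re := by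
    rw [ae_all_iff]
    exact fun k => ae_energyRate_eq (H.memH_one.1 k) (H.memH_deriv.1 k)
      (by filter_upwards [H.fourier_eq] with t ht using ht k)
  filter_upwards [h] with t ht
  rw [Finset.mul_sum]
  exact Finset.sum_congr rfl fun k _ => ht k

end IsInitial

/-- The pairing depends on the two orders only through their sum, so the three expressions for the
rate of change of the norm are one and the same series, at every time. -/
theorem vecDual_bessel_bessel (r s : ℝ) (G F : VecDist n) :
    vecDual (bessel r G) (bessel s F) = ∑ k, (∑' ξ, ((rho ξ ^ (r + s) : ℝ) : ℂ) *
      ((G k).fourier ξ * conj ((F k).fourier ξ))).re := by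
  refine Finset.sum_congr rfl fun k _ => ?_
  rw [dual_eq_tsum_conj]
  congr 1
  refine tsum_congr fun ξ => ?_
  rw [fourier_bessel, fourier_bessel, Real.rpow_add (rho_pos ξ), map_mul, Complex.conj_ofReal]
  push_cast
  ring

theorem bessel_zero (G : VecDist n) : bessel 0 G = G := by
  funext k
  exact fourier_injective fun ξ => by simp [fourier_bessel]

theorem vecDual_bessel_right (r : ℝ) (G F : VecDist n) :
    vecDual G (bessel r F) = ∑ k, (∑' ξ, ((rho ξ ^ r : ℝ) : ℂ) *
      ((G k).fourier ξ * conj ((F k).fourier ξ))).re := by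
  have h := vecDual_bessel_bessel 0 r G F
  rwa [bessel_zero, zero_add] at h

theorem vecDual_bessel_left (r : ℝ) (G F : VecDist n) :
    vecDual (bessel r G) F = ∑ k, (∑' ξ, ((rho ξ ^ r : ℝ) : ℂ) *
      ((G k).fourier ξ * conj ((F k).fourier ξ))).re := by
  have h := vecDual_bessel_bessel r 0 G F
  rwa [bessel_zero, add_zero] at h

namespace IsInitial

variable {T : ℝ} {u u' : ℝ → VecDist n} {c : Fin n → (Fin n → ℤ) → ℂ} {M : ℝ≥0∞}

theorem ae_sum_energyRate_eq_vecDual (H : IsInitial T u u' c M) :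
    ∀ᵐ t ∂timeMeasure T, ∑ k, energyRate T (fun t => u' t k) (c k) t =
      2 * vecDual (bessel (-(n : ℝ) / 2) (u' t)) (bessel 1 (u t)) := by
  filter_upwards [H.ae_sum_energyRate] with t ht
  rw [ht, vecDual_bessel_bessel, show -(n : ℝ) / 2 + 1 = 1 - n / 2 by ring]

theorem hasDistribDeriv_normSqH (H : IsInitial T u u' c M) (hn : 2 ≤ n) :
    HasDistribDeriv T (fun t => normSqH (-((n : ℝ) - 2) / 4) (u t))
      (fun t => 2 * vecDual (bessel (-(n : ℝ) / 2) (u' t)) (bessel 1 (u t))) := by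
  refine (HasDistribDeriv.sum H.pos Finset.univ fun k => hasDistribDeriv_prim H.pos
    (∑' ξ, rho ξ ^ (1 - (n : ℝ) / 2) * ‖c k ξ‖ ^ 2) (H.integrable_energyRate k)).congr ?_
    H.ae_sum_energyRate_eq_vecDual
  filter_upwards [H.ae_eq, H.mem_Icc] with t h1 h2
  rw [h1, H.normSqH_contRepr hn h2]

/-- On `(0,T)` the squared norm of the representative coincides with a finite sum of primitives,
each differentiable almost everywhere by Lebesgue's theorem. -/
theorem ae_hasDerivAt_normSqH (H : IsInitial T u u' c M) (hn : 2 ≤ n) :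
    ∀ᵐ t ∂timeMeasure T,
      HasDerivAt (fun τ => normSqH (-((n : ℝ) - 2) / 4) (contRepr T u' c τ))
        (2 * vecDual (bessel (-(n : ℝ) / 2) (u' t)) (bessel 1 (u t))) t := by
  have h1 : ∀ᵐ t ∂timeMeasure T, ∀ k, HasDerivAt
      (prim (∑' ξ, rho ξ ^ (1 - (n : ℝ) / 2) * ‖c k ξ‖ ^ 2)
        (energyRate T (fun t => u' t k) (c k)))
      (energyRate T (fun t => u' t k) (c k) t) t := by
    rw [ae_all_iff]
    exact fun k => ae_restrict_of_ae (ae_hasDerivAt_prim _ (H.integrable_energyRate k))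
  have hmem : ∀ᵐ s ∂timeMeasure T, s ∈ Set.Ioo 0 T := ae_restrict_mem measurableSet_Ioo
  filter_upwards [h1, hmem, H.ae_sum_energyRate_eq_vecDual] with t h2 h3 h4
  rw [← h4]
  refine (HasDerivAt.fun_sum fun k _ => h2 k).congr_of_eventuallyEq ?_
  filter_upwards [isOpen_Ioo.mem_nhds h3] with τ hτ
  exact H.normSqH_contRepr hn (Set.Ioo_subset_Icc_self hτ)

/-! ### Strong continuity -/

/-- The expansion of `‖x - y‖²`, with the inner product of `H^{-(n-2)/4}` written as a dual product
against a Bessel potential of order `1-n/2`. -/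
theorem normSqH_sub_contRepr (H : IsInitial T u u' c M) (hn : 2 ≤ n) {t t₀ : ℝ}
    (ht : t ∈ Set.Icc 0 T) (ht₀ : t₀ ∈ Set.Icc 0 T) :
    normSqH (-((n : ℝ) - 2) / 4) (contRepr T u' c t - contRepr T u' c t₀) =
      normSqH (-((n : ℝ) - 2) / 4) (contRepr T u' c t) +
        normSqH (-((n : ℝ) - 2) / 4) (contRepr T u' c t₀) -
        2 * vecDual (contRepr T u' c t) (bessel (1 - (n : ℝ) / 2) (contRepr T u' c t₀)) := by
  have hn' : (2 : ℝ) ≤ n := by exact_mod_cast hn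
  rw [vecDual_bessel_right, normSqH, normSqH, normSqH, Finset.mul_sum, ← Finset.sum_add_distrib,
    ← Finset.sum_sub_distrib]
  refine Finset.sum_congr rfl fun k _ => ?_
  rw [show 2 * (-((n : ℝ) - 2) / 4) = 1 - n / 2 by ring]
  have s1 := H.summable_initial hn k ht
  have s2 := H.summable_initial hn k ht₀
  have s3 : Summable fun ξ => ((rho ξ ^ (1 - (n : ℝ) / 2) : ℝ) : ℂ) *
      (reprCoeff T u' c k t ξ * conj (reprCoeff T u' c k t₀ ξ)) := by
    refine Summable.of_norm_bounded (s1.add s2) fun ξ => ?_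
    have hp : 0 < rho ξ ^ (1 - (n : ℝ) / 2) := Real.rpow_pos_of_pos (rho_pos ξ) _
    rw [norm_mul, Complex.norm_real, norm_mul, RCLike.norm_conj, Real.norm_of_nonneg hp.le,
      ← mul_add]
    refine mul_le_mul_of_nonneg_left ?_ hp.le
    nlinarith [sq_nonneg (‖reprCoeff T u' c k t ξ‖ - ‖reprCoeff T u' c k t₀ ξ‖),
      sq_nonneg (‖reprCoeff T u' c k t ξ‖), sq_nonneg (‖reprCoeff T u' c k t₀ ξ‖)]
  simp only [Pi.sub_apply, fourier_sub, H.fourier_contRepr k ht, H.fourier_contRepr k ht₀]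
  rw [Complex.re_tsum s3, ← s1.tsum_add s2, ← tsum_mul_left,
    ← (s1.add s2).tsum_sub ((Complex.hasSum_re s3.hasSum).summable.mul_left 2)]
  refine tsum_congr fun ξ => ?_
  rw [Complex.re_ofReal_mul, Complex.sq_norm, Complex.sq_norm, Complex.sq_norm,
    Complex.normSq_sub]
  ring

/-- In the expansion of the squared difference the norm is continuous, being a primitive, and the
mixed term is continuous by weak continuity: the potential of `ũ(t₀)` is in `H⁰` since its order
`1-n/2` is not positive. -/
theorem tendsto_normSqH_sub (H : IsInitial T u u' c M) (hn : 2 ≤ n) {t₀ : ℝ}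
    (ht₀ : t₀ ∈ Set.Icc 0 T) :
    Tendsto (fun t => normSqH (-((n : ℝ) - 2) / 4) (contRepr T u' c t - contRepr T u' c t₀))
      (𝓝[Set.Icc 0 T] t₀) (𝓝 0) := by
  have hn' : (2 : ℝ) ≤ n := by exact_mod_cast hn
  have hmem : MemVecH 0 (bessel (1 - (n : ℝ) / 2) (contRepr T u' c t₀)) := by
    intro k
    rw [memH_iff]
    have h1 : hE 0 (bessel (1 - (n : ℝ) / 2) (contRepr T u' c t₀) k).fourier ≤
        ENNReal.ofReal (1 ^ 2) * hE (0 + (1 - (n : ℝ) / 2)) (contRepr T u' c t₀ k).fourier :=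
      hE_le_of_norm_le fun ξ => by
        have hr := rho_pos ξ
        rw [fourier_bessel, norm_mul, Complex.norm_real, Real.norm_of_nonneg (by positivity),
          one_mul]
    refine ne_top_of_le_ne_top (ENNReal.mul_ne_top ENNReal.ofReal_ne_top ?_) h1
    exact ne_top_of_le_ne_top ((memH_iff _ _).mp ((H.memHdotSigma_zero ht₀).1.1 k))
      (hE_mono_exp (by linarith) _)
  have h1 : ContinuousOn (fun t => normSqH (-((n : ℝ) - 2) / 4) (contRepr T u' c t))
      (Set.Icc 0 T) := by
    have h2 : Continuous fun t => ∑ k, prim (∑' ξ, rho ξ ^ (1 - (n : ℝ) / 2) * ‖c k ξ‖ ^ 2)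
        (energyRate T (fun t => u' t k) (c k)) t :=
      continuous_finsetSum _ fun k _ => continuous_prim _ (H.integrable_energyRate k)
    exact h2.continuousOn.congr fun t ht => H.normSqH_contRepr hn ht
  have h3 : Tendsto (fun t => normSqH (-((n : ℝ) - 2) / 4) (contRepr T u' c t) +
        normSqH (-((n : ℝ) - 2) / 4) (contRepr T u' c t₀) -
        2 * vecDual (contRepr T u' c t) (bessel (1 - (n : ℝ) / 2) (contRepr T u' c t₀)))
      (𝓝[Set.Icc 0 T] t₀) (𝓝 (normSqH (-((n : ℝ) - 2) / 4) (contRepr T u' c t₀) +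
        normSqH (-((n : ℝ) - 2) / 4) (contRepr T u' c t₀) -
        2 * vecDual (contRepr T u' c t₀) (bessel (1 - (n : ℝ) / 2) (contRepr T u' c t₀)))) :=
    ((h1 t₀ ht₀).tendsto.add_const _).sub ((H.tendsto_vecDual hmem ht₀).const_mul 2)
  rw [← H.normSqH_sub_contRepr hn ht₀ ht₀] at h3
  have e0 : normSqH (-((n : ℝ) - 2) / 4) (contRepr T u' c t₀ - contRepr T u' c t₀) = 0 := by
    simp [normSqH, fourier_sub]
  rw [e0] at h3
  refine h3.congr' ?_
  filter_upwards [self_mem_nhdsWithin] with t ht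
  exact (H.normSqH_sub_contRepr hn ht ht₀).symm

end IsInitial

/-! ## The pressure -/

/-- The Fourier coefficients of the potential of `X`. -/
def potentialCoeff (X : VecDist n) (ξ : Fin n → ℤ) : ℂ :=
  if ξ = 0 then 0
  else (∑ j, (ξ j : ℂ) * (X j).fourier ξ) / (2 * Real.pi * Complex.I * ((freqSq ξ : ℝ) : ℂ))

/-- The zero-mean potential `p` with `∇p` the gradient part of `X`. -/
def potential (X : VecDist n) : TorusDist n := TorusDist.ofFourier (potentialCoeff X)

/-- Since `|ξ|² ≥ 1` away from zero, `1 + |ξ|² ≤ 2|ξ|²`; this is why inverting the gradient on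
zero-mean fields gains a full power of `ϱ`. -/
theorem rho_mul_abs_coord_le {ξ : Fin n → ℤ} (hξ : ξ ≠ 0) (j : Fin n) :
    rho ξ * |(ξ j : ℝ)| ≤ 2 * (2 * Real.pi * freqSq ξ) := by
  have h1 := one_le_freqSq hξ
  have h2 : (ξ j : ℝ) ^ 2 ≤ freqSq ξ :=
    Finset.single_le_sum (f := fun i => (ξ i : ℝ) ^ 2) (fun _ _ => sq_nonneg _) (Finset.mem_univ j)
  have hpi := Real.pi_pos
  refine le_of_sq_le_sq ?_ (by positivity)
  rw [mul_pow, sq_abs, rho, mul_pow, Real.sq_sqrt (by linarith)]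
  calc (2 * Real.pi) ^ 2 * (1 + freqSq ξ) * (ξ j : ℝ) ^ 2
      ≤ (2 * Real.pi) ^ 2 * (2 * freqSq ξ) * freqSq ξ := by gcongr; linarith
    _ ≤ (2 * (2 * Real.pi * freqSq ξ)) ^ 2 := by nlinarith [sq_nonneg (2 * Real.pi * freqSq ξ)]

theorem norm_potentialCoeff_le (X : VecDist n) (ξ : Fin n → ℤ) :
    ‖potentialCoeff X ξ‖ ≤ 2 * rho ξ ^ (-1 : ℝ) * ∑ j, ‖(X j).fourier ξ‖ := by
  have hr := rho_pos ξ
  have h0 : 0 ≤ ∑ j, ‖(X j).fourier ξ‖ := Finset.sum_nonneg fun _ _ => norm_nonneg _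
  rw [potentialCoeff]
  split_ifs with h
  · rw [norm_zero]; positivity
  · have hq := freqSq_pos h
    have hpi := Real.pi_pos
    have e : ‖(2 * Real.pi * Complex.I * ((freqSq ξ : ℝ) : ℂ))‖ = 2 * Real.pi * freqSq ξ := by
      simp [abs_of_pos hpi, abs_of_pos hq]
    rw [norm_div, e, div_le_iff₀ (by positivity), Real.rpow_neg_one]
    refine (norm_sum_le _ _).trans ?_
    rw [Finset.mul_sum, Finset.sum_mul]
    refine Finset.sum_le_sum fun j _ => ?_
    have h1 := rho_mul_abs_coord_le h j
    have h2 : |(ξ j : ℝ)| ≤ (rho ξ)⁻¹ * (2 * (2 * Real.pi * freqSq ξ)) := by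
      rw [inv_mul_eq_div, le_div_iff₀ hr, mul_comm]; exact h1
    rw [norm_mul, ← Complex.ofReal_intCast, Complex.norm_real, Real.norm_eq_abs]
    calc _ ≤ (rho ξ)⁻¹ * (2 * (2 * Real.pi * freqSq ξ)) * ‖(X j).fourier ξ‖ := by gcongr
      _ = _ := by ring

theorem fourier_potential (X : VecDist n) (ξ : Fin n → ℤ) :
    (potential X).fourier ξ = potentialCoeff X ξ := by
  refine fourier_ofFourier ?_ (fun η => ?_) ξ
  · have h1 : PolyGrowth fun ξ : Fin n → ℤ => ∑ j, ((‖(X j).fourier ξ‖ : ℝ) : ℂ) :=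
      PolyGrowth.sum _ fun j => by
        obtain ⟨N, C, hC⟩ := polyGrowth_fourier (X j)
        exact ⟨N, C, fun ξ => by simpa using hC ξ⟩
    have h2 : PolyGrowth fun _ : Fin n → ℤ => (2 : ℂ) := ⟨0, 2, fun ξ => by simp⟩
    refine (h1.mul ((polyGrowth_rpow (-1)).mul h2)).mono fun ξ => ?_
    have hr := rho_pos ξ
    refine (norm_potentialCoeff_le X ξ).trans_eq ?_
    have h0 : 0 ≤ ∑ j, ‖(X j).fourier ξ‖ := Finset.sum_nonneg fun _ _ => norm_nonneg _
    rw [norm_mul, norm_mul, ← Complex.ofReal_sum, Complex.norm_real, Complex.norm_real,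
      Real.norm_of_nonneg h0, Real.norm_of_nonneg (by positivity)]
    norm_num
  · simp only [potentialCoeff, neg_eq_zero]
    split_ifs with h
    · simp
    · simp only [freqSq_neg, fourier_neg, Pi.neg_apply, Int.cast_neg, neg_mul,
        Finset.sum_neg_distrib, map_div₀, map_sum, map_mul, Complex.conj_I, Complex.conj_ofReal,
        map_intCast, map_ofNat, mul_neg, neg_mul, neg_div, div_neg]

theorem hE_potential_le (s : ℝ) (X : VecDist n) :
    hE (s + 1) (potential X).fourier ≤ ENNReal.ofReal (2 ^ 2) * n * ∑ j, hE s (X j).fourier := by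
  have h1 : hE (s + 1) (potential X).fourier ≤ ENNReal.ofReal (2 ^ 2) * hE (s + 1 + -1)
      (fun ξ => ∑ j, ((‖(X j).fourier ξ‖ : ℝ) : ℂ)) := by
    refine hE_le_of_norm_le fun ξ => ?_
    rw [fourier_potential, ← Complex.ofReal_sum, Complex.norm_real,
      Real.norm_of_nonneg (Finset.sum_nonneg fun _ _ => norm_nonneg _)]
    exact norm_potentialCoeff_le X ξ
  rw [add_neg_cancel_right] at h1
  refine h1.trans ?_
  have h2 := hE_sum_le Finset.univ s fun j ξ => ((‖(X j).fourier ξ‖ : ℝ) : ℂ)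
  rw [Finset.card_univ, Fintype.card_fin] at h2
  have e : ∀ j, hE s (fun ξ => ((‖(X j).fourier ξ‖ : ℝ) : ℂ)) = hE s (X j).fourier := fun j => by
    simp only [hE, ← ofReal_norm, Complex.norm_real, norm_norm]
  simp only [e] at h2
  rw [mul_assoc]
  gcongr

theorem memLqHdot_potential {T s : ℝ} {X : ℝ → VecDist n} (h : ∀ k, MemLqH 2 T s fun t => X t k) :
    MemLqHdot 2 T (s + 1) fun t => potential (X t) := by
  have hm : FourierMeasurable T fun t => potential (X t) := fun ξ => by
    simp only [fourier_potential, potentialCoeff]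
    by_cases hξ : ξ = 0
    · simpa only [if_pos hξ] using aestronglyMeasurable_const
    · simp only [if_neg hξ, div_eq_mul_inv]
      exact (Finset.aestronglyMeasurable_fun_sum _ fun j _ =>
        ((h j).aestronglyMeasurable_fourier ξ).const_mul _).mul_const _
  have h1 : MemLqH 2 T (s + 1) fun t => potential (X t) :=
    memLqH_two_of_le hm (Eventually.of_forall fun t => hE_potential_le s (X t))
      (lintegral_mul_sum_hE_ne_top h (ENNReal.mul_ne_top ENNReal.ofReal_ne_top (by simp)))
  refine ⟨h1, ?_⟩
  filter_upwards [h1.ae_memH] with t ht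
  refine ⟨ht, ?_⟩
  rw [MeanZero, fourier_potential, potentialCoeff, if_pos rfl]

/-- `X` is a gradient if its Leray projection and its mean vanish. -/
theorem gradient_potential {X : VecDist n} (h0 : ∀ k, (X k).fourier 0 = 0)
    (hX : ∀ k ξ, lerayCoeff ξ (fun j => (X j).fourier ξ) k = 0) : gradient (potential X) = X := by
  funext k
  refine fourier_injective fun ξ => ?_
  rw [gradient, fourier_partialDeriv, fourier_potential, potentialCoeff]
  by_cases hξ : ξ = 0
  · rw [hξ, h0]; simp
  · have h1 := hX k ξ
    rw [lerayCoeff, if_neg hξ, sub_eq_zero] at h1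
    rw [if_neg hξ, h1]
    have hq : ((freqSq ξ : ℝ) : ℂ) ≠ 0 := by exact_mod_cast (freqSq_pos hξ).ne'
    have hpi : (Real.pi : ℂ) ≠ 0 := by exact_mod_cast Real.pi_ne_zero
    field_simp

/-- At a nonzero frequency some coordinate `ξ_k` is nonzero, and the `k`-th component of the
gradient determines the coefficient; the mean is fixed separately. -/
theorem eq_of_gradient {p q : TorusDist n} (hp : MeanZero p) (hq : MeanZero q)
    (h : ∀ w : Fin n → TestFn n, vecApply (gradient q) w = vecApply (gradient p) w) : q = p := by
  refine fourier_injective fun ξ => ?_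
  by_cases hξ : ξ = 0
  · rw [hξ, hp, hq]
  obtain ⟨k, hk⟩ := Function.ne_iff.mp hξ
  have h1 : ∀ φ, (gradient q k).1 φ = (gradient p k).1 φ := fun φ => by
    have h2 := h (Pi.single k φ)
    rwa [vecApply_single, vecApply_single] at h2
  have h3 : (gradient q k).fourier ξ = (gradient p k).fourier ξ := by
    rw [TorusDist.fourier, TorusDist.fourier, h1, h1]
  rw [gradient, gradient, fourier_partialDeriv, fourier_partialDeriv] at h3
  refine mul_left_cancel₀ ?_ h3
  have : (ξ k : ℂ) ≠ 0 := by exact_mod_cast hk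
  simp [Real.pi_ne_zero, this]

section Pressure

variable {T : ℝ} {a : Tensor n} {f u u' : ℝ → VecDist n}

/-- The gradient part of the equation, `f - A u - u' - (u·∇)u`. -/
def pressureForce (a : Tensor n) (f u u' : ℝ → VecDist n) (t : ℝ) : VecDist n := fun k =>
  forcing a f u t k - u' t k - convection (u t) k

theorem memLqH_pressureForce (hn : 2 ≤ n) (hT : 0 < T) (ha : IsViscosity T a)
    (hf : MemLqVecHdot 2 T (-1) f) (hu_inf : MemLqHdotSigma ∞ T 0 u)
    (hu_two : MemLqHdotSigma 2 T 1 u) (hu : SolvesWeakEquation T a f u u') (k : Fin n) :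
    MemLqH 2 T (-(n : ℝ) / 2) fun t => pressureForce a f u u' t k := by
  have hn' : (2 : ℝ) ≤ n := by exact_mod_cast hn
  exact (((memLqH_forcing ha hf hu_two k).mono_exp (by linarith)).sub
    ((memLqHdotSigma_timeDeriv hn hT ha hf hu_inf hu_two hu).1 k)).sub
      (memLqH_convection hn hu_inf hu_two k)

/-- Since `u'` is solenoidal, the projected equation says precisely that the Leray projection of the
residual vanishes. Its mean vanishes because each of the four terms has zero mean. -/
theorem ae_gradient_pressure (hn : 2 ≤ n) (hT : 0 < T) (ha : IsViscosity T a)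
    (hf : MemLqVecHdot 2 T (-1) f) (hu_inf : MemLqHdotSigma ∞ T 0 u)
    (hu_two : MemLqHdotSigma 2 T 1 u) (hu : SolvesWeakEquation T a f u u') :
    ∀ᵐ t ∂timeMeasure T,
      gradient (potential (pressureForce a f u u' t)) = pressureForce a f u u' t := by
  filter_upwards [hu.ae_eq_leray hT ha hu_two, hf.2, hu_two.2,
    (memLqHdotSigma_timeDeriv hn hT ha hf hu_inf hu_two hu).2] with t h1 h2 h3 h4
  refine gradient_potential (fun k => ?_) fun k ξ => ?_
  · have hvisc := viscDist_fourier_zero (fun i j α β x => a i j α β x t) (u t) k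
    rw [pressureForce, fourier_sub, fourier_sub, forcing, Pi.sub_apply, fourier_sub, h2.2 k,
      hvisc, h4.1.2 k, convection_fourier_zero h3.1.1 h3.2]
    simp
  · have h5 := congrArg (fun g : TorusDist n => g.fourier ξ) (congrFun h1 k)
    simp only [Pi.add_apply, fourier_add, fourier_leray, lerayCoeff] at h5
    have h6 := sum_coord_mul_fourier_eq_zero h4.2 ξ
    by_cases hξ : ξ = 0
    · rw [lerayCoeff, if_pos hξ]
    · rw [if_neg hξ, if_neg hξ] at h5
      rw [lerayCoeff, if_neg hξ]
      simp only [pressureForce, fourier_sub, mul_sub, Finset.sum_sub_distrib, h6]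
      linear_combination -h5

theorem isAssociatedPressure_potential (hn : 2 ≤ n) (hT : 0 < T) (ha : IsViscosity T a)
    (hf : MemLqVecHdot 2 T (-1) f) (hu_inf : MemLqHdotSigma ∞ T 0 u)
    (hu_two : MemLqHdotSigma 2 T 1 u) (hu : SolvesWeakEquation T a f u u') :
    IsAssociatedPressure T a f u u' fun t => potential (pressureForce a f u u' t) := by
  obtain ⟨K, hK⟩ := ha.exists_boundedCoeff
  filter_upwards [ae_gradient_pressure hn hT ha hf hu_inf hu_two hu, hK, hu_two.2]
    with t h1 h2 h3 w
  rw [h1, viscForm_toDist h2 h3.1.1]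
  simp only [vecApply, ← Finset.sum_add_distrib]
  refine Finset.sum_congr rfl fun k _ => ?_
  simp only [pressureForce, forcing, Pi.add_apply, Pi.sub_apply, Submodule.coe_add,
    Submodule.coe_sub, LinearMap.add_apply, LinearMap.sub_apply]
  ring

theorem IsAssociatedPressure.ae_unique {p q : ℝ → TorusDist n} {s r : ℝ}
    (hp : IsAssociatedPressure T a f u u' p) (hq : IsAssociatedPressure T a f u u' q)
    (hps : MemLqHdot 2 T s p) (hqs : MemLqHdot 2 T r q) : ∀ᵐ t ∂timeMeasure T, q t = p t := by
  filter_upwards [hp, hq, hps.2, hqs.2] with t h1 h2 h3 h4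
  exact eq_of_gradient h3.2 h4.2 fun w => by linarith [h1 w, h2 w]

end Pressure

end PeriodicNS

end

/-! ### Assembly of the statement -/

theorem lemmaL4p2 (n : ℕ) (hn : 2 ≤ n) (T : ℝ) (hT : 0 < T)
    (a : Tensor n) (ha : IsViscosity T a)
    (f : ℝ → VecDist n) (hf : MemLqVecHdot 2 T (-1) f)
    (u u' : ℝ → VecDist n)
    (hu_inf : MemLqHdotSigma ∞ T 0 u) (hu_two : MemLqHdotSigma 2 T 1 u)
    (hu : SolvesWeakEquation T a f u u') :
    -- (i)
    (MemLqHdotSigma 2 T (-1) (fun t => u' t + leray (convection (u t))) ∧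
      MemLqVecHdot 2 T (-(n : ℝ) / 2) (fun t => convection (u t)) ∧
      MemLqHdotSigma 2 T (-(n : ℝ) / 2) u' ∧
      MemW1Sigma T 1 (-(n : ℝ) / 2) u ∧
      HasDistribDeriv T (fun t => normSqH (-((n : ℝ) - 2) / 4) (u t))
        (fun t => 2 * vecDual (bessel (-(n : ℝ) / 2) (u' t)) (bessel 1 (u t))) ∧
      (∀ᵐ t ∂timeMeasure T,
        vecDual (bessel (-(n : ℝ) / 2) (u' t)) (bessel 1 (u t)) =
            vecDual (u' t) (bessel (1 - (n : ℝ) / 2) (u t)) ∧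
          vecDual (u' t) (bessel (1 - (n : ℝ) / 2) (u t)) =
            vecDual (bessel (1 - (n : ℝ) / 2) (u' t)) (u t))) ∧
    -- (ii), with the almost-everywhere form of the derivative identity in (i)
    (∃ v : ℝ → VecDist n,
      (∀ᵐ t ∂timeMeasure T, u t = v t) ∧
      (∀ t ∈ Set.Icc 0 T, MemHdotSigma (-((n : ℝ) - 2) / 4) (v t)) ∧
      (∀ t₀ ∈ Set.Icc 0 T,
        Tendsto (fun t => normSqH (-((n : ℝ) - 2) / 4) (v t - v t₀))
          (𝓝[Set.Icc 0 T] t₀) (𝓝 0)) ∧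
      (∀ t ∈ Set.Icc 0 T, MemHdotSigma 0 (v t)) ∧
      (∀ w : VecDist n, MemVecH 0 w → ∀ t₀ ∈ Set.Icc 0 T,
        Tendsto (fun t => vecDual (v t) w) (𝓝[Set.Icc 0 T] t₀) (𝓝 (vecDual (v t₀) w))) ∧
      (∀ᵐ t ∂timeMeasure T,
        HasDerivAt (fun τ => normSqH (-((n : ℝ) - 2) / 4) (v τ))
          (2 * vecDual (bessel (-(n : ℝ) / 2) (u' t)) (bessel 1 (u t))) t)) ∧
    -- (iii)
    (∃ p : ℝ → TorusDist n,
      MemLqHdot 2 T (1 - (n : ℝ) / 2) p ∧ IsAssociatedPressure T a f u u' p ∧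
      ∀ q : ℝ → TorusDist n,
        MemLqHdot 2 T (1 - (n : ℝ) / 2) q → IsAssociatedPressure T a f u u' q →
          ∀ᵐ t ∂timeMeasure T, q t = p t) := by
  have hderiv := memLqHdotSigma_timeDeriv hn hT ha hf hu_inf hu_two hu
  obtain ⟨c, M, H⟩ := exists_isInitial hT hu_inf hu_two hderiv hu.timeDeriv
  have hn' : (2 : ℝ) ≤ n := by exact_mod_cast hn
  have hp : MemLqHdot 2 T (1 - (n : ℝ) / 2) fun t => potential (pressureForce a f u u' t) := by
    have h := memLqHdot_potential (memLqH_pressureForce hn hT ha hf hu_inf hu_two hu)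
    rwa [show -(n : ℝ) / 2 + 1 = 1 - n / 2 by ring] at h
  have hpa := isAssociatedPressure_potential hn hT ha hf hu_inf hu_two hu
  refine ⟨⟨memLqHdotSigma_add_leray hT ha hf hu_two hu, memLqVecHdot_convection hn hu_inf hu_two,
    hderiv, ⟨hu_two, u', hu.timeDeriv, hderiv⟩, H.hasDistribDeriv_normSqH hn,
    Eventually.of_forall fun t => ⟨?_, ?_⟩⟩,
    ⟨contRepr T u' c, H.ae_eq, fun t ht => H.memHdotSigma_of_nonpos (by linarith) ht,
      fun t₀ ht₀ => H.tendsto_normSqH_sub hn ht₀, fun t ht => H.memHdotSigma_zero ht,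
      fun w hw t₀ ht₀ => H.tendsto_vecDual hw ht₀, H.ae_hasDerivAt_normSqH hn⟩,
    ⟨_, hp, hpa, fun q hq hqa => hpa.ae_unique hqa hp hq⟩⟩
  · rw [vecDual_bessel_bessel, vecDual_bessel_right,
      show -(n : ℝ) / 2 + 1 = 1 - n / 2 by ring]
  · rw [vecDual_bessel_right, vecDual_bessel_left]
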